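/- **Setting.** Let $d\in\{2,3\}$, let $\Omega\subseteq\mathbb R^d$ be a bounded open set which is the interior of its closure (every Lipschitz domain has this property), and let $\mathcal M$ be a matching simplicial mesh of $\Omega$: a finite set of closed nondegenerate $d$-simplices with union $\overline\Omega$ such that, for all $K,K'\in\mathcal M$, the set $K\cap K'$ is either empty or the convex hull of a subset of the vertices of $K$. The $(d-1)$-dimensional faces of the simplices in $\mathcal M$ are called faces, $\mathcal F_K$ is the set of all faces contained in $K$, an interface is a face $F$ of the form $F=K_1\cap K_2$ with $K_1,K_2\in\mathcal M$, $\mathcal F^i$ is the set of all interfaces, and $\Sigma$ is the union of all faces, with the $(d-1)$-dimensional surface measure. For a simplex or a face, $h$ is its diameter and $m$ its barycenter. Let $r_K$ be the radius of the largest ball contained in $K$ and $\gamma:=\max_{K\in\mathcal M}h_K/r_K$. Let $p\in\mathbb N_0$; $\mathbb P_k$ denotes the polynomials of total degree $\le k$, and $\mathbb P_{-1}=\{0\}$. Elements of $H^1(\Omega)$ or $H^1_0(\Omega)$ that are piecewise polynomial on $\mathcal M$ are identified with their continuous representatives on $\overline\Omega$. **Operators.** * For $K\in\mathcal M$, $\Phi_K\in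 H^1_0(\Omega)$ is determined by $\Phi_K=0$ off $K$, $\Phi_K|_K\in\mathbb P_{d+1}(K)$, $\Phi_K(m_K)=1$; and $B_Kv\in\mathbb P_{p-1}(K)$ is determined, for $v\in L^2(\Omega)$, by $\int_K q\,(B_Kv)\,\Phi_K=\int_K q\,v$ for all $q\in\mathbb P_{p-1}(K)$. Set $B_{\mathcal M}v:=\sum_{K\in\mathcal M}(B_Kv)\Phi_K$. * For $F=K_1\cap K_2\in\mathcal F^i$, $\Phi_F\in H^1_0(\Omega)$ is determined by $\Phi_F=0$ off $K_1\cup K_2$, $\Phi_F|_{K_j}\in\mathbb P_d(K_j)$ for $j=1,2$, $\Phi_F(m_F)=1$; and $B_Fv\in\mathbb P_p(F)$ is determined, for $v\in L^2(\Sigma)$, by $\int_F r\,(B_Fv)\,\Phi_F=\int_F r\,v$ for all $r\in\mathbb P_p(F)$. * For $p\ge1$, let $\mathcal L_p$ be the set of Lagrange nodes of degree $p$ of $\mathcal M$ and, for $z\in\mathcal L_p$, let $\Phi_z\in H^1(\Omega)$ be the function that is a polynomial of degree $\le p$ on each $K\in\mathcal M$ and satisfies $\Phi_z(z')=\delta_{zz'}$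 for all $z'\in\mathcal L_p$. Set $$B_\Sigma v:=\sum_{F\in\mathcal F^i}\ \sum_{z\in\mathcal L_p\cap F}(B_Fv)(z)\,\Phi_z\,\Phi_F\quad(p\ge1),\qquad B_\Sigma v:=\sum_{F\in\mathcal F^i}(B_Fv)\,\Phi_F\quad(p=0),$$ where for $p=0$ the constant $B_Fv$ is extended to $\Omega$ as a constant. **Proposition (Bubble smoother).** All these objects are well defined, and the operator $$B\hat v:=B_\Sigma v_\Sigma+B_{\mathcal M}(v_{\mathcal M}-B_\Sigma v_\Sigma),\qquad \hat v=(v_{\mathcal M},v_\Sigma)\in L^2(\Omega)\times L^2(\Sigma),$$ is a linear operator from $L^2(\Omega)\times L^2(\Sigma)$ into $H^1_0(\Omega)$ whose values are continuous functions. It preserves moments, $$\int_K q\,(B\hat v)=\int_K q\,v_{\mathcal M}\quad(K\in\mathcal M,\ q\in\mathbb P_{p-1}(K)),\qquad \int_F r\,(B\hat v)=\int_F r\,v_\Sigma\quad(F\in\mathcal F^i,\ r\in\mathbb P_p(F)),$$ and for all $K\in\mathcal M$ it satisfies $$\|\nabla B\hat v\|_{L^2(K)}\le C_{\gamma,p}\Big(h_K^{-1}\|v_{\mathcal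 M}\|_{L^2(K)}+\sum_{F\in\mathcal F_K}h_F^{-1/2}\|v_\Sigma\|_{L^2(F)}\Big),$$ where $C_{\gamma,p}$ depends only on $\gamma$ and $p$ and is nondecreasing in each of them. -/

import Mathlib

open MeasureTheory Filter Topology

namespace BubbleSmoother

/-- The Euclidean space `ℝ^d`. -/
abbrev Eucl (d : ℕ) : Type := EuclideanSpace ℝ (Fin d)

/-! ### Sobolev spaces -/

/-- `φ` is a test function on `Ω`: smooth with compact support contained in `Ω`. -/
def IsTestFunction {d : ℕ} (Ω : Set (Eucl d)) (φ : Eucl d → ℝ) : Prop :=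
  ContDiff ℝ ((⊤ : ℕ∞) : WithTop ℕ∞) φ ∧ HasCompactSupport φ ∧ tsupport φ ⊆ Ω

/-- `f ∈ L²(Ω)` has the weak gradient `g ∈ L²(Ω; ℝ^d)` in `Ω`. -/
def HasWeakGradient {d : ℕ} (Ω : Set (Eucl d)) (f : Eucl d → ℝ) (g : Eucl d → Eucl d) : Prop :=
  MemLp f 2 (volume.restrict Ω) ∧ MemLp g 2 (volume.restrict Ω) ∧
    ∀ φ : Eucl d → ℝ, IsTestFunction Ω φ →
      ∫ x in Ω, f x • gradient φ x = -∫ x in Ω, φ x • g x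

/-- `f ∈ H¹(Ω)`. -/
def MemH1 {d : ℕ} (Ω : Set (Eucl d)) (f : Eucl d → ℝ) : Prop :=
  ∃ g : Eucl d → Eucl d, HasWeakGradient Ω f g

/-- `f ∈ H¹₀(Ω)`: `f` is the limit in the `H¹(Ω)`-norm of a sequence of test functions on `Ω`. -/
def MemH10 {d : ℕ} (Ω : Set (Eucl d)) (f : Eucl d → ℝ) : Prop :=
  ∃ g : Eucl d → Eucl d, HasWeakGradient Ω f g ∧
    ∃ φ : ℕ → Eucl d → ℝ, (∀ n, IsTestFunction Ω (φ n)) ∧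
      Tendsto (fun n => eLpNorm (fun x => φ n x - f x) 2 (volume.restrict Ω)) atTop (𝓝 0) ∧
      Tendsto (fun n => eLpNorm (fun x => gradient (φ n) x - g x) 2 (volume.restrict Ω))
        atTop (𝓝 0)

/-! ### Polynomials and simplices -/

/-- `f` coincides on `S` with a polynomial of total degree at most `k`. The degree `k` is an
integer, so that only the zero polynomial is admitted for `k = -1`. -/
def IsPolyOn {d : ℕ} (k : ℤ) (S : Set (Eucl d)) (f : Eucl d → ℝ) : Prop :=
  ∃ q : MvPolynomial (Fin d) ℝ, (∀ m ∈ q.support, (m.degree : ℤ) ≤ k) ∧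
    ∀ x ∈ S, f x = MvPolynomial.eval (fun i => x i) q

/-- The closed simplex with the vertex set `T`. -/
def hull {d : ℕ} (T : Finset (Eucl d)) : Set (Eucl d) :=
  convexHull ℝ (T : Set (Eucl d))

/-- The barycenter of the simplex with the vertex set `T`. -/
noncomputable def barycenter {d : ℕ} (T : Finset (Eucl d)) : Eucl d :=
  (T.card : ℝ)⁻¹ • ∑ a ∈ T, a

/-- The diameter of the simplex with the vertex set `T`. -/
noncomputable def size {d : ℕ} (T : Finset (Eucl d)) : ℝ :=
  Metric.diam (hull T)

/-- The radius of the largest ball inscribed in the simplex with the vertex set `T`. -/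
noncomputable def inradius {d : ℕ} (T : Finset (Eucl d)) : ℝ :=
  sSup {r : ℝ | ∃ x, Metric.closedBall x r ⊆ hull T}

open Classical in
/-- The Lagrange nodes of degree `p ≥ 1` of the simplex with the vertex set `T`: the points
`∑ a ∈ T, (α a / p) • a` with natural numbers `α a` of sum `p`. -/
noncomputable def simplexNodes {d : ℕ} (p : ℕ) (T : Finset (Eucl d)) : Finset (Eucl d) :=
  (T.piAntidiag p).image fun α => ∑ a ∈ T, ((α a : ℝ) / (p : ℝ)) • a

/-! ### Matching simplicial meshes -/

/-- A matching simplicial mesh of `Ω`. A cell is given by its set of `d + 1` vertices. -/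
structure SimplicialMesh {d : ℕ} (Ω : Set (Eucl d)) where
  cells : Finset (Finset (Eucl d))
  card_eq : ∀ T ∈ cells, T.card = d + 1
  indep : ∀ T ∈ cells, AffineIndependent ℝ (fun a : T => (a : Eucl d))
  matching : ∀ T ∈ cells, ∀ T' ∈ cells, ∃ S ⊆ T, hull T ∩ hull T' = hull S
  cover : ⋃ T ∈ cells, hull T = closure Ω

namespace SimplicialMesh

variable {d : ℕ} {Ω : Set (Eucl d)}

open Classical in
/-- The `(d - 1)`-dimensional faces of the cells; a face is given by its set of `d` vertices. -/
noncomputable def faces (M : SimplicialMesh Ω) : Finset (Finset (Eucl d)) :=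
  M.cells.biUnion fun T => T.powersetCard d

open Classical in
/-- The interfaces: the faces of the form `K₁ ∩ K₂` with cells `K₁`, `K₂`. -/
noncomputable def interfaces (M : SimplicialMesh Ω) : Finset (Finset (Eucl d)) :=
  M.faces.filter fun F => ∃ T₁ ∈ M.cells, ∃ T₂ ∈ M.cells, hull F = hull T₁ ∩ hull T₂

open Classical in
/-- The faces of the mesh that are contained in the cell with the vertex set `T`. -/
noncomputable def facesOf (M : SimplicialMesh Ω) (T : Finset (Eucl d)) :
    Finset (Finset (Eucl d)) :=
  M.faces.filter fun F => hull F ⊆ hull T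

/-- The skeleton: the union of all faces. -/
def skeleton (M : SimplicialMesh Ω) : Set (Eucl d) :=
  ⋃ F ∈ M.faces, hull F

/-- The shape parameter: the maximum over the cells of the ratio of diameter and inradius. -/
noncomputable def shapeParameter (M : SimplicialMesh Ω) : ℝ :=
  sSup ((fun T => size T / inradius T) '' (M.cells : Set (Finset (Eucl d))))

open Classical in
/-- The Lagrange nodes of degree `p ≥ 1` of the mesh. -/
noncomputable def nodes (M : SimplicialMesh Ω) (p : ℕ) : Finset (Eucl d) :=
  M.cells.biUnion (simplexNodes p)

/-- `v ∈ L²(Ω)`. -/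
def MemL2Cells (_M : SimplicialMesh Ω) (v : Eucl d → ℝ) : Prop :=
  MemLp v 2 (volume.restrict Ω)

/-- `v ∈ L²(Σ)` for the skeleton `Σ` with the `(d - 1)`-dimensional surface measure. -/
def MemL2Skeleton (M : SimplicialMesh Ω) (v : Eucl d → ℝ) : Prop :=
  MemLp v 2 ((μHE[d - 1]).restrict M.skeleton)

/-! ### Bubbles, Lagrange basis and local operators -/

/-- The conditions determining the element bubble of the cell `T`. The piecewise polynomial
element of `H¹₀(Ω)` is represented by its continuous representative, extended by zero. -/
def IsElementBubble (_M : SimplicialMesh Ω) (T : Finset (Eucl d)) (Φ : Eucl d → ℝ) : Prop :=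
  Continuous Φ ∧ MemH10 Ω Φ ∧ (∀ x ∉ hull T, Φ x = 0) ∧
    IsPolyOn ((d : ℤ) + 1) (hull T) Φ ∧ Φ (barycenter T) = 1

/-- The conditions determining the face bubble of the interface `F`. The piecewise polynomial
element of `H¹₀(Ω)` is represented by its continuous representative, extended by zero. -/
def IsFaceBubble (M : SimplicialMesh Ω) (F : Finset (Eucl d)) (Φ : Eucl d → ℝ) : Prop :=
  Continuous Φ ∧ MemH10 Ω Φ ∧
    (∃ T₁ ∈ M.cells, ∃ T₂ ∈ M.cells, hull F = hull T₁ ∩ hull T₂ ∧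
      (∀ x ∉ hull T₁ ∪ hull T₂, Φ x = 0) ∧
      IsPolyOn (d : ℤ) (hull T₁) Φ ∧ IsPolyOn (d : ℤ) (hull T₂) Φ) ∧
    Φ (barycenter F) = 1

open Classical in
/-- The conditions determining the basis function of degree `p` associated with the node `z`:
it lies in `H¹(Ω)`, is a polynomial of degree at most `p` on each closed cell, and takes the value
`1` at `z` and `0` at all other nodes; outside `closure Ω` it is set to zero. -/
def IsLagrangeBasis (M : SimplicialMesh Ω) (p : ℕ) (z : Eucl d) (Φ : Eucl d → ℝ) : Prop :=
  MemH1 Ω Φ ∧ (∀ x ∉ closure Ω, Φ x = 0) ∧ (∀ T ∈ M.cells, IsPolyOn (p : ℤ) (hull T) Φ) ∧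
    ∀ z' ∈ M.nodes p, Φ z' = if z' = z then 1 else 0

/-- The element bubble of the cell `T`. -/
noncomputable def elementBubble (M : SimplicialMesh Ω) (T : Finset (Eucl d)) : Eucl d → ℝ :=
  Classical.epsilon (M.IsElementBubble T)

/-- The face bubble of the interface `F`. -/
noncomputable def faceBubble (M : SimplicialMesh Ω) (F : Finset (Eucl d)) : Eucl d → ℝ :=
  Classical.epsilon (M.IsFaceBubble F)

/-- The Lagrange basis function of degree `p` associated with the node `z`. -/
noncomputable def lagrangeBasis (M : SimplicialMesh Ω) (p : ℕ) (z : Eucl d) : Eucl d → ℝ :=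
  Classical.epsilon (M.IsLagrangeBasis p z)

/-- The conditions determining the local operator of the cell `T`, applied to `v`: `b` is a
polynomial of degree at most `p - 1` on the cell (set to zero elsewhere) and
`∫_K q b Φ_K = ∫_K q v` for all polynomials `q` of degree at most `p - 1`. -/
def IsCellOp (M : SimplicialMesh Ω) (p : ℕ) (T : Finset (Eucl d)) (v b : Eucl d → ℝ) : Prop :=
  IsPolyOn ((p : ℤ) - 1) (hull T) b ∧ (∀ x ∉ hull T, b x = 0) ∧
    ∀ q : Eucl d → ℝ, IsPolyOn ((p : ℤ) - 1) (hull T) q →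
      ∫ x in hull T, q x * b x * M.elementBubble T x = ∫ x in hull T, q x * v x

/-- The conditions determining the local operator of the interface `F`, applied to `v`: `b` is a
polynomial of degree at most `p` on the interface (set to zero elsewhere) and
`∫_F r b Φ_F = ∫_F r v` for all polynomials `r` of degree at most `p`. -/
def IsFaceOp (M : SimplicialMesh Ω) (p : ℕ) (F : Finset (Eucl d)) (v b : Eucl d → ℝ) : Prop :=
  IsPolyOn (p : ℤ) (hull F) b ∧ (∀ x ∉ hull F, b x = 0) ∧
    ∀ r : Eucl d → ℝ, IsPolyOn (p : ℤ) (hull F) r →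
      ∫ x in hull F, r x * b x * M.faceBubble F x ∂μHE[d - 1] =
        ∫ x in hull F, r x * v x ∂μHE[d - 1]

/-- The local operator `B_K` of the cell `T`. -/
noncomputable def cellOp (M : SimplicialMesh Ω) (p : ℕ) (T : Finset (Eucl d))
    (v : Eucl d → ℝ) : Eucl d → ℝ :=
  Classical.epsilon (M.IsCellOp p T v)

/-- The local operator `B_F` of the interface `F`. -/
noncomputable def faceOp (M : SimplicialMesh Ω) (p : ℕ) (F : Finset (Eucl d))
    (v : Eucl d → ℝ) : Eucl d → ℝ :=
  Classical.epsilon (M.IsFaceOp p F v)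

/-! ### The bubble smoother -/

/-- The operator `B_𝓜`. -/
noncomputable def meshOp (M : SimplicialMesh Ω) (p : ℕ) (v : Eucl d → ℝ) : Eucl d → ℝ :=
  fun x => ∑ T ∈ M.cells, M.cellOp p T v x * M.elementBubble T x

open Classical in
/-- The operator `B_Σ`. For `p = 0` the function `B_F v` is constant on `F`; its constant extension
is written through its value at the barycenter of `F`. -/
noncomputable def skeletonOp (M : SimplicialMesh Ω) (p : ℕ) (v : Eucl d → ℝ) : Eucl d → ℝ :=
  fun x =>
    if p = 0 then
      ∑ F ∈ M.interfaces, M.faceOp p F v (barycenter F) * M.faceBubble F x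
    else
      ∑ F ∈ M.interfaces, ∑ z ∈ (M.nodes p).filter (fun z => z ∈ hull F),
        M.faceOp p F v z * M.lagrangeBasis p z x * M.faceBubble F x

/-- The bubble smoother `B (v_𝓜, v_Σ) = B_Σ v_Σ + B_𝓜 (v_𝓜 - B_Σ v_Σ)`. -/
noncomputable def smoother (M : SimplicialMesh Ω) (p : ℕ) (vM vS : Eucl d → ℝ) : Eucl d → ℝ :=
  fun x => M.skeletonOp p vS x + M.meshOp p (fun y => vM y - M.skeletonOp p vS y) x

end SimplicialMesh

end BubbleSmoother

/-! All objects of the construction are explicit. By the matching condition, the barycentric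
coordinates of two cells agree on their common points (`bary_eq_of_mem`), so they glue to hat
functions. The element and face bubbles are the normalized products of the hats over the vertices of
the cell or interface, and the Lagrange functions are products of binomial coefficients in the
scaled hats. Uniqueness is unisolvence: a polynomial of degree at most $p\ge1$ on a simplex is
determined by its values at the Lagrange nodes of degree $p$ (`IsCell.eq_zero_of_nodes`). For the
bubbles, continuity and the support condition force the value zero at every node except one
barycenter.

For membership in $H^1_0$, a function that is polynomial on each closed cell and vanishes off
$\Omega$ is Lipschitz, and Lipschitz functions vanishing off a bounded open set lie in $H^1_0$
(`memH10_of_lipschitz`): soft thresholding makes the support compact, and mollification then gives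
test functions. That a face bubble vanishes off $\Omega$ rests on geometry: the two cells at an
interface lie on opposite sides of it (`opposite`), no third cell contains it, so its open star lies
in the interior of $\overline\Omega$, which is $\Omega$.

The moments are preserved because the construction is triangular. On an interface $F$ all cell
bubbles and all other face bubbles vanish, and the extension of $B_Fv$ restricts to $B_Fv$; so the
trace is $(B_Fv)\Phi_F$, which has the right moments by definition of $B_F$. In a cell, $B_K$
applied to the residual $v_{\mathcal M}-B_\Sigma v_\Sigma$ restores exactly the moments that
$B_\Sigma v_\Sigma$ spoils.

Stability is a scaling argument. The local moment problems are transported to the reference simplex,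
where their solvability and bounds follow from positivity of the bubble and finite dimension
(`exists_moments`); the measure factor cancels (`exists_localOp`). An inverse estimate
(`exists_gradient_le`) bounds the gradient by $r_K^{-1}$ times the $L^2$ norm, and $|K|/|F|\lesssim
h_K\gamma^{d-1}$ (`exists_volume_le`) turns face norms into cell norms. Each of the two estimates
costs at most one factor $\max(\gamma,1)$, so the constant is $c_{d,p}\max(\gamma,1)^2$. -/

namespace BubbleSmoother

/-! ### Polynomial functions -/

/-- The space of polynomials in `n` variables of total degree at most the integer `k`. -/
noncomputable def polySpace (n : ℕ) (k : ℤ) : Submodule ℝ (MvPolynomial (Fin n) ℝ) :=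
  MvPolynomial.restrictSupport ℝ {m | (m.degree : ℤ) ≤ k}

theorem mem_polySpace {n : ℕ} {k : ℤ} {q : MvPolynomial (Fin n) ℝ} :
    q ∈ polySpace n k ↔ ∀ m ∈ q.support, (m.degree : ℤ) ≤ k := Iff.rfl

theorem mem_polySpace_natCast {n k : ℕ} {q : MvPolynomial (Fin n) ℝ} :
    q ∈ polySpace n (k : ℤ) ↔ q.totalDegree ≤ k := by
  rw [mem_polySpace, MvPolynomial.totalDegree, Finset.sup_le_iff]
  simp only [Finsupp.degree_eq_sum, Finsupp.sum_fintype, implies_true]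
  norm_cast

theorem polySpace_mono {n : ℕ} {k l : ℤ} (h : k ≤ l) : polySpace n k ≤ polySpace n l :=
  fun _ hq _ hm => (hq hm).trans h

instance (n : ℕ) (k : ℤ) : FiniteDimensional ℝ (polySpace n k) := by
  have : polySpace n k ≤ MvPolynomial.restrictTotalDegree (Fin n) ℝ k.toNat := by
    intro q hq
    rw [MvPolynomial.mem_restrictTotalDegree, ← mem_polySpace_natCast]
    exact polySpace_mono (Int.self_le_toNat k) hq
  exact Submodule.finiteDimensional_of_le this

theorem mul_mem_polySpace {n : ℕ} {k l : ℤ} {p q : MvPolynomial (Fin n) ℝ}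
    (hp : p ∈ polySpace n k) (hq : q ∈ polySpace n l) : p * q ∈ polySpace n (k + l) := by
  classical
  rw [mem_polySpace] at *
  intro m hm
  obtain ⟨a, ha, b, hb, rfl⟩ := Finset.mem_add.1 (MvPolynomial.support_mul p q hm)
  rw [map_add]
  push_cast
  exact add_le_add (hp a ha) (hq b hb)

theorem C_mem_polySpace {n : ℕ} (c : ℝ) : MvPolynomial.C c ∈ polySpace n 0 := by
  have : MvPolynomial.C c ∈ polySpace n ((0 : ℕ) : ℤ) := by
    rw [mem_polySpace_natCast]; simp
  simpa using this

theorem X_mem_polySpace {n : ℕ} (i : Fin n) : MvPolynomial.X i ∈ polySpace n 1 := by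
  have : (MvPolynomial.X i : MvPolynomial (Fin n) ℝ) ∈ polySpace n ((1 : ℕ) : ℤ) := by
    rw [mem_polySpace_natCast]; simp
  simpa using this

section IsPolyOn

variable {d : ℕ} {k l : ℤ} {S S' : Set (Eucl d)} {f g : Eucl d → ℝ}

theorem isPolyOn_iff : IsPolyOn k S f ↔
    ∃ q ∈ polySpace d k, ∀ x ∈ S, f x = MvPolynomial.eval (fun i => x i) q := Iff.rfl

theorem IsPolyOn.mono_set (h : IsPolyOn k S f) (hS : S' ⊆ S) : IsPolyOn k S' f := by
  obtain ⟨q, hq, hf⟩ := h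
  exact ⟨q, hq, fun x hx => hf x (hS hx)⟩

theorem IsPolyOn.mono_deg (h : IsPolyOn k S f) (hk : k ≤ l) : IsPolyOn l S f := by
  obtain ⟨q, hq, hf⟩ := h
  exact ⟨q, polySpace_mono hk hq, hf⟩

theorem IsPolyOn.congr (h : IsPolyOn k S f) (hg : ∀ x ∈ S, g x = f x) : IsPolyOn k S g := by
  obtain ⟨q, hq, hf⟩ := h
  exact ⟨q, hq, fun x hx => (hg x hx).trans (hf x hx)⟩

theorem isPolyOn_const (c : ℝ) : IsPolyOn 0 S fun _ => c :=
  isPolyOn_iff.2 ⟨MvPolynomial.C c, C_mem_polySpace c, by simp⟩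

theorem isPolyOn_zero : IsPolyOn k S fun _ => 0 :=
  isPolyOn_iff.2 ⟨0, zero_mem _, by simp⟩

theorem IsPolyOn.add (hf : IsPolyOn k S f) (hg : IsPolyOn k S g) :
    IsPolyOn k S fun x => f x + g x := by
  rw [isPolyOn_iff] at *
  obtain ⟨p, hp, hf⟩ := hf
  obtain ⟨q, hq, hg⟩ := hg
  exact ⟨p + q, add_mem hp hq, fun x hx => by simp [hf x hx, hg x hx]⟩

theorem IsPolyOn.const_mul (hf : IsPolyOn k S f) (c : ℝ) : IsPolyOn k S fun x => c * f x := by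
  rw [isPolyOn_iff] at *
  obtain ⟨p, hp, hf⟩ := hf
  exact ⟨c • p, Submodule.smul_mem _ _ hp, fun x hx => by
    simp [hf x hx, MvPolynomial.smul_eval]⟩

theorem IsPolyOn.sub (hf : IsPolyOn k S f) (hg : IsPolyOn k S g) :
    IsPolyOn k S fun x => f x - g x :=
  (hf.add (hg.const_mul (-1))).congr fun x _ => by ring

theorem IsPolyOn.mul (hf : IsPolyOn k S f) (hg : IsPolyOn l S g) :
    IsPolyOn (k + l) S fun x => f x * g x := by
  rw [isPolyOn_iff] at *
  obtain ⟨p, hp, hf⟩ := hf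
  obtain ⟨q, hq, hg⟩ := hg
  exact ⟨p * q, mul_mem_polySpace hp hq, fun x hx => by simp [hf x hx, hg x hx]⟩

theorem IsPolyOn.sum {ι : Type*} {s : Finset ι} {F : ι → Eucl d → ℝ}
    (h : ∀ i ∈ s, IsPolyOn k S (F i)) : IsPolyOn k S fun x => ∑ i ∈ s, F i x := by
  classical
  induction s using Finset.induction_on with
  | empty => simpa using isPolyOn_zero
  | insert a s ha ih =>
    simp only [Finset.sum_insert ha]
    exact (h a (by simp)).add (ih fun i hi => h i (by simp [hi]))

theorem IsPolyOn.prod {ι : Type*} {s : Finset ι} {F : ι → Eucl d → ℝ} {e : ι → ℤ}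
    (h : ∀ i ∈ s, IsPolyOn (e i) S (F i)) :
    IsPolyOn (∑ i ∈ s, e i) S fun x => ∏ i ∈ s, F i x := by
  classical
  induction s using Finset.induction_on with
  | empty => simpa using isPolyOn_const 1
  | insert a s ha ih =>
    simp only [Finset.sum_insert ha, Finset.prod_insert ha]
    exact (h a (by simp)).mul (ih fun i hi => h i (by simp [hi]))

theorem isPolyOn_coord (i : Fin d) : IsPolyOn 1 S fun x => x i :=
  isPolyOn_iff.2 ⟨MvPolynomial.X i, X_mem_polySpace i, by simp⟩

theorem isPolyOn_affine (φ : Eucl d →ᵃ[ℝ] ℝ) : IsPolyOn 1 S fun x => φ x := by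
  have h : ∀ x : Eucl d, φ x = ∑ i, φ.linear (EuclideanSpace.single i 1) * x i + φ 0 := by
    intro x
    have h1 : x = ∑ i, x i • EuclideanSpace.single i (1 : ℝ) := by
      ext j; simp [Finset.sum_apply, Pi.single_apply]
    have h2 : φ x = φ.linear x + φ 0 := by
      have := φ.map_vadd 0 x
      simpa using this
    rw [h2]
    conv_lhs => rw [h1]
    simp [map_sum, mul_comm]
  refine IsPolyOn.congr (f := fun x => ∑ i, φ.linear (EuclideanSpace.single i 1) * x i + φ 0) ?_
    fun x _ => h x
  refine IsPolyOn.add (IsPolyOn.sum fun i _ => (isPolyOn_coord i).const_mul _) ?_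
  exact (isPolyOn_const _).mono_deg (by norm_num)

/-- Substitution of an affine map does not raise the degree. -/
theorem IsPolyOn.comp_affine {n : ℕ} (hf : IsPolyOn k S f) (A : Eucl n →ᵃ[ℝ] Eucl d)
    {Q : Set (Eucl n)} (hA : ∀ y ∈ Q, A y ∈ S) : IsPolyOn k Q fun y => f (A y) := by
  obtain ⟨q, hq, hf⟩ := hf
  have key : IsPolyOn k Q fun y => ∑ m ∈ q.support, q.coeff m * ∏ i, A y i ^ m i := by
    refine IsPolyOn.sum fun m hm => IsPolyOn.const_mul ?_ _
    have h1 : IsPolyOn (∑ i, (m i : ℤ)) Q fun y => ∏ i, A y i ^ m i := by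
      refine IsPolyOn.prod fun i _ => ?_
      have h2 : IsPolyOn (∑ j ∈ Finset.range (m i), 1) Q
          fun y => ∏ j ∈ Finset.range (m i), A y i := by
        refine IsPolyOn.prod fun j _ => ?_
        let π : Eucl d →ᵃ[ℝ] ℝ := (EuclideanSpace.proj i : Eucl d →L[ℝ] ℝ).toLinearMap.toAffineMap
        exact isPolyOn_affine (π.comp A)
      simpa using h2
    refine h1.mono_deg ?_
    have := hq m hm
    rw [Finsupp.degree_eq_sum] at this
    exact_mod_cast this
  refine key.congr fun y hy => ?_
  rw [hf _ (hA y hy), MvPolynomial.eval_eq']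

theorem IsPolyOn.exists_contDiff (hf : IsPolyOn k S f) :
    ∃ P : Eucl d → ℝ, ContDiff ℝ ((⊤ : ℕ∞) : WithTop ℕ∞) P ∧ IsPolyOn k Set.univ P ∧
      ∀ x ∈ S, f x = P x := by
  obtain ⟨q, hq, hf⟩ := hf
  refine ⟨fun x => MvPolynomial.eval (fun i => x i) q, ?_, ⟨q, hq, fun _ _ => rfl⟩, hf⟩
  simp only [MvPolynomial.eval_eq']
  fun_prop

theorem IsPolyOn.continuousOn (hf : IsPolyOn k S f) : ContinuousOn f S := by
  obtain ⟨P, hP, -, h⟩ := hf.exists_contDiff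
  exact hP.continuous.continuousOn.congr h

end IsPolyOn

/-- A polynomial of degree at most `p` vanishing at the points `m / p`, `m ∈ ℕ^d`, `|m| ≤ p`,
is zero. -/
theorem eq_zero_of_eval_lattice {n p : ℕ} (hp : 1 ≤ p) {q : MvPolynomial (Fin n) ℝ}
    (hq : q ∈ polySpace n (p : ℤ))
    (h : ∀ m : Fin n → ℕ, ∑ i, m i ≤ p → MvPolynomial.eval (fun i => (m i : ℝ) / p) q = 0) :
    q = 0 := by
  by_contra hne
  obtain ⟨t, ht, hdeg⟩ : ∃ t ∈ q.support, q.totalDegree = t.degree := by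
    obtain ⟨t, ht, h'⟩ := Finset.exists_mem_eq_sup q.support
      (MvPolynomial.support_nonempty.2 hne) (fun s => s.sum fun _ e => e)
    refine ⟨t, ht, ?_⟩
    rw [MvPolynomial.totalDegree, h', Finsupp.degree_eq_sum, Finsupp.sum_fintype _ _ (by simp)]
  have hp0 : (p : ℝ) ≠ 0 := by positivity
  -- For a monomial $t$ of top degree, the combinatorial Nullstellensatz gives a nonzero value on
  -- any grid with $t_i+1$ points in direction $i$. The grid $\{0,\dots,t_i\}/p$ stays within the
  -- lattice, because $|t|\le p$.
  obtain ⟨s, hs, hev⟩ := MvPolynomial.combinatorial_nullstellensatz_exists_eval_nonzero q t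
    (MvPolynomial.mem_support_iff.1 ht) hdeg
    (fun i => (Finset.range (t i + 1)).image fun j : ℕ => (j : ℝ) / p) (fun i => by
      rw [Finset.card_image_of_injective]
      · simp
      · intro a b hab
        simpa [div_left_inj' hp0] using hab)
  choose m hm hms using fun i => Finset.mem_image.1 (hs i)
  refine hev ?_
  rw [← funext hms]
  refine h m ?_
  have h1 : q.totalDegree ≤ p := mem_polySpace_natCast.1 hq
  rw [hdeg, Finsupp.degree_eq_sum] at h1
  refine (Finset.sum_le_sum fun i _ => ?_).trans h1
  have := Finset.mem_range.1 (hm i)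
  omega

/-- A polynomial vanishing on a nonempty open set is zero. -/
theorem eq_zero_of_eval_isOpen {n : ℕ} {q : MvPolynomial (Fin n) ℝ} {U : Set (Eucl n)}
    (hU : IsOpen U) (hne : U.Nonempty) (h : ∀ y ∈ U, MvPolynomial.eval (fun i => y i) q = 0) :
    q = 0 := by
  obtain ⟨y, hy⟩ := hne
  have hU' : IsOpen {z : Fin n → ℝ | WithLp.toLp 2 z ∈ U} :=
    hU.preimage (PiLp.continuous_toLp 2 _)
  obtain ⟨ε, hε, hb⟩ := Metric.isOpen_iff.1 hU' (fun i => y i) hy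
  -- In the sup norm a ball is a box, and a polynomial vanishing on a product of infinite sets is
  -- zero.
  refine MvPolynomial.funext_set (fun i => Metric.ball (y i) ε) (fun i => ?_) fun z hz => ?_
  · rw [Real.ball_eq_Ioo]
    exact Set.Ioo_infinite (by linarith)
  · rw [map_zero]
    have : z ∈ Metric.ball (fun i => y i) ε := by
      rw [ball_pi _ hε]; exact hz
    exact h _ (hb this)

/-! ### Barycentric coordinates -/

section Barycentric

variable {d : ℕ} {T S : Finset (Eucl d)}

/-- The coordinates are those of the affine basis formed by the vertices. Points that are not
vertices get the zero function, so later statements can quantify over all points. -/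
theorem exists_bary (hc : T.card = d + 1)
    (hT : AffineIndependent ℝ (fun a : T => (a : Eucl d))) :
    ∃ l : Eucl d → Eucl d →ᵃ[ℝ] ℝ, (∀ x, ∑ a ∈ T, l a x = 1) ∧ (∀ x, ∑ a ∈ T, l a x • a = x) ∧
      (∀ a ∈ T, l a a = 1) ∧ (∀ a, ∀ b ∈ T, a ≠ b → l a b = 0) ∧ ∀ a ∉ T, ∀ x, l a x = 0 := by
  classical
  have htop : affineSpan ℝ (Set.range fun a : T => (a : Eucl d)) = ⊤ := by
    rw [hT.affineSpan_eq_top_iff_card_eq_finrank_add_one]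
    simp [hc]
  let b : AffineBasis T ℝ (Eucl d) := ⟨fun a : T => (a : Eucl d), hT, htop⟩
  have hb : ∀ a : T, b a = a := fun _ => rfl
  refine ⟨fun a => if h : a ∈ T then b.coord ⟨a, h⟩ else 0, fun x => ?_, fun x => ?_,
    fun a ha => ?_, fun a c hc hac => ?_, fun a ha x => ?_⟩
  · rw [← Finset.sum_attach]
    simpa using b.sum_coord_apply_eq_one x
  · rw [← Finset.sum_attach]
    have := b.linear_combination_coord_eq_self x
    simpa [hb] using this
  · have := b.coord_apply ⟨a, ha⟩ ⟨a, ha⟩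
    rw [hb, if_pos rfl] at this
    simpa [ha] using this
  · by_cases ha : a ∈ T
    · have := b.coord_apply ⟨a, ha⟩ ⟨c, hc⟩
      rw [hb, if_neg (by simpa using hac)] at this
      simpa [ha] using this
    · simp [ha]
  · simp [ha]

open Classical in
/-- The barycentric coordinate of the simplex with the vertex set `T` associated with the point
`a`; it is zero if `a` is not a vertex. -/
noncomputable def bary (T : Finset (Eucl d)) : Eucl d → Eucl d →ᵃ[ℝ] ℝ :=
  if h : T.card = d + 1 ∧ AffineIndependent ℝ (fun a : T => (a : Eucl d)) then
    (exists_bary h.1 h.2).choose else 0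

/-- `T` is the vertex set of a nondegenerate `d`-simplex in `ℝ^d`. -/
def IsCell (T : Finset (Eucl d)) : Prop :=
  T.card = d + 1 ∧ AffineIndependent ℝ (fun a : T => (a : Eucl d))

namespace IsCell

theorem bary_spec (hT : IsCell T) :
    (∀ x, ∑ a ∈ T, bary T a x = 1) ∧ (∀ x, ∑ a ∈ T, bary T a x • a = x) ∧
      (∀ a ∈ T, bary T a a = 1) ∧ (∀ a, ∀ b ∈ T, a ≠ b → bary T a b = 0) ∧
      ∀ a ∉ T, ∀ x, bary T a x = 0 := by
  have h : bary T = (exists_bary hT.1 hT.2).choose := dif_pos (show _ ∧ _ from hT)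
  rw [h]
  exact (exists_bary hT.1 hT.2).choose_spec

theorem sum_bary (hT : IsCell T) (x : Eucl d) : ∑ a ∈ T, bary T a x = 1 := hT.bary_spec.1 x

theorem sum_bary_smul (hT : IsCell T) (x : Eucl d) : ∑ a ∈ T, bary T a x • a = x :=
  hT.bary_spec.2.1 x

theorem bary_self (hT : IsCell T) {a : Eucl d} (ha : a ∈ T) : bary T a a = 1 :=
  hT.bary_spec.2.2.1 a ha

theorem bary_ne (hT : IsCell T) {a b : Eucl d} (hb : b ∈ T) (h : a ≠ b) : bary T a b = 0 :=
  hT.bary_spec.2.2.2.1 a b hb h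

theorem bary_notMem (hT : IsCell T) {a : Eucl d} (ha : a ∉ T) (x : Eucl d) : bary T a x = 0 :=
  hT.bary_spec.2.2.2.2 a ha x

end IsCell

theorem affine_map_comb {E F : Type*} [AddCommGroup E] [Module ℝ E] [AddCommGroup F] [Module ℝ F]
    (φ : E →ᵃ[ℝ] F) {ι : Type*} (s : Finset ι) (w : ι → ℝ) (p : ι → E) (hw : ∑ i ∈ s, w i = 1) :
    φ (∑ i ∈ s, w i • p i) = ∑ i ∈ s, w i • φ (p i) := by
  have h := s.map_affineCombination p w hw φ
  rw [Finset.affineCombination_eq_linear_combination _ _ _ hw,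
    Finset.affineCombination_eq_linear_combination _ _ _ hw] at h
  exact h

theorem IsCell.bary_comb (hT : IsCell T) (hS : S ⊆ T) {w : Eucl d → ℝ} (hw : ∑ a ∈ S, w a = 1)
    {b : Eucl d} (hb : b ∈ S) : bary T b (∑ a ∈ S, w a • a) = w b := by
  classical
  rw [affine_map_comb (bary T b) S w (fun a => a) hw, Finset.sum_eq_single b]
  · rw [hT.bary_self (hS hb), smul_eq_mul, mul_one]
  · intro a ha hab
    rw [hT.bary_ne (hS ha) hab.symm, smul_zero]
  · exact fun h => absurd hb h

theorem IsCell.bary_comb_notMem (hT : IsCell T) (hS : S ⊆ T) {w : Eucl d → ℝ}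
    (hw : ∑ a ∈ S, w a = 1) {b : Eucl d} (hb : b ∉ S) : bary T b (∑ a ∈ S, w a • a) = 0 := by
  rw [affine_map_comb (bary T b) S w (fun a => a) hw]
  refine Finset.sum_eq_zero fun a ha => ?_
  rw [hT.bary_ne (hS ha) (by rintro rfl; exact hb ha), smul_zero]

theorem mem_hull {x : Eucl d} :
    x ∈ hull S ↔ ∃ w : Eucl d → ℝ, (∀ a ∈ S, 0 ≤ w a) ∧ ∑ a ∈ S, w a = 1 ∧
      ∑ a ∈ S, w a • a = x :=
  Finset.mem_convexHull'

theorem hull_mono (h : S ⊆ T) : hull S ⊆ hull T := convexHull_mono (Finset.coe_subset.2 h)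

theorem subset_hull {a : Eucl d} (ha : a ∈ S) : a ∈ hull S :=
  subset_convexHull ℝ _ (Finset.mem_coe.2 ha)

theorem convex_hull : Convex ℝ (hull S) := convex_convexHull ℝ (S : Set (Eucl d))

theorem isCompact_hull : IsCompact (hull S) := S.finite_toSet.isCompact_convexHull (𝕜 := ℝ)

theorem isClosed_hull : IsClosed (hull S) := isCompact_hull.isClosed

/-- A face of a simplex in terms of the barycentric coordinates of the simplex. -/
theorem IsCell.mem_hull_face_iff (hT : IsCell T) (hS : S ⊆ T) {x : Eucl d} :
    x ∈ hull S ↔ (∀ a, 0 ≤ bary T a x) ∧ ∀ a ∉ S, bary T a x = 0 := by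
  constructor
  · rw [mem_hull]
    rintro ⟨w, hw0, hw, rfl⟩
    refine ⟨fun a => ?_, fun a ha => hT.bary_comb_notMem hS hw ha⟩
    by_cases ha : a ∈ S
    · rw [hT.bary_comb hS hw ha]; exact hw0 a ha
    · rw [hT.bary_comb_notMem hS hw ha]
  · rintro ⟨h0, h⟩
    have key : ∀ {F : Type} [AddCommGroup F] [Module ℝ F] (g : Eucl d → F),
        ∑ a ∈ S, bary T a x • g a = ∑ a ∈ T, bary T a x • g a := fun g =>
      Finset.sum_subset hS fun a _ ha => by rw [h a ha, zero_smul]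
    refine mem_hull.2 ⟨fun a => bary T a x, fun a _ => h0 a, ?_, ?_⟩
    · have := key (fun _ => (1 : ℝ))
      simp only [smul_eq_mul, mul_one] at this
      rw [this, hT.sum_bary]
    · have := key (fun a => a)
      rw [this, hT.sum_bary_smul]

theorem IsCell.mem_hull_iff (hT : IsCell T) {x : Eucl d} :
    x ∈ hull T ↔ ∀ a, 0 ≤ bary T a x := by
  rw [hT.mem_hull_face_iff subset_rfl]
  exact ⟨fun h => h.1, fun h => ⟨h, fun a ha => hT.bary_notMem ha x⟩⟩

theorem IsCell.bary_le_one (hT : IsCell T) {x : Eucl d} (hx : x ∈ hull T) (a : Eucl d) :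
    bary T a x ≤ 1 := by
  by_cases ha : a ∈ T
  · rw [← hT.sum_bary x]
    exact Finset.single_le_sum (f := fun a => bary T a x)
      (fun b _ => hT.mem_hull_iff.1 hx b) ha
  · rw [hT.bary_notMem ha]; exact zero_le_one

theorem continuous_bary (T : Finset (Eucl d)) (a : Eucl d) : Continuous (bary T a) :=
  AffineMap.continuous_of_finiteDimensional _

theorem IsCell.isOpen_pos (T : Finset (Eucl d)) : IsOpen {x | ∀ a ∈ T, 0 < bary T a x} := by
  simp only [Set.ofPred_forall]
  exact isOpen_biInter_finset fun a _ => isOpen_lt continuous_const (continuous_bary T a)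

/-- A simplex is determined by its convex hull. -/
theorem IsCell.subset_of_hull_subset (hT : IsCell T) {F : Finset (Eucl d)} (hS : S ⊆ T)
    (h : hull S = hull F) : S ⊆ F := by
  intro a ha
  obtain ⟨w, hw0, hw, hwa⟩ := mem_hull.1 (h ▸ subset_hull ha)
  by_contra haF
  have h1 : bary T a a = 1 := hT.bary_self (hS ha)
  have hle : ∀ b ∈ F, bary T a b ≤ 1 := fun b hb =>
    hT.bary_le_one (hull_mono hS (h ▸ subset_hull hb)) a
  -- On the simplex the coordinate of $a$ reaches $1$ only at $a$. If $a\notin F$, all its values on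
  -- $F$ are below $1$, and so is any convex combination of them, contradicting the value $1$ at
  -- $a\in$ `hull F`.
  have hlt : ∀ b ∈ F, bary T a b < 1 := by
    intro b hb
    refine lt_of_le_of_ne (hle b hb) fun hb1 => haF ?_
    have hbT : b ∈ hull T := hull_mono hS (h ▸ subset_hull hb)
    have hz : ∀ c ∈ T, c ≠ a → bary T c b = 0 := by
      intro c hc hca
      have hsum := hT.sum_bary b
      classical
      rw [← Finset.add_sum_erase _ _ (hS ha), hb1] at hsum
      have h0 : ∑ x ∈ T.erase a, bary T x b = 0 := by linarith
      exact (Finset.sum_eq_zero_iff_of_nonneg fun i _ => hT.mem_hull_iff.1 hbT i).1 h0 c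
        (Finset.mem_erase.2 ⟨hca, hc⟩)
    have : b = a := by
      rw [← hT.sum_bary_smul b, Finset.sum_eq_single a]
      · rw [hb1, one_smul]
      · intro c hc hca; rw [hz c hc hca, zero_smul]
      · exact fun h => absurd (hS ha) h
    exact this ▸ hb
  have h2 : bary T a (∑ b ∈ F, w b • b) = ∑ b ∈ F, w b • bary T a b :=
    affine_map_comb (bary T a) F w (fun b => b) hw
  rw [hwa, h1] at h2
  have h3 : ∑ b ∈ F, w b * (1 - bary T a b) = 0 := by
    simp only [mul_sub, mul_one, Finset.sum_sub_distrib, hw]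
    simp only [smul_eq_mul] at h2
    linarith
  have h4 := (Finset.sum_eq_zero_iff_of_nonneg fun b hb =>
    mul_nonneg (hw0 b hb) (by linarith [hle b hb])).1 h3
  have h5 : ∑ b ∈ F, w b = 0 := Finset.sum_eq_zero fun b hb => by
    rcases mul_eq_zero.1 (h4 b hb) with h | h
    · exact h
    · linarith [hlt b hb]
  linarith

theorem IsCell.mem_interior (hT : IsCell T) {x : Eucl d} (h : ∀ a ∈ T, 0 < bary T a x) :
    x ∈ interior (hull T) := by
  refine _root_.mem_interior.2 ⟨_, fun y hy => ?_, IsCell.isOpen_pos T, h⟩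
  refine hT.mem_hull_iff.2 fun a => ?_
  by_cases ha : a ∈ T
  · exact (hy a ha).le
  · rw [hT.bary_notMem ha]

/-- Points with a vanishing coordinate are limits of points outside the simplex. -/
theorem IsCell.frequently_notMem (hT : IsCell T) {x : Eucl d} {a : Eucl d} (ha : a ∈ T)
    (hx : bary T a x = 0) : ∃ᶠ y in 𝓝 x, y ∉ hull T := by
  -- Points on the line through $x$ and $a$ at negative parameter $t$, on the side away from $a$,
  -- have $a$-coordinate $t<0$.
  have hlim : Tendsto (fun t : ℝ => AffineMap.lineMap x a t) (𝓝[<] (0 : ℝ)) (𝓝 x) := by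
    have hc : Continuous fun t : ℝ => AffineMap.lineMap x a t := AffineMap.lineMap_continuous
    have := (hc.tendsto 0).mono_left (nhdsWithin_le_nhds (s := Set.Iio 0))
    simpa using this
  refine hlim.frequently (Eventually.frequently ?_)
  filter_upwards [self_mem_nhdsWithin] with t ht hmem
  have := hT.mem_hull_iff.1 hmem a
  rw [AffineMap.apply_lineMap, hx, hT.bary_self ha, AffineMap.lineMap_apply] at this
  simp at this
  exact absurd ht (not_lt.2 this)

theorem IsCell.barycenter_pos (hT : IsCell T) (hS : S ⊆ T) (hne : S.Nonempty) {a : Eucl d}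
    (ha : a ∈ S) : bary T a (barycenter S) = (S.card : ℝ)⁻¹ := by
  have h0 : (S.card : ℝ) ≠ 0 := by exact_mod_cast hne.card_pos.ne'
  have h : barycenter S = ∑ a ∈ S, (fun _ => (S.card : ℝ)⁻¹) a • a := by
    rw [barycenter, Finset.smul_sum]
  rw [h, hT.bary_comb hS _ ha]
  simp [h0]

theorem barycenter_mem_hull (hne : S.Nonempty) : barycenter S ∈ hull S := by
  have h0 : (S.card : ℝ) ≠ 0 := by exact_mod_cast hne.card_pos.ne'
  refine mem_hull.2 ⟨fun _ => (S.card : ℝ)⁻¹, fun _ _ => by positivity, by simp [h0], ?_⟩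
  rw [barycenter, Finset.smul_sum]

/-- The affine map taking the vertices of the reference simplex to the points `e i`. -/
noncomputable def refMap {n : ℕ} (e : Fin (n + 1) → Eucl d) : Eucl n →ᵃ[ℝ] Eucl d :=
  (∑ i : Fin n, (EuclideanSpace.proj i : Eucl n →L[ℝ] ℝ).toLinearMap.smulRight
    (e i.succ - e 0)).toAffineMap + AffineMap.const ℝ _ (e 0)

theorem refMap_apply {n : ℕ} (e : Fin (n + 1) → Eucl d) (y : Eucl n) :
    refMap e y = (1 - ∑ i, y i) • e 0 + ∑ i : Fin n, y i • e i.succ := by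
  have h : refMap e y = ∑ i : Fin n, y i • (e i.succ - e 0) + e 0 := by simp [refMap]
  rw [h, sub_smul, one_smul, Finset.sum_smul]
  simp only [smul_sub, Finset.sum_sub_distrib]
  abel

/-- A polynomial on a simplex that vanishes at all Lagrange nodes is zero. -/
theorem IsCell.eq_zero_of_nodes (hT : IsCell T) {p : ℕ} (hp : 1 ≤ p) {f : Eucl d → ℝ}
    (hf : IsPolyOn (p : ℤ) (hull T) f) (h0 : ∀ z ∈ simplexNodes p T, f z = 0) :
    ∀ x ∈ hull T, f x = 0 := by
  classical
  obtain ⟨q, hq, hfq⟩ := hf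
  let e : Fin (d + 1) ≃ T := (T.equivFinOfCardEq hT.1).symm
  let A := refMap fun i => (e i : Eucl d)
  have hAw : ∀ y : Eucl d, A y = (1 - ∑ i, y i) • (e 0 : Eucl d) +
      ∑ i : Fin d, y i • (e i.succ : Eucl d) := refMap_apply _
  have hglob : IsPolyOn (p : ℤ) Set.univ fun x : Eucl d => MvPolynomial.eval (fun i => x i) q :=
    ⟨q, hq, fun _ _ => rfl⟩
  obtain ⟨r, hr, hrq⟩ := hglob.comp_affine A (Q := Set.univ) (fun _ _ => Set.mem_univ _)
  have hp0 : (p : ℝ) ≠ 0 := by positivity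
  have hr0 : r = 0 := by
    refine eq_zero_of_eval_lattice hp hr fun m hm => ?_
    let y : Eucl d := WithLp.toLp 2 fun i => (m i : ℝ) / p
    have h1 : MvPolynomial.eval (fun i => A y i) q = _ := hrq y (Set.mem_univ _)
    change MvPolynomial.eval (fun i => y i) r = 0
    rw [← h1]
    -- The weight $p-\sum m_i$ at the zeroth vertex completes the lattice point to vertex weights of
    -- sum $p$.
    let c : Fin (d + 1) → ℕ := Fin.cons (p - ∑ i, m i) m
    let α : Eucl d → ℕ := fun a => if h : a ∈ T then c (e.symm ⟨a, h⟩) else 0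
    have hα : ∀ i, α (e i) = c i := by
      intro i; simp [α]
    have hsum : ∀ {F : Type} [AddCommMonoid F] (g : Eucl d → F),
        ∑ a ∈ T, g a = ∑ i, g (e i) := by
      intro F _ g
      rw [← Finset.sum_coe_sort, ← e.sum_comp]
    have hz : A y ∈ simplexNodes p T := by
      refine Finset.mem_image.2 ⟨α, ?_, ?_⟩
      · rw [Finset.mem_piAntidiag]
        refine ⟨?_, fun a ha => ?_⟩
        · rw [hsum α]
          simp only [hα, c, Fin.sum_univ_succ, Fin.cons_zero, Fin.cons_succ]
          omega
        · by_contra h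
          simp [α, h] at ha
      · rw [hsum fun a => ((α a : ℝ) / p) • a, hAw]
        simp only [hα, c, Fin.sum_univ_succ, Fin.cons_zero, Fin.cons_succ]
        congr 2
        rw [Nat.cast_sub hm, sub_div, div_self hp0, Nat.cast_sum, Finset.sum_div]
    have hzT : A y ∈ hull T := by
      obtain ⟨β, hβ, hz'⟩ := Finset.mem_image.1 hz
      rw [← hz']
      refine mem_hull.2 ⟨fun a => (β a : ℝ) / p, fun a _ => by positivity, ?_, rfl⟩
      rw [← Finset.sum_div, ← Nat.cast_sum, (Finset.mem_piAntidiag.1 hβ).1, div_self hp0]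
    rw [← hfq _ hzT, h0 _ hz]
  intro x hx
  rw [hfq x hx]
  let y : Eucl d := WithLp.toLp 2 fun i : Fin d => bary T (e i.succ) x
  have hxy : A y = x := by
    rw [hAw]
    have h1 := hT.sum_bary x
    have h2 := hT.sum_bary_smul x
    rw [← Finset.sum_coe_sort, ← e.sum_comp, Fin.sum_univ_succ] at h1 h2
    have h3 : 1 - ∑ i, y i = bary T (e 0) x := by
      simp only [y]; linarith
    rw [h3]
    exact h2
  have : MvPolynomial.eval (fun i => A y i) q = _ := hrq y (Set.mem_univ _)
  rw [hr0, map_zero, hxy] at this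
  exact this

theorem mem_hull_of_mem_simplexNodes {p : ℕ} (hp : 1 ≤ p) {z : Eucl d}
    (hz : z ∈ simplexNodes p S) : z ∈ hull S := by
  have hp0 : (p : ℝ) ≠ 0 := by positivity
  obtain ⟨β, hβ, rfl⟩ := Finset.mem_image.1 hz
  refine mem_hull.2 ⟨fun a => (β a : ℝ) / p, fun a _ => by positivity, ?_, rfl⟩
  rw [← Finset.sum_div, ← Nat.cast_sum, (Finset.mem_piAntidiag.1 hβ).1, div_self hp0]

end Barycentric

namespace SimplicialMesh

variable {d : ℕ} {Ω : Set (Eucl d)} (M : SimplicialMesh Ω)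

/-! ### Hat functions -/

theorem isCell {M : SimplicialMesh Ω} {T : Finset (Eucl d)} (hT : T ∈ M.cells) : IsCell T :=
  ⟨M.card_eq T hT, M.indep T hT⟩

/-- The intersection of the cells is the hull of a subset of the vertices of either one, by matching
in both orders. A simplex is determined by its hull, so the spanning vertices are common to both
cells and a common point has the same weights in each. This makes the hat functions independent of
the chosen cell. -/
theorem bary_eq_of_mem {M : SimplicialMesh Ω} {T T' : Finset (Eucl d)} (hT : T ∈ M.cells)
    (hT' : T' ∈ M.cells) {x : Eucl d} (hx : x ∈ hull T) (hx' : x ∈ hull T') (a : Eucl d) :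
    bary T a x = bary T' a x := by
  obtain ⟨S, hS, h⟩ := M.matching T hT T' hT'
  obtain ⟨S', hS', h'⟩ := M.matching T' hT' T hT
  have hSS : hull S = hull S' := by rw [← h, ← h', Set.inter_comm]
  have hsub : S ⊆ T' := ((isCell hT).subset_of_hull_subset hS hSS).trans hS'
  obtain ⟨w, -, hw, rfl⟩ := mem_hull.1 (show x ∈ hull S from h ▸ ⟨hx, hx'⟩)
  by_cases ha : a ∈ S
  · rw [(isCell hT).bary_comb hS hw ha, (isCell hT').bary_comb hsub hw ha]
  · rw [(isCell hT).bary_comb_notMem hS hw ha, (isCell hT').bary_comb_notMem hsub hw ha]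

open Classical in
/-- The continuous piecewise affine function which is `1` at the vertex `a` and `0` at all other
vertices of the mesh; it is zero outside the mesh. -/
noncomputable def hat (a x : Eucl d) : ℝ :=
  if h : ∃ T ∈ M.cells, x ∈ hull T then bary h.choose a x else 0

theorem mem_closure_iff {M : SimplicialMesh Ω} {x : Eucl d} :
    x ∈ closure Ω ↔ ∃ T ∈ M.cells, x ∈ hull T := by
  rw [← M.cover]; simp

theorem hull_subset_closure {M : SimplicialMesh Ω} {T : Finset (Eucl d)} (hT : T ∈ M.cells) :
    hull T ⊆ closure Ω := fun _ hx => mem_closure_iff.2 ⟨T, hT, hx⟩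

variable {M} {T T' S F : Finset (Eucl d)} {x a : Eucl d}

theorem hat_eq (hT : T ∈ M.cells) (hx : x ∈ hull T) (a : Eucl d) : M.hat a x = bary T a x := by
  have h : ∃ T ∈ M.cells, x ∈ hull T := ⟨T, hT, hx⟩
  rw [hat, dif_pos h]
  exact bary_eq_of_mem h.choose_spec.1 hT h.choose_spec.2 hx a

theorem hat_of_notMem (hx : x ∉ closure Ω) (a : Eucl d) : M.hat a x = 0 :=
  dif_neg fun h => hx (mem_closure_iff.2 h)

theorem hat_nonneg (a x : Eucl d) : 0 ≤ M.hat a x := by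
  by_cases hx : x ∈ closure Ω
  · obtain ⟨T, hT, hxT⟩ := mem_closure_iff.1 hx
    rw [hat_eq hT hxT]
    exact (isCell hT).mem_hull_iff.1 hxT a
  · rw [hat_of_notMem hx]

theorem hat_le_one (a x : Eucl d) : M.hat a x ≤ 1 := by
  by_cases hx : x ∈ closure Ω
  · obtain ⟨T, hT, hxT⟩ := mem_closure_iff.1 hx
    rw [hat_eq hT hxT]
    exact (isCell hT).bary_le_one hxT a
  · rw [hat_of_notMem hx]; exact zero_le_one

theorem isPolyOn_hat (hT : T ∈ M.cells) (a : Eucl d) : IsPolyOn 1 (hull T) (M.hat a) :=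
  (isPolyOn_affine (bary T a)).congr fun _ hx => hat_eq hT hx a

/-- The normalized product of the hat functions of the vertices in `S`. -/
noncomputable def bubble (M : SimplicialMesh Ω) (S : Finset (Eucl d)) (x : Eucl d) : ℝ :=
  (S.card : ℝ) ^ S.card * ∏ a ∈ S, M.hat a x

theorem isPolyOn_bubble (hT : T ∈ M.cells) (S : Finset (Eucl d)) :
    IsPolyOn (S.card : ℤ) (hull T) (M.bubble S) := by
  have h := IsPolyOn.prod (s := S) (e := fun _ => 1) fun a _ => isPolyOn_hat hT a
  simp only [Finset.sum_const, nsmul_eq_mul, mul_one] at h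
  exact h.const_mul _

theorem bubble_nonneg (S : Finset (Eucl d)) (x : Eucl d) : 0 ≤ M.bubble S x :=
  mul_nonneg (by positivity) (Finset.prod_nonneg fun a _ => hat_nonneg a x)

theorem bubble_le (S : Finset (Eucl d)) (x : Eucl d) : M.bubble S x ≤ (S.card : ℝ) ^ S.card :=
  mul_le_of_le_one_right (by positivity)
    (Finset.prod_le_one (fun a _ => hat_nonneg a x) fun a _ => hat_le_one a x)

theorem bubble_eq_zero (ha : a ∈ S) (h : M.hat a x = 0) : M.bubble S x = 0 := by
  rw [bubble, Finset.prod_eq_zero ha h, mul_zero]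

theorem bubble_of_notMem_closure (hS : S.Nonempty) (hx : x ∉ closure Ω) : M.bubble S x = 0 := by
  obtain ⟨a, ha⟩ := hS
  exact bubble_eq_zero ha (hat_of_notMem hx a)

theorem bubble_comb (hT : T ∈ M.cells) (hS : S ⊆ T) {w : Eucl d → ℝ} (hw0 : ∀ a ∈ S, 0 ≤ w a)
    (hw : ∑ a ∈ S, w a = 1) :
    M.bubble S (∑ a ∈ S, w a • a) = (S.card : ℝ) ^ S.card * ∏ a ∈ S, w a := by
  have hx : ∑ a ∈ S, w a • a ∈ hull T := hull_mono hS (mem_hull.2 ⟨w, hw0, hw, rfl⟩)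
  rw [bubble]
  congr 1
  exact Finset.prod_congr rfl fun a ha => by
    rw [hat_eq hT hx, (isCell hT).bary_comb hS hw ha]

theorem bubble_barycenter (hT : T ∈ M.cells) (hS : S ⊆ T) (hne : S.Nonempty) :
    M.bubble S (barycenter S) = 1 := by
  have h0 : (S.card : ℝ) ≠ 0 := by exact_mod_cast hne.card_pos.ne'
  have h : barycenter S = ∑ a ∈ S, (fun _ => (S.card : ℝ)⁻¹) a • a := by
    rw [barycenter, Finset.smul_sum]
  rw [h, bubble_comb hT hS (fun _ _ => by positivity) (by simp [h0]), Finset.prod_const,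
    ← mul_pow, mul_inv_cancel₀ h0, one_pow]

/-- Off the star of `S`, in particular on simplices which do not contain `S`, the bubble
vanishes. -/
theorem bubble_eq_zero_of_not_subset (hT : T ∈ M.cells) (hF : F ⊆ T) (hx : x ∈ hull F)
    (h : ¬ S ⊆ F) : M.bubble S x = 0 := by
  obtain ⟨a, ha, haF⟩ := Finset.not_subset.1 h
  refine bubble_eq_zero ha ?_
  rw [hat_eq hT (hull_mono hF hx)]
  exact (((isCell hT).mem_hull_face_iff hF).1 hx).2 a haF

/-- A cell containing the point must contain $S$, since the hat of a vertex outside the cell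
vanishes on it. This reduces questions about supports to incidence of vertex sets. -/
theorem exists_of_bubble_ne_zero (hS : S.Nonempty) (h : M.bubble S x ≠ 0) :
    ∃ T ∈ M.cells, S ⊆ T ∧ x ∈ hull T ∧ ∀ a ∈ S, 0 < bary T a x := by
  have hx : x ∈ closure Ω := by
    by_contra hx; exact h (bubble_of_notMem_closure hS hx)
  obtain ⟨T, hT, hxT⟩ := mem_closure_iff.1 hx
  refine ⟨T, hT, ?_, hxT, fun a ha => ?_⟩
  · by_contra hST
    exact h (bubble_eq_zero_of_not_subset hT subset_rfl hxT hST)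
  · rw [← hat_eq hT hxT]
    exact lt_of_le_of_ne (hat_nonneg a x) fun h0 => h (bubble_eq_zero ha h0.symm)

theorem interior_hull_subset (hΩ : interior (closure Ω) = Ω) (hT : T ∈ M.cells) :
    interior (hull T) ⊆ Ω := by
  rw [← hΩ]; exact interior_mono (hull_subset_closure hT)

theorem cell_nonempty (hT : T ∈ M.cells) : T.Nonempty := by
  rw [← Finset.card_pos, M.card_eq T hT]; omega

theorem cell_eq_of_subset (hT : T ∈ M.cells) (hT' : T' ∈ M.cells) (h : T ⊆ T') : T = T' :=
  Finset.eq_of_subset_of_card_le h (by rw [M.card_eq T hT, M.card_eq T' hT'])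

theorem cellBubble_eq_zero (hT : T ∈ M.cells) (hx : x ∉ hull T) : M.bubble T x = 0 := by
  by_contra h
  obtain ⟨T', hT', hTT, hxT, -⟩ := exists_of_bubble_ne_zero (cell_nonempty hT) h
  rw [cell_eq_of_subset hT hT' hTT] at hx
  exact hx hxT

/-- Where the bubble is nonzero all coordinates of the cell are positive, so the point is interior
to the cell, hence interior to $\overline\Omega$. -/
theorem cellBubble_eq_zero_of_notMem (hΩ : interior (closure Ω) = Ω) (hT : T ∈ M.cells)
    (hx : x ∉ Ω) : M.bubble T x = 0 := by
  by_contra h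
  obtain ⟨T', hT', hTT, hxT, hpos⟩ := exists_of_bubble_ne_zero (cell_nonempty hT) h
  rw [cell_eq_of_subset hT hT' hTT] at hpos
  exact hx (interior_hull_subset hΩ hT' ((isCell hT').mem_interior hpos))

/-! ### Interfaces -/

theorem facet_eq_insert {T F : Finset (Eucl d)} (hT : T.card = d + 1) (hF : F ⊆ T)
    (hc : F.card = d) : ∃ a ∈ T, a ∉ F ∧ ∀ b ∈ T, b ∉ F → b = a := by
  classical
  have h : (T \ F).card = 1 := by rw [Finset.card_sdiff_of_subset hF]; omega
  obtain ⟨a, ha⟩ := Finset.card_eq_one.1 h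
  have h1 : ∀ b, b ∈ T \ F ↔ b = a := fun b => by rw [ha, Finset.mem_singleton]
  simp only [Finset.mem_sdiff] at h1
  exact ⟨a, ((h1 a).2 rfl).1, ((h1 a).2 rfl).2, fun b hb hbF => (h1 b).1 ⟨hb, hbF⟩⟩

/-- The apex coordinates of two cells with a common facet are negative multiples of each other. -/
theorem opposite (hd : 0 < d) {T₁ T₂ : Finset (Eucl d)} (h₁ : T₁ ∈ M.cells) (h₂ : T₂ ∈ M.cells)
    (hne : T₁ ≠ T₂) (hF₁ : F ⊆ T₁) (hF₂ : F ⊆ T₂) (hc : F.card = d) {a₁ a₂ : Eucl d}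
    (ha₁ : a₁ ∈ T₁) (ha₁F : a₁ ∉ F) (ha₂ : a₂ ∈ T₂) (ha₂F : a₂ ∉ F) :
    bary T₁ a₁ a₂ < 0 ∧ ∀ x, bary T₁ a₁ x = bary T₁ a₁ a₂ * bary T₂ a₂ x := by
  have hFne : F.Nonempty := by rw [← Finset.card_pos]; omega
  obtain ⟨b₁, -, -, hu₁⟩ := facet_eq_insert (M.card_eq _ h₁) hF₁ hc
  obtain ⟨b₂, -, -, hu₂⟩ := facet_eq_insert (M.card_eq _ h₂) hF₂ hc
  obtain rfl := hu₁ a₁ ha₁ ha₁F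
  obtain rfl := hu₂ a₂ ha₂ ha₂F
  have hT₁ := isCell h₁
  have hT₂ := isCell h₂
  -- Both affine functions vanish at the vertices of $F$, so they are proportional, with the factor
  -- read off at $a_2$.
  have hmul : ∀ x, bary T₁ a₁ x = bary T₁ a₁ a₂ * bary T₂ a₂ x := by
    intro x
    conv_lhs => rw [← hT₂.sum_bary_smul x]
    rw [affine_map_comb (bary T₁ a₁) T₂ _ (fun a => a) (hT₂.sum_bary x),
      Finset.sum_eq_single a₂]
    · rw [smul_eq_mul, mul_comm]
    · intro b hb hba
      have hbF : b ∈ F := by by_contra h; exact hba (hu₂ b hb h)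
      rw [hT₁.bary_ne (hF₁ hbF) (by rintro rfl; exact ha₁F hbF), smul_zero]
    · exact fun h => absurd ha₂ h
  refine ⟨?_, hmul⟩
  -- If the factor were nonnegative, a short step from the barycenter of $F$ towards $a_2$ would
  -- stay in both cells. There the $a_2$-coordinate is $t>0$ with respect to $T_2$ but zero with
  -- respect to $T_1$, since $a_2\notin T_1$; yet coordinates agree on common points.
  by_contra hκ
  push Not at hκ
  have ha₂T₁ : a₂ ∉ T₁ := by
    intro h
    refine hne (cell_eq_of_subset h₂ h₁ fun b hb => ?_).symm
    by_cases hbF : b ∈ F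
    · exact hF₁ hbF
    · rw [hu₂ b hb hbF]; exact h
  let m := barycenter F
  let c : ℝ → Eucl d := fun t => AffineMap.lineMap m a₂ t
  have hcont : Continuous c := AffineMap.lineMap_continuous
  have hc0 : c 0 = m := AffineMap.lineMap_apply_zero _ _
  have hev : ∀ᶠ t in 𝓝 (0 : ℝ), ∀ a ∈ F, 0 < bary T₁ a (c t) := by
    refine (Filter.eventually_all_finset F).2 fun a ha => ?_
    have h0 : 0 < bary T₁ a (c 0) := by
      rw [hc0, hT₁.barycenter_pos hF₁ hFne ha]
      exact inv_pos.2 (Nat.cast_pos.2 hFne.card_pos)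
    exact ((continuous_bary T₁ a).comp hcont).continuousAt.eventually (lt_mem_nhds h0)
  have hm₂ : bary T₂ a₂ m = 0 :=
    ((hT₂.mem_hull_face_iff hF₂).1 (barycenter_mem_hull hFne)).2 a₂ ha₂F
  have hct : ∀ t, bary T₂ a₂ (c t) = t := by
    intro t
    change bary T₂ a₂ (AffineMap.lineMap m a₂ t) = t
    rw [AffineMap.apply_lineMap, hm₂, hT₂.bary_self ha₂, AffineMap.lineMap_apply]
    simp
  obtain ⟨t, hpos, ht0, ht1⟩ := ((hev.filter_mono nhdsWithin_le_nhds).and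
    (Ioo_mem_nhdsGT (zero_lt_one' ℝ))).exists
  have hx₁ : c t ∈ hull T₁ := by
    refine hT₁.mem_hull_iff.2 fun b => ?_
    by_cases hb : b ∈ T₁
    · by_cases hbF : b ∈ F
      · exact (hpos b hbF).le
      · rw [hu₁ b hb hbF, hmul, hct]; positivity
    · rw [hT₁.bary_notMem hb]
  have hx₂ : c t ∈ hull T₂ :=
    convex_hull.lineMap_mem (hull_mono hF₂ (barycenter_mem_hull hFne)) (subset_hull ha₂)
      ⟨ht0.le, ht1.le⟩
  have := bary_eq_of_mem h₁ h₂ hx₁ hx₂ a₂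
  rw [hct, hT₁.bary_notMem ha₂T₁] at this
  exact ht0.ne this

/-- Three cells cannot be pairwise on opposite sides of a facet: the factor relating the first and
third apex coordinates would be the product of two negative factors, and itself negative. -/
theorem eq_or_eq_of_facet (hd : 0 < d) {T₁ T₂ T₃ : Finset (Eucl d)} (h₁ : T₁ ∈ M.cells)
    (h₂ : T₂ ∈ M.cells) (h₃ : T₃ ∈ M.cells) (hne : T₁ ≠ T₂) (hF₁ : F ⊆ T₁) (hF₂ : F ⊆ T₂)
    (hF₃ : F ⊆ T₃) (hc : F.card = d) : T₃ = T₁ ∨ T₃ = T₂ := by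
  by_contra! h
  obtain ⟨a₁, ha₁, ha₁F, -⟩ := facet_eq_insert (M.card_eq _ h₁) hF₁ hc
  obtain ⟨a₂, ha₂, ha₂F, -⟩ := facet_eq_insert (M.card_eq _ h₂) hF₂ hc
  obtain ⟨a₃, ha₃, ha₃F, -⟩ := facet_eq_insert (M.card_eq _ h₃) hF₃ hc
  obtain ⟨n₁, e₁⟩ := opposite hd h₁ h₂ hne hF₁ hF₂ hc ha₁ ha₁F ha₂ ha₂F
  obtain ⟨n₂, -⟩ := opposite hd h₂ h₃ h.2.symm hF₂ hF₃ hc ha₂ ha₂F ha₃ ha₃F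
  obtain ⟨n₃, -⟩ := opposite hd h₁ h₃ h.1.symm hF₁ hF₃ hc ha₁ ha₁F ha₃ ha₃F
  rw [e₁] at n₃
  nlinarith [mul_pos_of_neg_of_neg n₁ n₂]

theorem mem_faces : F ∈ M.faces ↔ ∃ T ∈ M.cells, F ⊆ T ∧ F.card = d := by
  simp [faces, Finset.mem_powersetCard]

/-- This turns the geometric definition of an interface into incidence of vertex sets. The cells
differ because a cell has one vertex more than a face. -/
theorem interface_subset (hF : F ∈ M.faces) {T₁ T₂ : Finset (Eucl d)} (h₁ : T₁ ∈ M.cells)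
    (h₂ : T₂ ∈ M.cells) (h : hull F = hull T₁ ∩ hull T₂) : F ⊆ T₁ ∧ F ⊆ T₂ ∧ T₁ ≠ T₂ := by
  obtain ⟨T, hT, hFT, hc⟩ := mem_faces.1 hF
  have key : ∀ {T₁ T₂ : Finset (Eucl d)}, T₁ ∈ M.cells → T₂ ∈ M.cells →
      hull F = hull T₁ ∩ hull T₂ → F ⊆ T₁ := by
    intro T₁ T₂ h₁ h₂ h
    obtain ⟨S, hS, hS'⟩ := M.matching T₁ h₁ T₂ h₂
    exact ((isCell hT).subset_of_hull_subset hFT (h.trans hS')).trans hS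
  refine ⟨key h₁ h₂ h, key h₂ h₁ (by rw [h, Set.inter_comm]), ?_⟩
  rintro rfl
  rw [Set.inter_self] at h
  have := (isCell h₁).subset_of_hull_subset subset_rfl h.symm
  have := Finset.card_le_card this
  rw [hc, M.card_eq _ h₁] at this
  omega

theorem exists_of_mem_interfaces (hF : F ∈ M.interfaces) : F.card = d ∧
    ∃ T₁ ∈ M.cells, ∃ T₂ ∈ M.cells, hull F = hull T₁ ∩ hull T₂ ∧ F ⊆ T₁ ∧ F ⊆ T₂ ∧ T₁ ≠ T₂ := by
  classical
  obtain ⟨hF, T₁, h₁, T₂, h₂, h⟩ := Finset.mem_filter.1 hF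
  obtain ⟨-, -, -, hc⟩ := mem_faces.1 hF
  exact ⟨hc, T₁, h₁, T₂, h₂, h, interface_subset hF h₁ h₂ h⟩

/-- The open star of an interface is contained in the domain. -/
theorem mem_of_facet_pos (hΩ : interior (closure Ω) = Ω) (hd : 0 < d)
    {T₁ T₂ : Finset (Eucl d)} (h₁ : T₁ ∈ M.cells) (h₂ : T₂ ∈ M.cells) (hne : T₁ ≠ T₂)
    (hF₁ : F ⊆ T₁) (hF₂ : F ⊆ T₂) (hc : F.card = d) (hx : x ∈ hull T₁)
    (hpos : ∀ a ∈ F, 0 < bary T₁ a x) : x ∈ Ω := by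
  obtain ⟨a₁, ha₁, ha₁F, hu₁⟩ := facet_eq_insert (M.card_eq _ h₁) hF₁ hc
  obtain ⟨a₂, ha₂, ha₂F, hu₂⟩ := facet_eq_insert (M.card_eq _ h₂) hF₂ hc
  obtain ⟨n, e⟩ := opposite hd h₁ h₂ hne hF₁ hF₂ hc ha₁ ha₁F ha₂ ha₂F
  have hT₁ := isCell h₁
  have hT₂ := isCell h₂
  rcases (hT₁.mem_hull_iff.1 hx a₁).lt_or_eq with h0 | h0
  · refine interior_hull_subset hΩ h₁ (hT₁.mem_interior fun b hb => ?_)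
    by_cases hbF : b ∈ F
    · exact hpos b hbF
    · rw [hu₁ b hb hbF]; exact h0
  · have hxF : x ∈ hull F := by
      refine (hT₁.mem_hull_face_iff hF₁).2 ⟨hT₁.mem_hull_iff.1 hx, fun b hb => ?_⟩
      by_cases hbT : b ∈ T₁
      · rw [hu₁ b hbT hb, h0]
      · exact hT₁.bary_notMem hbT x
    have hx₂ := hull_mono hF₂ hxF
    rw [← hΩ]
    -- Near a relatively interior point of $F$ the coordinates of $F$ are positive for both cells.
    -- The sign of the apex coordinate then decides which of them contains $y$, so a whole
    -- neighbourhood is covered.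
    refine mem_interior.2 ⟨{y | ∀ a ∈ F, 0 < bary T₁ a y} ∩ {y | ∀ a ∈ F, 0 < bary T₂ a y},
      ?_, ?_, hpos, fun a ha => ?_⟩
    · rintro y ⟨hy₁, hy₂⟩
      by_cases hy : 0 ≤ bary T₁ a₁ y
      · refine hull_subset_closure h₁ (hT₁.mem_hull_iff.2 fun b => ?_)
        by_cases hbT : b ∈ T₁
        · by_cases hbF : b ∈ F
          · exact (hy₁ b hbF).le
          · rw [hu₁ b hbT hbF]; exact hy
        · rw [hT₁.bary_notMem hbT]
      · refine hull_subset_closure h₂ (hT₂.mem_hull_iff.2 fun b => ?_)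
        by_cases hbT : b ∈ T₂
        · by_cases hbF : b ∈ F
          · exact (hy₂ b hbF).le
          · rw [hu₂ b hbT hbF]
            rw [e] at hy
            by_contra hneg
            exact hy (mul_nonneg_of_nonpos_of_nonpos n.le (not_le.1 hneg).le)
        · rw [hT₂.bary_notMem hbT]
    · refine IsOpen.inter ?_ ?_ <;>
      · simp only [Set.ofPred_forall]
        exact isOpen_biInter_finset fun a _ => isOpen_lt continuous_const (continuous_bary _ a)
    · rw [← bary_eq_of_mem h₁ h₂ hx hx₂]; exact hpos a ha

theorem faceBubble_eq_zero (hd : 0 < d) {T₁ T₂ : Finset (Eucl d)} (h₁ : T₁ ∈ M.cells)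
    (h₂ : T₂ ∈ M.cells) (hne : T₁ ≠ T₂) (hF₁ : F ⊆ T₁) (hF₂ : F ⊆ T₂) (hc : F.card = d)
    (hx : x ∉ hull T₁ ∪ hull T₂) : M.bubble F x = 0 := by
  by_contra h
  obtain ⟨T, hT, hFT, hxT, -⟩ :=
    exists_of_bubble_ne_zero (by rw [← Finset.card_pos]; omega) h
  rcases eq_or_eq_of_facet hd h₁ h₂ hT hne hF₁ hF₂ hFT hc with rfl | rfl
  · exact hx (Or.inl hxT)
  · exact hx (Or.inr hxT)

theorem faceBubble_eq_zero_of_notMem (hΩ : interior (closure Ω) = Ω) (hd : 0 < d)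
    (hF : F ∈ M.interfaces) (hx : x ∉ Ω) : M.bubble F x = 0 := by
  by_contra h
  obtain ⟨hc, T₁, h₁, T₂, h₂, -, hF₁, hF₂, hne⟩ := exists_of_mem_interfaces hF
  obtain ⟨T, hT, hFT, hxT, hpos⟩ :=
    exists_of_bubble_ne_zero (by rw [← Finset.card_pos]; omega) h
  rcases eq_or_eq_of_facet hd h₁ h₂ hT hne hF₁ hF₂ hFT hc with rfl | rfl
  · exact hx (mem_of_facet_pos hΩ hd hT h₂ hne hF₁ hF₂ hc hxT hpos)
  · exact hx (mem_of_facet_pos hΩ hd hT h₁ hne.symm hF₂ hF₁ hc hxT hpos)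

/-! ### Lagrange nodes and basis functions -/

/-- The vertex weights of a node of the mesh are determined by the hat functions. -/
theorem hat_node {p : ℕ} (hp : 1 ≤ p) (hT : T ∈ M.cells) {α : Eucl d → ℕ}
    (hα : α ∈ T.piAntidiag p) (a : Eucl d) :
    M.hat a (∑ b ∈ T, ((α b : ℝ) / p) • b) = (α a : ℝ) / p := by
  classical
  have hp0 : (p : ℝ) ≠ 0 := by positivity
  have hw : ∑ b ∈ T, (α b : ℝ) / p = 1 := by
    rw [← Finset.sum_div, ← Nat.cast_sum, (Finset.mem_piAntidiag.1 hα).1, div_self hp0]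
  have hx : ∑ b ∈ T, ((α b : ℝ) / p) • b ∈ hull T :=
    mem_hull.2 ⟨_, fun b _ => by positivity, hw, rfl⟩
  rw [hat_eq hT hx]
  by_cases ha : a ∈ T
  · exact (isCell hT).bary_comb (w := fun b => (α b : ℝ) / p) subset_rfl hw ha
  · rw [(isCell hT).bary_notMem ha]
    have : α a = 0 := by
      by_contra h; exact ha ((Finset.mem_piAntidiag.1 hα).2 a h)
    simp [this]

theorem mem_nodes {p : ℕ} {z : Eucl d} : z ∈ M.nodes p ↔ ∃ T ∈ M.cells, z ∈ simplexNodes p T := by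
  simp [nodes]

theorem mem_simplexNodes {p : ℕ} {z : Eucl d} :
    z ∈ simplexNodes p T ↔ ∃ α : Eucl d → ℕ,
      (∑ a ∈ T, α a = p ∧ ∀ a, α a ≠ 0 → a ∈ T) ∧ ∑ a ∈ T, ((α a : ℝ) / p) • a = z := by
  classical
  simp only [simplexNodes, Finset.mem_image, Finset.mem_piAntidiag]

/-- A node of the mesh that lies on a cell is a node of the cell. -/
theorem mem_simplexNodes_of_mem {p : ℕ} (hp : 1 ≤ p) {z : Eucl d} (hz : z ∈ M.nodes p)
    (hT : T ∈ M.cells) (hzT : z ∈ hull T) : z ∈ simplexNodes p T := by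
  classical
  have hp0 : (p : ℝ) ≠ 0 := by positivity
  obtain ⟨T', hT', hz'⟩ := mem_nodes.1 hz
  obtain ⟨α, hα, rfl⟩ := mem_simplexNodes.1 hz'
  have hh := hat_node hp hT' (Finset.mem_piAntidiag.2 hα)
  have hb : ∀ a, bary T a (∑ a ∈ T', ((α a : ℝ) / p) • a) = (α a : ℝ) / p := fun a => by
    rw [← hat_eq hT hzT, hh]
  refine mem_simplexNodes.2 ⟨α, ⟨?_, fun a ha => ?_⟩, ?_⟩
  · have := (isCell hT).sum_bary (∑ a ∈ T', ((α a : ℝ) / p) • a)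
    simp only [hb] at this
    rw [← Finset.sum_div, div_eq_one_iff_eq hp0] at this
    exact_mod_cast this
  · by_contra haT
    have := hb a
    rw [(isCell hT).bary_notMem haT, eq_comm, div_eq_zero_iff] at this
    rcases this with h | h
    · exact ha (by exact_mod_cast h)
    · exact hp0 h
  · have := (isCell hT).sum_bary_smul (∑ a ∈ T', ((α a : ℝ) / p) • a)
    simpa only [hb] using this

/-- The Lagrange basis function of the node with the vertex weights `α / p`. -/
noncomputable def nodeFun (M : SimplicialMesh Ω) (p : ℕ) (T : Finset (Eucl d)) (α : Eucl d → ℕ)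
    (x : Eucl d) : ℝ :=
  ∏ a ∈ T, ∏ j ∈ Finset.range (α a), ((p : ℝ) * M.hat a x - j) / (j + 1)

/-- The function is $\prod_a\binom{p\lambda_a}{\alpha_a}$ with the hats $\lambda_a$, so its degree
is at most $\sum_a\alpha_a=p$. -/
theorem isPolyOn_nodeFun {p : ℕ} {α : Eucl d → ℕ} (hα : ∑ a ∈ T, α a = p) (hT' : T' ∈ M.cells) :
    IsPolyOn (p : ℤ) (hull T') (M.nodeFun p T α) := by
  have h := IsPolyOn.prod (s := T) (e := fun a => ∑ j ∈ Finset.range (α a), (1 : ℤ))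
    (S := hull T') (F := fun a x => ∏ j ∈ Finset.range (α a), ((p : ℝ) * M.hat a x - j) / (j + 1))
    fun a _ => IsPolyOn.prod fun j _ => by
      have h1 := ((isPolyOn_hat hT' a).const_mul (p : ℝ)).sub
        ((isPolyOn_const (j : ℝ)).mono_deg zero_le_one)
      exact (h1.const_mul ((j : ℝ) + 1)⁻¹).congr fun x _ => by rw [div_eq_inv_mul]
  have hs : ∑ a ∈ T, ∑ j ∈ Finset.range (α a), (1 : ℤ) = p := by
    simp only [Finset.sum_const, Finset.card_range, nsmul_eq_mul, mul_one]
    exact_mod_cast hα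
  rw [hs] at h
  exact h

theorem nodeFun_of_notMem {p : ℕ} (hp : 1 ≤ p) {α : Eucl d → ℕ} (hα : ∑ a ∈ T, α a = p)
    (hx : x ∉ closure Ω) : M.nodeFun p T α x = 0 := by
  obtain ⟨a, ha, h0⟩ : ∃ a ∈ T, α a ≠ 0 := by
    by_contra! h
    rw [Finset.sum_eq_zero h] at hα
    omega
  -- The factor with $j=0$ is a multiple of the hat function of $a$, which is zero off the mesh.
  refine Finset.prod_eq_zero ha (Finset.prod_eq_zero (i := 0) ?_ ?_)
  · simpa [Nat.pos_iff_ne_zero] using h0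
  · simp [hat_of_notMem hx]

/-- There are $p$ factors. Each is at most $p$ in absolute value, because both $p\lambda_a$ and $j$
lie in $[0,p]$. -/
theorem abs_nodeFun_le {p : ℕ} {α : Eucl d → ℕ} (hα : ∑ a ∈ T, α a = p) (x : Eucl d) :
    |M.nodeFun p T α x| ≤ (p : ℝ) ^ p := by
  have h1 : ∀ a ∈ T, ∀ j ∈ Finset.range (α a), |((p : ℝ) * M.hat a x - j) / (j + 1)| ≤ p := by
    intro a ha j hj
    have hjp : (j : ℝ) ≤ p := by
      have h2 := Finset.single_le_sum (f := α) (fun _ _ => Nat.zero_le _) ha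
      have := Finset.mem_range.1 hj
      exact_mod_cast (by omega : j ≤ p)
    have hj0 : (0 : ℝ) ≤ j := by positivity
    have h0 := hat_nonneg (M := M) a x
    have h1 := hat_le_one (M := M) a x
    have hp : (0 : ℝ) ≤ p := by positivity
    rw [abs_div, abs_of_pos (by positivity : (0 : ℝ) < j + 1)]
    refine (div_le_self (abs_nonneg _) (by linarith)).trans (abs_le.2 ⟨?_, ?_⟩)
    · nlinarith [mul_nonneg hp h0]
    · nlinarith [mul_le_of_le_one_right hp h1]
  rw [nodeFun, Finset.abs_prod]
  calc ∏ a ∈ T, |∏ j ∈ Finset.range (α a), ((p : ℝ) * M.hat a x - j) / (j + 1)|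
      ≤ ∏ a ∈ T, (p : ℝ) ^ α a := by
        refine Finset.prod_le_prod (fun _ _ => abs_nonneg _) fun a ha => ?_
        rw [Finset.abs_prod]
        refine (Finset.prod_le_prod (fun _ _ => abs_nonneg _) (h1 a ha)).trans_eq ?_
        simp
    _ = (p : ℝ) ^ p := by rw [Finset.prod_pow_eq_pow_sum, hα]

/-- This is $\binom nn=1$: the numerators are the denominators in reverse order. -/
theorem prod_range_sub_div (n : ℕ) :
    ∏ j ∈ Finset.range n, ((n : ℝ) - j) / (j + 1) = 1 := by
  rw [Finset.prod_div_distrib, div_eq_one_iff_eq]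
  · rw [← Finset.prod_range_reflect]
    refine Finset.prod_congr rfl fun j hj => ?_
    have := Finset.mem_range.1 hj
    rw [Nat.cast_sub (by omega), Nat.cast_sub (by omega)]
    push_cast; ring
  · exact Finset.prod_ne_zero_iff.2 fun j _ => by positivity

/-- At the node with weights $\beta/p$ the value is $\prod_a\binom{\beta_a}{\alpha_a}$, which is
nonzero only if $\alpha\le\beta$. Both weights have sum $p$, so then $\alpha=\beta$. -/
theorem nodeFun_node {p : ℕ} (hp : 1 ≤ p) (hT : T ∈ M.cells) {α : Eucl d → ℕ}
    (hα : ∑ a ∈ T, α a = p ∧ ∀ a, α a ≠ 0 → a ∈ T) {z : Eucl d} (hz : z ∈ M.nodes p) :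
    (z = ∑ a ∈ T, ((α a : ℝ) / p) • a → M.nodeFun p T α z = 1) ∧
      (z ≠ ∑ a ∈ T, ((α a : ℝ) / p) • a → M.nodeFun p T α z = 0) := by
  classical
  have hp0 : (p : ℝ) ≠ 0 := by positivity
  constructor
  · rintro rfl
    refine Finset.prod_eq_one fun a _ => ?_
    rw [hat_node hp hT (Finset.mem_piAntidiag.2 hα), mul_div_cancel₀ _ hp0]
    exact prod_range_sub_div (α a)
  · intro hne
    obtain ⟨T', hT', hz'⟩ := mem_nodes.1 hz
    obtain ⟨β, hβ, rfl⟩ := mem_simplexNodes.1 hz'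
    by_contra h0
    have hle : ∀ a, α a ≤ β a := by
      intro a
      by_cases ha : a ∈ T
      · by_contra hlt
        push Not at hlt
        refine h0 (Finset.prod_eq_zero ha
          (Finset.prod_eq_zero (Finset.mem_range.2 hlt) ?_))
        rw [hat_node hp hT' (Finset.mem_piAntidiag.2 hβ), mul_div_cancel₀ _ hp0, sub_self,
          zero_div]
      · have : α a = 0 := by by_contra h; exact ha (hα.2 a h)
        omega
    have hext : ∀ {γ : Eucl d → ℕ} {S U : Finset (Eucl d)}, S ⊆ U → (∀ a, γ a ≠ 0 → a ∈ S) →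
        ∀ {E : Type} [AddCommMonoid E] (g : Eucl d → E), (∀ a, γ a = 0 → g a = 0) →
        ∑ a ∈ S, g a = ∑ a ∈ U, g a := by
      intro γ S U hSU hγ E _ g hg
      exact Finset.sum_subset hSU fun a _ ha => hg a (by by_contra h; exact ha (hγ a h))
    have e₁ := hext Finset.subset_union_left hα.2 (U := T ∪ T') α fun _ h => h
    have e₂ := hext Finset.subset_union_right hβ.2 (U := T ∪ T') β fun _ h => h
    have heq : ∀ a ∈ T ∪ T', α a = β a :=
      (Finset.sum_eq_sum_iff_of_le fun a _ => hle a).1 (by rw [← e₁, ← e₂, hα.1, hβ.1])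
    refine hne ?_
    rw [hext Finset.subset_union_left hα.2 (U := T ∪ T') (fun a => ((α a : ℝ) / p) • a)
      (fun a h => by simp [h]), hext Finset.subset_union_right hβ.2 (U := T ∪ T')
      (fun a => ((β a : ℝ) / p) • a) (fun a h => by simp [h])]
    exact Finset.sum_congr rfl fun a ha => by rw [heq a ha]

end SimplicialMesh

/-! ### Lipschitz functions and weak gradients -/

section Sobolev

open scoped NNReal ENNReal

/-- A function with locally uniformly bounded difference quotients is Lipschitz. -/
theorem lipschitzWith_of_eventually {E : Type*} [NormedAddCommGroup E] [NormedSpace ℝ E]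
    {f : E → ℝ} {C : ℝ≥0} (h : ∀ x, ∀ᶠ y in 𝓝 x, |f y - f x| ≤ C * ‖y - x‖) :
    LipschitzWith C f := by
  have hcont : Continuous f := by
    refine continuous_iff_continuousAt.2 fun x => ?_
    rw [ContinuousAt, tendsto_iff_norm_sub_tendsto_zero]
    refine squeeze_zero' (.of_forall fun _ => norm_nonneg _) (h x) ?_
    have : Continuous fun y => (C : ℝ) * ‖y - x‖ := by fun_prop
    simpa using this.tendsto x
  refine LipschitzWith.of_dist_le_mul fun y x => ?_
  let c : ℝ → E := fun t => x + t • (y - x)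
  have hc : Continuous c := by fun_prop
  have hcc : ∀ s t, c s - c t = (s - t) • (y - x) := fun s t => by
    simp only [c, sub_smul]; abel
  -- Continuous induction along the segment from $x$ to $y$: the set of good parameters is closed,
  -- and it extends to the right of each of its points without loss in the constant.
  have key : Set.Icc (0 : ℝ) 1 ⊆ {t | |f (c t) - f x| ≤ C * ‖y - x‖ * t} := by
    refine IsClosed.Icc_subset_of_forall_mem_nhdsWithin ?_ (by simp [c]) ?_
    · exact (isClosed_le (by fun_prop) (by fun_prop)).inter isClosed_Icc
    · rintro t ⟨ht, -⟩
      have h1 : ∀ᶠ s in 𝓝[>] t, |f (c s) - f (c t)| ≤ C * ‖c s - c t‖ :=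
        ((hc.tendsto t).eventually (h (c t))).filter_mono nhdsWithin_le_nhds
      filter_upwards [h1, self_mem_nhdsWithin] with s hs hst
      have ht' : |f (c t) - f x| ≤ C * ‖y - x‖ * t := ht
      rw [hcc, norm_smul, Real.norm_of_nonneg (sub_nonneg.2 (le_of_lt hst))] at hs
      calc |f (c s) - f x| ≤ |f (c s) - f (c t)| + |f (c t) - f x| := abs_sub_le _ _ _
        _ ≤ C * ((s - t) * ‖y - x‖) + C * ‖y - x‖ * t := add_le_add hs ht'
        _ = C * ‖y - x‖ * s := by ring
  have := key (Set.right_mem_Icc.2 zero_le_one)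
  simpa [c, Real.dist_eq, dist_eq_norm] using this

variable {d : ℕ} {Ω : Set (Eucl d)} {f φ : Eucl d → ℝ} {C : ℝ≥0}

theorem inner_gradient (f : Eucl d → ℝ) (x v : Eucl d) :
    inner ℝ (gradient f x) v = fderiv ℝ f x v := InnerProductSpace.toDual_symm_apply

theorem norm_gradient (f : Eucl d → ℝ) (x : Eucl d) : ‖gradient f x‖ = ‖fderiv ℝ f x‖ :=
  LinearIsometryEquiv.norm_map _ _

theorem norm_gradient_sub (f g : Eucl d → ℝ) (x : Eucl d) :
    ‖gradient f x - gradient g x‖ = ‖fderiv ℝ f x - fderiv ℝ g x‖ := by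
  rw [gradient, gradient, ← map_sub]
  exact LinearIsometryEquiv.norm_map _ _

theorem measurable_gradient (f : Eucl d → ℝ) : Measurable (gradient f) :=
  (InnerProductSpace.toDual ℝ (Eucl d)).symm.continuous.measurable.comp (measurable_fderiv ℝ f)

theorem gradient_of_notMem_tsupport {x : Eucl d} (hx : x ∉ tsupport f) : gradient f x = 0 := by
  rw [gradient, fderiv_of_notMem_tsupport ℝ hx, map_zero]

theorem norm_gradient_le (hf : LipschitzWith C f) (x : Eucl d) : ‖gradient f x‖ ≤ C := by
  rw [norm_gradient]; exact norm_fderiv_le_of_lipschitz ℝ hf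

theorem gradient_congr {f g : Eucl d → ℝ} {x : Eucl d} (h : f =ᶠ[𝓝 x] g) :
    gradient f x = gradient g x := by rw [gradient, gradient, h.fderiv_eq]

theorem IsTestFunction.lipschitz (hφ : IsTestFunction Ω φ) : ∃ D, LipschitzWith D φ :=
  ContDiff.lipschitzWith_of_hasCompactSupport hφ.2.1 hφ.1 (by simp)

theorem integrable_of_bounded_of_tsupport {G : Type*} [NormedAddCommGroup G] {F : Eucl d → G}
    {K : Set (Eucl d)} (hK : IsCompact K) (hm : AEStronglyMeasurable F volume) {B : ℝ}
    (hB : ∀ x ∈ K, ‖F x‖ ≤ B) (h0 : ∀ x ∉ K, F x = 0) : Integrable F := by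
  rw [← integrableOn_iff_integrable_of_support_subset (s := K)
    (Function.support_subset_iff'.2 h0)]
  exact Measure.integrableOn_of_bounded hK.measure_ne_top hm
    ((ae_restrict_iff' hK.measurableSet).2 (.of_forall hB))

/-- Integration by parts for a Lipschitz function and a compactly supported one. -/
theorem integral_smul_gradient {D : ℝ≥0} (hf : LipschitzWith C f) (hφ : LipschitzWith D φ)
    (hc : HasCompactSupport φ) :
    ∫ x, f x • gradient φ x = -∫ x, φ x • gradient f x := by
  obtain ⟨B, hB⟩ := hc.isCompact.exists_bound_of_continuousOn hf.continuous.continuousOn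
  obtain ⟨B', hB'⟩ := hc.isCompact.exists_bound_of_continuousOn hφ.continuous.continuousOn
  have i1 : Integrable fun x => f x • gradient φ x := by
    refine integrable_of_bounded_of_tsupport hc.isCompact
      (hf.continuous.aestronglyMeasurable.smul (measurable_gradient φ).aestronglyMeasurable)
      (B := B * D) (fun x hx => ?_) fun x hx => by rw [gradient_of_notMem_tsupport hx, smul_zero]
    rw [norm_smul]
    exact mul_le_mul (hB x hx) (norm_gradient_le hφ x) (norm_nonneg _)
      ((norm_nonneg _).trans (hB x hx))
  have i2 : Integrable fun x => φ x • gradient f x := by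
    refine integrable_of_bounded_of_tsupport hc.isCompact
      (hφ.continuous.aestronglyMeasurable.smul (measurable_gradient f).aestronglyMeasurable)
      (B := B' * C) (fun x hx => ?_) fun x hx => by rw [image_eq_zero_of_notMem_tsupport hx,
        zero_smul]
    rw [norm_smul]
    exact mul_le_mul (hB' x hx) (norm_gradient_le hf x) (norm_nonneg _)
      ((norm_nonneg _).trans (hB' x hx))
  -- Tested with a fixed vector $v$, the claim is integration by parts for directional derivatives.
  -- By Rademacher's theorem these come from the gradient almost everywhere.
  refine ext_inner_left ℝ fun v => ?_
  rw [inner_neg_right, ← integral_inner i1, ← integral_inner i2]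
  have h := hf.integral_lineDeriv_mul_eq (μ := volume) hφ hc v
  have e1 : ∫ x, inner ℝ v (φ x • gradient f x) = ∫ x, lineDeriv ℝ f x v * φ x := by
    refine integral_congr_ae ?_
    filter_upwards [hf.ae_differentiableAt (μ := volume)] with x hx
    rw [inner_smul_right, real_inner_comm, inner_gradient, hx.lineDeriv_eq_fderiv, mul_comm]
  have e2 : ∫ x, inner ℝ v (f x • gradient φ x) = -∫ x, lineDeriv ℝ φ x (-v) * f x := by
    rw [← integral_neg]
    refine integral_congr_ae ?_
    filter_upwards [hφ.ae_differentiableAt (μ := volume)] with x hx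
    rw [inner_smul_right, real_inner_comm, inner_gradient, hx.lineDeriv_eq_fderiv, map_neg]
    ring
  rw [e1, e2, h]

/-- A smooth cutoff function. -/
theorem exists_cutoff (hΩ : IsOpen Ω) {K : Set (Eucl d)} (hK : IsCompact K) (hKΩ : K ⊆ Ω) :
    ∃ χ : Eucl d → ℝ, IsTestFunction Ω χ ∧ (∀ᶠ x in 𝓝ˢ K, χ x = 1) ∧ ∀ x, |χ x| ≤ 1 := by
  obtain ⟨δ, hδ, hsub⟩ := hK.exists_cthickening_subset_open hΩ hKΩ
  obtain ⟨χ, h1, h0, hI⟩ := exists_contMDiffMap_one_nhds_of_subset_interior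
    (modelWithCornersSelf ℝ (Eucl d)) (n := ⊤) hK.isClosed (t := Metric.cthickening δ K)
    ((Metric.self_subset_thickening hδ K).trans
      (interior_maximal (Metric.thickening_subset_cthickening δ K) Metric.isOpen_thickening))
  have hts : tsupport χ ⊆ Metric.cthickening δ K :=
    closure_minimal (Function.support_subset_iff'.2 h0) Metric.isClosed_cthickening
  refine ⟨χ, ⟨χ.contMDiff.contDiff, ?_, hts.trans hsub⟩, h1, fun x => ?_⟩
  · exact HasCompactSupport.of_support_subset_isCompact hK.cthickening
      (Function.support_subset_iff'.2 h0)
  · rw [abs_le]; exact ⟨by linarith [(hI x).1], (hI x).2⟩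

theorem tendsto_eLpNorm_zero {α G : Type*} [MeasurableSpace α] {μ : Measure α} [IsFiniteMeasure μ]
    [NormedAddCommGroup G] {F : ℕ → α → G} {B : ℝ} (hm : ∀ n, AEStronglyMeasurable (F n) μ)
    (hb : ∀ n, ∀ᵐ x ∂μ, ‖F n x‖ ≤ B) (hl : ∀ᵐ x ∂μ, Tendsto (fun n => F n x) atTop (𝓝 0)) :
    Tendsto (fun n => eLpNorm (F n) 2 μ) atTop (𝓝 0) := by
  simp only [eLpNorm_eq_lintegral_rpow_enorm_toReal two_ne_zero ENNReal.ofNat_ne_top]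
  have key : Tendsto (fun n => ∫⁻ x, ‖F n x‖ₑ ^ (2 : ℝ≥0∞).toReal ∂μ) atTop (𝓝 0) := by
    have := tendsto_lintegral_of_dominated_convergence' (μ := μ)
      (F := fun n x => ‖F n x‖ₑ ^ (2 : ℝ≥0∞).toReal) (f := fun _ => 0)
      (fun _ => ENNReal.ofReal B ^ (2 : ℝ≥0∞).toReal) (fun n => (hm n).enorm.pow_const _)
      (fun n => ?_) ?_ ?_
    · simpa using this
    · filter_upwards [hb n] with x hx
      refine ENNReal.rpow_le_rpow ?_ (by simp)
      rw [← ofReal_norm]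
      exact ENNReal.ofReal_le_ofReal hx
    · rw [lintegral_const]
      exact ENNReal.mul_ne_top (by simp) (measure_ne_top _ _)
    · filter_upwards [hl] with x hx
      have h1 := (ENNReal.continuous_rpow_const (y := (2 : ℝ≥0∞).toReal)).tendsto ‖(0 : G)‖ₑ
      have := h1.comp hx.enorm
      simpa [Function.comp_def] using this
  have h2 := (ENNReal.continuous_rpow_const (y := 1 / (2 : ℝ≥0∞).toReal)).tendsto 0
  have := h2.comp key
  simpa [Function.comp_def] using this

theorem finite_restrict (hb : Bornology.IsBounded Ω) :
    IsFiniteMeasure ((volume : Measure (Eucl d)).restrict Ω) :=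
  ⟨by simpa using hb.measure_lt_top⟩

/-- A bounded function with uniformly bounded local difference quotients on a bounded open set
belongs to `H¹`. -/
theorem hasWeakGradient_of_local (hΩ : IsOpen Ω) (hb : Bornology.IsBounded Ω) {B : ℝ}
    (hB : ∀ x ∈ Ω, |f x| ≤ B) (hL : ∀ x ∈ Ω, ∀ᶠ y in 𝓝 x, |f y - f x| ≤ C * ‖y - x‖) :
    HasWeakGradient Ω f (gradient f) := by
  have := finite_restrict hb
  have hcont : ContinuousOn f Ω := by
    refine fun x hx => ContinuousAt.continuousWithinAt ?_
    rw [ContinuousAt, tendsto_iff_norm_sub_tendsto_zero]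
    refine squeeze_zero' (.of_forall fun _ => norm_nonneg _) (hL x hx) ?_
    have : Continuous fun y => (C : ℝ) * ‖y - x‖ := by fun_prop
    simpa using this.tendsto x
  refine ⟨?_, ?_, fun φ hφ => ?_⟩
  · exact MemLp.of_bound (hcont.aestronglyMeasurable hΩ.measurableSet) B
      ((ae_restrict_iff' hΩ.measurableSet).2 (.of_forall hB))
  · refine MemLp.of_bound (measurable_gradient f).aestronglyMeasurable C
      ((ae_restrict_iff' hΩ.measurableSet).2 (.of_forall fun x hx => ?_))
    rw [norm_gradient]
    exact norm_fderiv_le_of_lip' ℝ C.2 (hL x hx)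
  -- The function is controlled only inside $\Omega$. Multiplied by a cutoff equal to $1$ near the
  -- support of $\varphi$ it becomes Lipschitz on the whole space, and the cutoff is invisible in
  -- both integrals.
  · obtain ⟨χ, hχ, hχ1, hχb⟩ := exists_cutoff hΩ hφ.2.1.isCompact hφ.2.2
    obtain ⟨D, hD⟩ := hφ.lipschitz
    obtain ⟨E, hE⟩ := hχ.lipschitz
    have hlip : LipschitzWith (C + B.toNNReal * E) fun x => χ x * f x := by
      refine lipschitzWith_of_eventually fun x => ?_
      by_cases hx : x ∈ Ω
      · filter_upwards [hL x hx] with y hy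
        have h1 : |χ y - χ x| ≤ E * ‖y - x‖ := by
          simpa [Real.dist_eq, dist_eq_norm] using hE.dist_le_mul y x
        have hB0 : |f x| ≤ B.toNNReal := (hB x hx).trans (Real.le_coe_toNNReal B)
        calc |χ y * f y - χ x * f x| = |χ y * (f y - f x) + f x * (χ y - χ x)| := by ring_nf
          _ ≤ |χ y| * |f y - f x| + |f x| * |χ y - χ x| := by
            rw [← abs_mul, ← abs_mul]; exact abs_add_le _ _
          _ ≤ 1 * (C * ‖y - x‖) + B.toNNReal * (E * ‖y - x‖) := by
            gcongr
            exact hχb y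
          _ = _ := by push_cast; ring
      · have hx' : x ∉ tsupport χ := fun h => hx (hχ.2.2 h)
        filter_upwards [(isClosed_tsupport χ).isOpen_compl.mem_nhds hx'] with y hy
        rw [image_eq_zero_of_notMem_tsupport hy, image_eq_zero_of_notMem_tsupport hx']
        simp only [zero_mul, sub_self, abs_zero]
        positivity
    have key := integral_smul_gradient hlip hD hφ.2.1
    have heq : ∀ x ∈ tsupport φ, (fun x => χ x * f x) =ᶠ[𝓝 x] f := by
      intro x hx
      filter_upwards [(eventually_nhdsSet_iff_forall.1 hχ1) x hx] with y hy
      rw [hy, one_mul]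
    rw [setIntegral_eq_integral_of_forall_compl_eq_zero, setIntegral_eq_integral_of_forall_compl_eq_zero]
    · convert key using 2
      · ext1 x
        by_cases hx : x ∈ tsupport φ
        · rw [show χ x * f x = f x from (heq x hx).self_of_nhds]
        · rw [gradient_of_notMem_tsupport hx, smul_zero, smul_zero]
      · congr 1
        ext1 x
        by_cases hx : x ∈ tsupport φ
        · rw [gradient_congr (heq x hx)]
        · rw [image_eq_zero_of_notMem_tsupport hx, zero_smul, zero_smul]
    · intro x hx
      rw [image_eq_zero_of_notMem_tsupport fun h => hx (hφ.2.2 h), zero_smul]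
    · intro x hx
      rw [gradient_of_notMem_tsupport fun h => hx (hφ.2.2 h), smul_zero]

/-- Lipschitz functions with compact support can be approximated by test functions. -/
theorem exists_testFunction_approx (hΩ : IsOpen Ω) (hb : Bornology.IsBounded Ω)
    (hf : LipschitzWith C f) (hc : HasCompactSupport f) (hs : tsupport f ⊆ Ω) {ε : ℝ≥0∞}
    (hε : 0 < ε) : ∃ φ, IsTestFunction Ω φ ∧
      eLpNorm (fun x => φ x - f x) 2 (volume.restrict Ω) ≤ ε ∧
      eLpNorm (fun x => gradient φ x - gradient f x) 2 (volume.restrict Ω) ≤ ε := by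
  have := finite_restrict hb
  obtain ⟨δ, hδ, hsub⟩ := hc.isCompact.exists_cthickening_subset_open hΩ hs
  -- Outer radii at most $\delta$ keep the mollified functions supported in $\Omega$. The fixed
  -- ratio $2$ of the radii is what the almost everywhere convergence of mollifications requires.
  let b : ℕ → ContDiffBump (0 : Eucl d) := fun k =>
    ⟨δ / (k + 1) / 2, δ / (k + 1), by positivity, half_lt_self (by positivity)⟩
  have hbδ : ∀ k, (b k).rOut ≤ δ := fun k => div_le_self hδ.le (by norm_cast; omega)
  have hb0 : Tendsto (fun k => (b k).rOut) atTop (𝓝 0) := by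
    simpa [b, div_eq_mul_inv] using
      (tendsto_one_div_add_atTop_nhds_zero_nat (𝕜 := ℝ)).const_mul δ
  let ψ : ℕ → Eucl d → ℝ := fun k =>
    convolution ((b k).normed volume) f (ContinuousLinearMap.lsmul ℝ ℝ) volume
  have hloc : LocallyIntegrable f := hf.continuous.locallyIntegrable
  have hsupp : ∀ k, Function.support (ψ k) ⊆ Metric.cthickening δ (tsupport f) := by
    intro k
    refine (support_convolution_subset _).trans ?_
    rw [ContDiffBump.support_normed_eq]
    rintro _ ⟨y, hy, x, hx, rfl⟩
    refine Metric.mem_cthickening_of_dist_le _ x δ _ (subset_tsupport _ hx) ?_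
    rw [mem_ball_zero_iff] at hy
    simpa using hy.le.trans (hbδ k)
  have htest : ∀ k, IsTestFunction Ω (ψ k) := by
    intro k
    refine ⟨(b k).hasCompactSupport_normed.contDiff_convolution_left _ (b k).contDiff_normed hloc,
      ?_, ?_⟩
    · exact HasCompactSupport.of_support_subset_isCompact hc.isCompact.cthickening (hsupp k)
    · exact (closure_minimal (hsupp k) Metric.isClosed_cthickening).trans hsub
  have hclose : ∀ k x, |ψ k x - f x| ≤ C * (b k).rOut := by
    intro k x
    have := (b k).dist_normed_convolution_le (μ := volume) (x₀ := x) (ε := C * (b k).rOut)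
      hf.continuous.aestronglyMeasurable fun y hy => (hf.dist_le_mul y x).trans
        (mul_le_mul_of_nonneg_left (Metric.mem_ball.1 hy).le C.2)
    simpa [Real.dist_eq] using this
  -- The derivative of the mollification is the mollification of the almost everywhere derivative.
  -- The Lipschitz constant dominates the difference quotients under the integral.
  have hfd : ∀ k x, HasFDerivAt (ψ k)
      (convolution ((b k).normed volume) (fderiv ℝ f) (ContinuousLinearMap.lsmul ℝ ℝ) volume x)
      x := by
    intro k x
    have hnc := (b k).continuous_normed (μ := (volume : Measure (Eucl d)))
    have hmp : MeasurePreserving (fun t : Eucl d => x - t) volume volume :=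
      Measure.measurePreserving_sub_left volume x
    have := hasFDerivAt_integral_of_dominated_loc_of_lip (μ := (volume : Measure (Eucl d)))
      (F := fun y t => (b k).normed volume t • f (y - t)) (x₀ := x) (s := Set.univ)
      (F' := fun t => (b k).normed volume t • fderiv ℝ f (x - t))
      (bound := fun t => (b k).normed volume t * C) univ_mem ?_ ?_ ?_ ?_ ?_ ?_
    · exact this.2
    · refine .of_forall fun y => Continuous.aestronglyMeasurable ?_
      exact hnc.smul (hf.continuous.comp (by fun_prop))
    · refine Continuous.integrable_of_hasCompactSupport ?_ ?_
      · exact hnc.smul (hf.continuous.comp (by fun_prop))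
      · exact (b k).hasCompactSupport_normed.smul_right
    · exact hnc.aestronglyMeasurable.smul
        ((measurable_fderiv ℝ f).comp (by fun_prop)).aestronglyMeasurable
    · refine .of_forall fun t => ?_
      refine LipschitzOnWith.of_dist_le_mul fun y _ z _ => ?_
      have hn := (b k).nonneg_normed (μ := volume) t
      have h1 := hf.dist_le_mul (y - t) (z - t)
      rw [dist_sub_right] at h1
      change _ ≤ |(b k).normed volume t * (C : ℝ)| * dist y z
      refine le_trans ?_ (mul_le_mul_of_nonneg_right (le_abs_self _) dist_nonneg)
      rw [dist_smul₀, Real.norm_of_nonneg hn, mul_assoc]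
      exact mul_le_mul_of_nonneg_left h1 hn
    · exact (b k).integrable_normed.mul_const _
    · have h1 := hmp.quasiMeasurePreserving.ae (hf.ae_differentiableAt (μ := volume))
      filter_upwards [h1] with t ht
      have h2 : HasFDerivAt (fun y => f (y - t)) (fderiv ℝ f (x - t)) x := by
        have h3 := ht.hasFDerivAt.comp x ((hasFDerivAt_id x).sub_const t)
        simpa [Function.comp_def] using h3
      exact h2.fun_const_smul _
  have hψlip : ∀ k, LipschitzWith C (ψ k) := by
    intro k
    refine LipschitzWith.of_dist_le_mul fun x y => ?_
    have hint : ∀ z, Integrable fun t => (b k).normed volume t • f (z - t) := fun z =>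
      Continuous.integrable_of_hasCompactSupport
        (((b k).continuous_normed).smul (hf.continuous.comp (by fun_prop)))
        (b k).hasCompactSupport_normed.smul_right
    rw [dist_eq_norm]
    change ‖(∫ t, (b k).normed volume t • f (x - t)) - ∫ t, (b k).normed volume t • f (y - t)‖ ≤ _
    rw [← integral_sub (hint x) (hint y)]
    have h1 := norm_integral_le_of_norm_le (μ := (volume : Measure (Eucl d)))
      (f := fun t => (b k).normed volume t • f (x - t) - (b k).normed volume t • f (y - t))
      ((b k).integrable_normed.mul_const (C * dist x y)) (.of_forall fun t => ?_)
    · rwa [integral_mul_const, (b k).integral_normed, one_mul] at h1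
    · have hn := (b k).nonneg_normed (μ := volume) t
      rw [← smul_sub, norm_smul, Real.norm_of_nonneg hn, ← dist_eq_norm]
      refine mul_le_mul_of_nonneg_left ?_ hn
      simpa using hf.dist_le_mul (x - t) (y - t)
  have hlim1 : Tendsto (fun k => eLpNorm (fun x => ψ k x - f x) 2 (volume.restrict Ω)) atTop
      (𝓝 0) := by
    refine tendsto_eLpNorm_zero (B := C * δ) (fun k => ?_) (fun k => .of_forall fun x => ?_)
      (.of_forall fun x => ?_)
    · exact ((htest k).1.continuous.sub hf.continuous).aestronglyMeasurable
    · exact (hclose k x).trans (mul_le_mul_of_nonneg_left (hbδ k) C.2)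
    · refine squeeze_zero_norm (hclose · x) ?_
      simpa using hb0.const_mul (C : ℝ)
  have hlim2 : Tendsto (fun k => eLpNorm (fun x => gradient (ψ k) x - gradient f x) 2
      (volume.restrict Ω)) atTop (𝓝 0) := by
    refine tendsto_eLpNorm_zero (B := C + C) (fun k => ?_) (fun k => .of_forall fun x => ?_) ?_
    · exact ((measurable_gradient _).sub (measurable_gradient _)).aestronglyMeasurable
    · exact (norm_sub_le _ _).trans
        (add_le_add (norm_gradient_le (hψlip k) x) (norm_gradient_le hf x))
    -- The mollified derivatives converge almost everywhere by Lebesgue differentiation. They are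
    -- bounded by the Lipschitz constant, so convergence in $L^2(\Omega)$ follows.
    · have hfl : LocallyIntegrable (fderiv ℝ f) (volume : Measure (Eucl d)) := by
        have : MemLp (fderiv ℝ f) ⊤ (volume : Measure (Eucl d)) :=
          memLp_top_of_bound (measurable_fderiv ℝ f).aestronglyMeasurable C
            (.of_forall fun x => norm_fderiv_le_of_lipschitz ℝ hf)
        exact this.locallyIntegrable le_top
      have h1 := ContDiffBump.ae_convolution_tendsto_right_of_locallyIntegrable
        (φ := b) (K := 2) (μ := (volume : Measure (Eucl d))) hb0
        (.of_forall fun k => (mul_div_cancel₀ (δ / (k + 1)) (two_ne_zero' ℝ)).ge) hfl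
      refine ae_restrict_of_ae ?_
      filter_upwards [h1] with x hx
      rw [tendsto_iff_norm_sub_tendsto_zero] at hx
      rw [tendsto_zero_iff_norm_tendsto_zero]
      refine hx.congr fun k => ?_
      rw [norm_gradient_sub, (hfd k x).fderiv]
  obtain ⟨k, h1, h2⟩ := ((hlim1.eventually_le_const hε).and (hlim2.eventually_le_const hε)).exists
  exact ⟨ψ k, htest k, h1, h2⟩

/-- The soft threshold function. -/
noncomputable def softThreshold (ε t : ℝ) : ℝ := t - max (-ε) (min t ε)

theorem softThreshold_of_abs_le {ε t : ℝ} (h : |t| ≤ ε) : softThreshold ε t = 0 := by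
  rw [abs_le] at h
  rw [softThreshold, min_eq_left h.2, max_eq_right h.1, sub_self]

theorem softThreshold_of_lt {ε t : ℝ} (hε : 0 < ε) (h : ε < t) : softThreshold ε t = t - ε := by
  rw [softThreshold, min_eq_right h.le, max_eq_right (by linarith)]

theorem softThreshold_of_lt_neg {ε t : ℝ} (hε : 0 < ε) (h : t < -ε) :
    softThreshold ε t = t + ε := by
  rw [softThreshold, min_eq_left (by linarith), max_eq_left h.le, sub_neg_eq_add]

theorem abs_softThreshold_sub_le {ε : ℝ} (hε : 0 < ε) (t : ℝ) :
    |softThreshold ε t - t| ≤ ε := by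
  rw [softThreshold, abs_le]
  constructor
  · have : max (-ε) (min t ε) ≤ ε := max_le (by linarith) (min_le_right _ _)
    linarith
  · have := le_max_left (-ε) (min t ε)
    linarith

theorem lipschitz_softThreshold (ε : ℝ) : LipschitzWith 1 (softThreshold ε) := by
  refine LipschitzWith.of_dist_le_mul fun s t => ?_
  simp only [NNReal.coe_one, one_mul, Real.dist_eq, softThreshold]
  rcases le_total s ε with h1 | h1 <;> rcases le_total t ε with h2 | h2 <;>
  simp only [min_eq_left, min_eq_right, h1, h2] <;>
  rcases le_total (-ε) s with h3 | h3 <;> rcases le_total (-ε) t with h4 | h4 <;>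
  rcases le_total (-ε) ε with h5 | h5 <;>
  simp only [max_eq_left, max_eq_right, h3, h4, h5] <;>
  rw [abs_le] <;> constructor <;> cases abs_cases (s - t) <;> linarith

/-- A Lipschitz function that vanishes outside a bounded open set `Ω` belongs to `H¹₀(Ω)`. -/
theorem memH10_of_lipschitz (hΩ : IsOpen Ω) (hb : Bornology.IsBounded Ω)
    (hf : LipschitzWith C f) (h0 : ∀ x ∉ Ω, f x = 0) : MemH10 Ω f := by
  classical
  have := finite_restrict hb
  let ε : ℕ → ℝ := fun n => 1 / ((n : ℝ) + 1)
  have hε : ∀ n, 0 < ε n := fun n => by positivity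
  have hε0 : Tendsto ε atTop (𝓝 0) := tendsto_one_div_add_atTop_nhds_zero_nat
  have hε1 : ∀ n, ε n ≤ 1 := fun n => by
    simp only [ε]; rw [div_le_one (by positivity)]; norm_cast; omega
  -- The truncation is supported in the closed set $\{|f|\ge\varepsilon_n\}$, which lies in $\Omega$
  -- and is therefore compact.
  let F : ℕ → Eucl d → ℝ := fun n x => softThreshold (ε n) (f x)
  -- On the zero set of $f$ all truncations have gradient zero; elsewhere their gradients eventually
  -- equal that of $f$. With this choice of $g$ the gradients converge at every point, and it need
  -- not be known that $\nabla f=0$ almost everywhere on $\{f=0\}$.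
  let g : Eucl d → Eucl d := fun x => if f x = 0 then 0 else gradient f x
  have hF : ∀ n, LipschitzWith C (F n) := fun n => by
    simpa [Function.comp_def, F] using (lipschitz_softThreshold (ε n)).comp hf
  have hFc : ∀ n x, |F n x - f x| ≤ ε n := fun n x => abs_softThreshold_sub_le (hε n) (f x)
  have hts : ∀ n, tsupport (F n) ⊆ {x | ε n ≤ |f x|} := fun n => by
    refine closure_minimal (fun x hx => ?_) (isClosed_le continuous_const hf.continuous.abs)
    by_contra h
    exact hx (softThreshold_of_abs_le (not_le.1 h).le)
  have htsΩ : ∀ n, tsupport (F n) ⊆ Ω := fun n x hx => by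
    by_contra h
    have := hts n hx
    rw [Set.mem_ofPred_eq, h0 x h, abs_zero] at this
    exact absurd this (not_le.2 (hε n))
  have hcs : ∀ n, HasCompactSupport (F n) := fun n =>
    Metric.isCompact_of_isClosed_isBounded (isClosed_tsupport _) (hb.subset (htsΩ n))
  have hgb : ∀ x, ‖g x‖ ≤ C := fun x => by
    by_cases h : f x = 0
    · simp [g, h]
    · simpa [g, h] using norm_gradient_le hf x
  have hgm : Measurable g :=
    Measurable.ite (hf.continuous.measurable (measurableSet_singleton 0)) measurable_const
      (measurable_gradient f)
  have hgrad : ∀ x, ∀ᶠ n in atTop, gradient (F n) x = g x := by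
    intro x
    by_cases hx : f x = 0
    · refine .of_forall fun n => ?_
      have h1 : F n =ᶠ[𝓝 x] fun _ => 0 := by
        have : ∀ᶠ y in 𝓝 x, |f y| < ε n :=
          hf.continuous.abs.continuousAt.eventually (gt_mem_nhds (by simpa [hx] using hε n))
        filter_upwards [this] with y hy using softThreshold_of_abs_le hy.le
      rw [gradient_congr h1]
      simp [g, hx, gradient]
    · have h2 : ∀ᶠ n in atTop, ε n < |f x| := hε0.eventually_lt_const (abs_pos.2 hx)
      filter_upwards [h2] with n hn
      have h3 : fderiv ℝ (F n) x = fderiv ℝ f x := by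
        rcases lt_or_gt_of_ne hx with h | h
        · rw [abs_of_neg h] at hn
          have h4 : F n =ᶠ[𝓝 x] fun y => f y + ε n := by
            have : ∀ᶠ y in 𝓝 x, f y < -ε n :=
              hf.continuous.continuousAt.eventually (gt_mem_nhds (by linarith))
            filter_upwards [this] with y hy using softThreshold_of_lt_neg (hε n) hy
          rw [h4.fderiv_eq, fderiv_add_const]
        · rw [abs_of_pos h] at hn
          have h4 : F n =ᶠ[𝓝 x] fun y => f y - ε n := by
            have : ∀ᶠ y in 𝓝 x, ε n < f y :=
              hf.continuous.continuousAt.eventually (lt_mem_nhds hn)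
            filter_upwards [this] with y hy using softThreshold_of_lt (hε n) hy
          rw [h4.fderiv_eq, fderiv_sub_const]
      simp only [g, hx, if_false, gradient, h3]
  have hgl : ∀ x, Tendsto (fun n => gradient (F n) x) atTop (𝓝 (g x)) := fun x =>
    tendsto_const_nhds.congr' ((hgrad x).mono fun n hn => hn.symm)
  have hFl : ∀ x, Tendsto (fun n => F n x) atTop (𝓝 (f x)) := fun x => by
    rw [tendsto_iff_norm_sub_tendsto_zero]
    exact squeeze_zero (fun _ => norm_nonneg _) (hFc · x) hε0
  obtain ⟨B, hB⟩ : ∃ B, ∀ x, |f x| ≤ B := by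
    obtain ⟨B, hB⟩ := hb.isCompact_closure.exists_bound_of_continuousOn hf.continuous.continuousOn
    refine ⟨max B 0, fun x => ?_⟩
    by_cases hx : x ∈ Ω
    · exact (hB x (subset_closure hx)).trans (le_max_left _ _)
    · rw [h0 x hx, abs_zero]; exact le_max_right _ _
  have hFB : ∀ n x, |F n x| ≤ B + 1 := fun n x => by
    have h1 := abs_sub_abs_le_abs_sub (F n x) (f x)
    linarith [hFc n x, hε1 n, hB x]
  have hFw : ∀ n, HasWeakGradient Ω (F n) (gradient (F n)) := fun n =>
    hasWeakGradient_of_local hΩ hb (fun x _ => hFB n x) fun x _ => .of_forall fun y => by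
      simpa [Real.dist_eq, dist_eq_norm] using (hF n).dist_le_mul y x
  refine ⟨g, ⟨?_, ?_, fun φ hφ => ?_⟩, ?_⟩
  · exact MemLp.of_bound hf.continuous.aestronglyMeasurable B (.of_forall hB)
  · exact MemLp.of_bound hgm.aestronglyMeasurable C (.of_forall hgb)
  · obtain ⟨D, hD⟩ := hφ.lipschitz
    obtain ⟨B', hB'⟩ := hφ.2.1.isCompact.exists_bound_of_continuousOn
      hD.continuous.continuousOn
    have hB'' : ∀ x, ‖φ x‖ ≤ max B' 0 := fun x => by
      by_cases hx : x ∈ tsupport φ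
      · exact (hB' x hx).trans (le_max_left _ _)
      · rw [image_eq_zero_of_notMem_tsupport hx, norm_zero]; exact le_max_right _ _
    have l1 : Tendsto (fun n => ∫ x in Ω, F n x • gradient φ x) atTop
        (𝓝 (∫ x in Ω, f x • gradient φ x)) := by
      refine tendsto_integral_of_dominated_convergence (fun _ => (B + 1) * D) (fun n => ?_)
        (integrable_const _) (fun n => .of_forall fun x => ?_) (.of_forall fun x => ?_)
      · exact (hF n).continuous.aestronglyMeasurable.smul
          (measurable_gradient φ).aestronglyMeasurable
      · rw [norm_smul]
        exact mul_le_mul (hFB n x) (norm_gradient_le hD x) (norm_nonneg _)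
          ((abs_nonneg _).trans (hFB n x))
      · exact (hFl x).smul_const _
    have l2 : Tendsto (fun n => -∫ x in Ω, φ x • gradient (F n) x) atTop
        (𝓝 (-∫ x in Ω, φ x • g x)) := by
      refine (tendsto_integral_of_dominated_convergence (fun _ => max B' 0 * C) (fun n => ?_)
        (integrable_const _) (fun n => .of_forall fun x => ?_) (.of_forall fun x => ?_)).neg
      · exact hD.continuous.aestronglyMeasurable.smul
          (measurable_gradient _).aestronglyMeasurable
      · rw [norm_smul]
        exact mul_le_mul (hB'' x) (norm_gradient_le (hF n) x) (norm_nonneg _)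
          ((norm_nonneg _).trans (hB'' x))
      · exact (hgl x).const_smul _
    refine tendsto_nhds_unique l1 (l2.congr fun n => ?_)
    exact ((hFw n).2.2 φ hφ).symm
  · have hδ : ∀ n : ℕ, (0 : ℝ≥0∞) < ((n : ℝ≥0∞) + 1)⁻¹ := fun n => by simp
    -- A diagonal choice: the $n$-th truncation is approximated by a test function within $1/(n+1)$
    -- in both norms.
    choose φ hφ h1 h2 using fun n => exists_testFunction_approx hΩ hb (hF n) (hcs n) (htsΩ n) (hδ n)
    have hδ0 : Tendsto (fun n : ℕ => ((n : ℝ≥0∞) + 1)⁻¹) atTop (𝓝 0) := by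
      have := (tendsto_add_atTop_iff_nat 1).2 ENNReal.tendsto_inv_nat_nhds_zero
      simpa using this
    have l1 : Tendsto (fun n => eLpNorm (fun x => F n x - f x) 2 (volume.restrict Ω)) atTop
        (𝓝 0) := by
      refine tendsto_eLpNorm_zero (B := 1) (fun n => ?_) (fun n => .of_forall fun x => ?_)
        (.of_forall fun x => ?_)
      · exact ((hF n).continuous.sub hf.continuous).aestronglyMeasurable
      · exact (hFc n x).trans (hε1 n)
      · simpa using (hFl x).sub_const (f x)
    have l2 : Tendsto (fun n => eLpNorm (fun x => gradient (F n) x - g x) 2 (volume.restrict Ω))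
        atTop (𝓝 0) := by
      refine tendsto_eLpNorm_zero (B := C + C) (fun n => ?_) (fun n => .of_forall fun x => ?_)
        (.of_forall fun x => ?_)
      · exact ((measurable_gradient _).sub hgm).aestronglyMeasurable
      · exact (norm_sub_le _ _).trans (add_le_add (norm_gradient_le (hF n) x) (hgb x))
      · simpa using (hgl x).sub_const (g x)
    refine ⟨φ, hφ, ?_, ?_⟩
    · refine tendsto_of_tendsto_of_tendsto_of_le_of_le tendsto_const_nhds
        (by simpa using hδ0.add l1) (fun _ => zero_le) fun n => ?_
      have e : (fun x => φ n x - f x) = (fun x => φ n x - F n x) + fun x => F n x - f x := by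
        ext x; simp
      rw [e]
      refine (eLpNorm_add_le ?_ ?_ one_le_two).trans (add_le_add (h1 n) le_rfl)
      · exact ((hφ n).1.continuous.sub (hF n).continuous).aestronglyMeasurable
      · exact ((hF n).continuous.sub hf.continuous).aestronglyMeasurable
    · refine tendsto_of_tendsto_of_tendsto_of_le_of_le tendsto_const_nhds
        (by simpa using hδ0.add l2) (fun _ => zero_le) fun n => ?_
      have e : (fun x => gradient (φ n) x - g x) =
          (fun x => gradient (φ n) x - gradient (F n) x) + fun x => gradient (F n) x - g x := by
        ext1 x; simp
      rw [e]
      refine (eLpNorm_add_le ?_ ?_ one_le_two).trans (add_le_add (h2 n) le_rfl)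
      · exact ((measurable_gradient _).sub (measurable_gradient _)).aestronglyMeasurable
      · exact ((measurable_gradient _).sub hgm).aestronglyMeasurable

/-- The weak gradient is the classical gradient wherever the function is smooth. -/
theorem HasWeakGradient.ae_eq_gradient {u P : Eucl d → ℝ} {g : Eucl d → Eucl d}
    (h : HasWeakGradient Ω u g) {U : Set (Eucl d)} (hU : IsOpen U) (hUΩ : U ⊆ Ω)
    (hP : ContDiff ℝ ((⊤ : ℕ∞) : WithTop ℕ∞) P) (hu : ∀ x ∈ U, u x = P x) :
    g =ᵐ[volume.restrict U] gradient P := by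
  have hgP : Continuous (gradient P) :=
    (InnerProductSpace.toDual ℝ (Eucl d)).symm.continuous.comp (hP.continuous_fderiv (by simp))
  have hg : LocallyIntegrableOn g U := by
    have h1 : LocallyIntegrable g (volume.restrict U) :=
      (h.2.1.mono_measure (Measure.restrict_mono hUΩ le_rfl)).locallyIntegrable one_le_two
    exact (locallyIntegrableOn_of_locallyIntegrable_restrict h1)
  have key := hU.ae_eq_zero_of_integral_contDiff_smul_eq_zero (μ := volume)
    (f := fun x => g x - gradient P x)
    (hg.sub (hgP.locallyIntegrable.locallyIntegrableOn U)) fun ψ hψ hψc hψU => ?_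
  · rw [Filter.EventuallyEq, ae_restrict_iff' hU.measurableSet]
    filter_upwards [key] with x hx hxU
    exact sub_eq_zero.1 (hx hxU)
  · have ht : IsTestFunction Ω ψ := ⟨hψ, hψc, hψU.trans hUΩ⟩
    have h1 := h.2.2 ψ ht
    -- The smooth function $P$ need not be globally Lipschitz, but $\chi P$ is, and it agrees with
    -- $P$ near the support of $\psi$.
    obtain ⟨χ, hχ, hχ1, -⟩ := exists_cutoff hU hψc.isCompact hψU
    have hχP : IsTestFunction U fun x => χ x * P x :=
      ⟨hχ.1.mul hP, hχ.2.1.mul_right, (tsupport_mul_subset_left).trans hχ.2.2⟩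
    obtain ⟨D, hD⟩ := ht.lipschitz
    obtain ⟨E, hE⟩ := hχP.lipschitz
    have heq : ∀ x ∈ tsupport ψ, (fun x => χ x * P x) =ᶠ[𝓝 x] P := by
      intro x hx
      filter_upwards [(eventually_nhdsSet_iff_forall.1 hχ1) x hx] with y hy
      rw [hy, one_mul]
    have h2 := integral_smul_gradient hE hD hψc
    have h3 : ∫ x in Ω, u x • gradient ψ x = ∫ x, (χ x * P x) • gradient ψ x := by
      rw [setIntegral_eq_integral_of_forall_compl_eq_zero]
      · congr 1
        ext1 x
        by_cases hx : x ∈ tsupport ψ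
        · rw [hu x (hψU hx), show χ x * P x = P x from (heq x hx).self_of_nhds]
        · rw [gradient_of_notMem_tsupport hx, smul_zero, smul_zero]
      · intro x hx
        rw [gradient_of_notMem_tsupport fun h => hx (ht.2.2 h), smul_zero]
    have h4 : ∫ x in Ω, ψ x • g x = ∫ x, ψ x • g x := by
      refine setIntegral_eq_integral_of_forall_compl_eq_zero fun x hx => ?_
      rw [image_eq_zero_of_notMem_tsupport fun h => hx (ht.2.2 h), zero_smul]
    have h5 : ∫ x, ψ x • gradient (fun x => χ x * P x) x = ∫ x, ψ x • gradient P x := by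
      congr 1
      ext1 x
      by_cases hx : x ∈ tsupport ψ
      · rw [gradient_congr (heq x hx)]
      · rw [image_eq_zero_of_notMem_tsupport hx, zero_smul, zero_smul]
    rw [h3, h2, h4, h5] at h1
    have i1 : Integrable fun x => ψ x • g x := by
      have := hg.integrableOn_compact_subset hψU hψc.isCompact
      refine (integrableOn_iff_integrable_of_support_subset (s := tsupport ψ) ?_).1
        (this.continuousOn_smul hψ.continuous.continuousOn hψc.isCompact)
      exact (Function.support_smul_subset_left _ _).trans (subset_tsupport ψ)
    have i2 : Integrable fun x => ψ x • gradient P x :=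
      (hψ.continuous.smul hgP).integrable_of_hasCompactSupport hψc.smul_right
    simp only [smul_sub]
    rw [integral_sub i1 i2, ← neg_inj.1 h1, sub_self]

end Sobolev

/-! ### The reference simplex -/

section Reference

open scoped NNReal ENNReal

/-- The reference simplex in `ℝ^n`. -/
def refSimplex (n : ℕ) : Set (Eucl n) := {y | (∀ i, 0 ≤ y i) ∧ ∑ i, y i ≤ 1}

/-- The interior of the reference simplex. -/
def refInterior (n : ℕ) : Set (Eucl n) := {y | (∀ i, 0 < y i) ∧ ∑ i, y i < 1}

/-- The bubble function of the reference simplex. -/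
noncomputable def refBubble (n : ℕ) (y : Eucl n) : ℝ :=
  ((n + 1 : ℕ) : ℝ) ^ (n + 1) * ((1 - ∑ i, y i) * ∏ i, y i)

variable {n : ℕ} {k : ℤ}

theorem continuous_coord (i : Fin n) : Continuous fun y : Eucl n => y i :=
  (EuclideanSpace.proj (𝕜 := ℝ) i).continuous

theorem isClosed_refSimplex : IsClosed (refSimplex n) := by
  simp only [refSimplex, Set.ofPred_and, Set.ofPred_forall]
  exact (isClosed_iInter fun i => isClosed_le continuous_const (continuous_coord i)).inter
    (isClosed_le (continuous_finsetSum _ fun i _ => continuous_coord i) continuous_const)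

theorem isOpen_refInterior : IsOpen (refInterior n) := by
  simp only [refInterior, Set.ofPred_and, Set.ofPred_forall]
  exact (isOpen_iInter_of_finite fun i => isOpen_lt continuous_const (continuous_coord i)).inter
    (isOpen_lt (continuous_finsetSum _ fun i _ => continuous_coord i) continuous_const)

theorem refInterior_subset : refInterior n ⊆ refSimplex n :=
  fun _ hy => ⟨fun i => (hy.1 i).le, hy.2.le⟩

theorem refInterior_nonempty : (refInterior n).Nonempty := by
  refine ⟨WithLp.toLp 2 fun _ => 1 / ((n : ℝ) + 1), fun i => ?_, ?_⟩
  · positivity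
  · simp only [Finset.sum_const, Finset.card_univ, Fintype.card_fin, nsmul_eq_mul]
    rw [mul_one_div, div_lt_one (by positivity)]
    linarith

theorem coord_le_one {y : Eucl n} (hy : y ∈ refSimplex n) (i : Fin n) : y i ≤ 1 :=
  (Finset.single_le_sum (f := fun i => y i) (fun j _ => hy.1 j) (Finset.mem_univ i)).trans hy.2

theorem isCompact_refSimplex : IsCompact (refSimplex n) := by
  refine Metric.isCompact_of_isClosed_isBounded isClosed_refSimplex ?_
  refine (Metric.isBounded_iff_subset_closedBall 0).2 ⟨√n, fun y hy => ?_⟩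
  rw [mem_closedBall_zero_iff, EuclideanSpace.norm_eq]
  refine Real.sqrt_le_sqrt ?_
  calc ∑ i, ‖y i‖ ^ 2 ≤ ∑ _i : Fin n, (1 : ℝ) := Finset.sum_le_sum fun i _ => by
        rw [Real.norm_of_nonneg (hy.1 i)]
        exact pow_le_one₀ (hy.1 i) (coord_le_one hy i)
    _ = n := by simp

theorem refBubble_nonneg {y : Eucl n} (hy : y ∈ refSimplex n) : 0 ≤ refBubble n y :=
  mul_nonneg (by positivity) (mul_nonneg (by linarith [hy.2]) (Finset.prod_nonneg fun i _ => hy.1 i))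

theorem refBubble_pos {y : Eucl n} (hy : y ∈ refInterior n) : 0 < refBubble n y :=
  mul_pos (by positivity) (mul_pos (by linarith [hy.2]) (Finset.prod_pos fun i _ => hy.1 i))

theorem continuous_refBubble : Continuous (refBubble n) := by
  unfold refBubble
  fun_prop

/-- The Lebesgue measure on the reference simplex. -/
noncomputable abbrev refMeasure (n : ℕ) : Measure (Eucl n) := volume.restrict (refSimplex n)

instance : IsFiniteMeasure (refMeasure n) :=
  ⟨by simpa using isCompact_refSimplex.measure_lt_top⟩

theorem memLp_refMeasure {f : Eucl n → ℝ} (hf : Continuous f) : MemLp f 2 (refMeasure n) := by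
  obtain ⟨B, hB⟩ := isCompact_refSimplex.exists_bound_of_continuousOn hf.continuousOn
  exact MemLp.of_bound hf.aestronglyMeasurable B
    ((ae_restrict_iff' isClosed_refSimplex.measurableSet).2 (.of_forall hB))

theorem eqOn_of_ae_refMeasure {f : Eucl n → ℝ} (hf : Continuous f)
    (h : f =ᵐ[refMeasure n] fun _ => 0) : ∀ y ∈ refInterior n, f y = 0 :=
  Measure.eqOn_open_of_ae_eq (ae_restrict_of_ae_restrict_of_subset refInterior_subset h)
    isOpen_refInterior hf.continuousOn continuousOn_const

/-- The polynomial function of a polynomial. -/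
noncomputable def evalFun (n : ℕ) : MvPolynomial (Fin n) ℝ →ₗ[ℝ] Eucl n → ℝ where
  toFun q y := MvPolynomial.eval (fun i => y i) q
  map_add' p q := by ext y; simp
  map_smul' c q := by ext y; simp [MvPolynomial.smul_eval]

theorem evalFun_apply (q : MvPolynomial (Fin n) ℝ) (y : Eucl n) :
    evalFun n q y = MvPolynomial.eval (fun i => y i) q := rfl

theorem continuous_evalFun (q : MvPolynomial (Fin n) ℝ) : Continuous (evalFun n q) := by
  have : evalFun n q = fun y => MvPolynomial.eval (fun i => y i) q := rfl
  rw [this]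
  simp only [MvPolynomial.eval_eq']
  fun_prop

/-! ### Norm equivalence on polynomial spaces -/

/-- Through the injection $J_1$ the space $V$ carries a norm, and linear maps from a
finite-dimensional normed space are bounded. All constants on the reference simplex come from this
compactness-free form of norm equivalence. -/
theorem exists_norm_le {V W₁ W₂ : Type*} [AddCommGroup V] [Module ℝ V] [FiniteDimensional ℝ V]
    [NormedAddCommGroup W₁] [NormedSpace ℝ W₁] [NormedAddCommGroup W₂] [NormedSpace ℝ W₂]
    (J₁ : V →ₗ[ℝ] W₁) (h : Function.Injective J₁) (J₂ : V →ₗ[ℝ] W₂) :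
    ∃ C : ℝ≥0, ∀ v, ‖J₂ v‖ ≤ C * ‖J₁ v‖ := by
  let e := LinearEquiv.ofInjective J₁ h
  let G : LinearMap.range J₁ →L[ℝ] W₂ := (J₂ ∘ₗ e.symm.toLinearMap).toContinuousLinearMap
  refine ⟨‖G‖₊, fun v => ?_⟩
  have := G.le_opNorm (e v)
  simpa [G, e] using this

/-- A linear map into square integrable functions as a map into `L²`. -/
noncomputable def toL2 {V α : Type*} [AddCommGroup V] [Module ℝ V] [MeasurableSpace α]
    (μ : Measure α) (F : V →ₗ[ℝ] α → ℝ) (hF : ∀ v, MemLp (F v) 2 μ) : V →ₗ[ℝ] Lp ℝ 2 μ where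
  toFun v := (hF v).toLp
  map_add' v w := by
    rw [← MemLp.toLp_add (hF v) (hF w)]
    congr 1
    exact map_add F v w
  map_smul' c v := by
    rw [RingHom.id_apply, ← MemLp.toLp_const_smul c (hF v)]
    congr 1
    exact map_smul F c v

theorem norm_toL2 {V α : Type*} [AddCommGroup V] [Module ℝ V] [MeasurableSpace α]
    {μ : Measure α} {F : V →ₗ[ℝ] α → ℝ} (hF : ∀ v, MemLp (F v) 2 μ) (v : V) :
    ‖toL2 μ F hF v‖ = (eLpNorm (F v) 2 μ).toReal := Lp.norm_toLp _ (hF v)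

theorem toL2_injective {V α : Type*} [AddCommGroup V] [Module ℝ V] [MeasurableSpace α]
    {μ : Measure α} {F : V →ₗ[ℝ] α → ℝ} (hF : ∀ v, MemLp (F v) 2 μ)
    (h : ∀ v, F v =ᵐ[μ] (fun _ => 0) → v = 0) : Function.Injective (toL2 μ F hF) := by
  refine (injective_iff_map_eq_zero _).2 fun v hv => h v ?_
  have h1 := (hF v).coeFn_toLp
  have h2 : (hF v).toLp = 0 := hv
  rw [h2] at h1
  exact h1.symm.trans (Lp.coeFn_zero _ _ _)

theorem exists_eLpNorm_le {V α β : Type*} [AddCommGroup V] [Module ℝ V] [FiniteDimensional ℝ V]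
    [MeasurableSpace α] [MeasurableSpace β] {μ : Measure α} {ν : Measure β} {F : V →ₗ[ℝ] α → ℝ}
    {G : V →ₗ[ℝ] β → ℝ} (hF : ∀ v, MemLp (F v) 2 μ) (hG : ∀ v, MemLp (G v) 2 ν)
    (h : ∀ v, F v =ᵐ[μ] (fun _ => 0) → v = 0) :
    ∃ C : ℝ≥0, ∀ v, eLpNorm (G v) 2 ν ≤ C * eLpNorm (F v) 2 μ := by
  obtain ⟨C, hC⟩ := exists_norm_le (toL2 μ F hF) (toL2_injective hF h) (toL2 ν G hG)
  refine ⟨C, fun v => ?_⟩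
  have := hC v
  rw [norm_toL2, norm_toL2] at this
  rw [← ENNReal.toReal_le_toReal (hG v).2.ne (ENNReal.mul_ne_top (by simp) (hF v).2.ne),
    ENNReal.toReal_mul]
  exact this

/-- Evaluation on a polynomial space. -/
noncomputable def polyEval (n : ℕ) (k : ℤ) : polySpace n k →ₗ[ℝ] Eucl n → ℝ :=
  evalFun n ∘ₗ (polySpace n k).subtype

/-- The weight may vanish on the boundary of the simplex, as the square root of the bubble does;
nonvanishing on the nonempty open interior suffices. -/
theorem polyEval_eq_zero {q : polySpace n k} {w : Eucl n → ℝ} (hw : Continuous w)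
    (hpos : ∀ y ∈ refInterior n, w y ≠ 0)
    (h : (fun y => w y * polyEval n k q y) =ᵐ[refMeasure n] fun _ => 0) : q = 0 := by
  have h1 := eqOn_of_ae_refMeasure (hw.mul (continuous_evalFun q.1)) h
  refine Subtype.ext (eq_zero_of_eval_isOpen isOpen_refInterior refInterior_nonempty fun y hy => ?_)
  exact (mul_eq_zero.1 (h1 y hy)).resolve_left (hpos y hy)

theorem polyEval_eq_zero' {q : polySpace n k}
    (h : polyEval n k q =ᵐ[refMeasure n] fun _ => 0) : q = 0 :=
  polyEval_eq_zero (w := fun _ => 1) continuous_const (fun _ _ => one_ne_zero) (by simpa using h)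

theorem memLp_polyEval (q : polySpace n k) : MemLp (polyEval n k q) 2 (refMeasure n) :=
  memLp_refMeasure (continuous_evalFun q.1)

/-- The inverse estimate on the reference simplex. -/
theorem exists_pderiv_le (n : ℕ) (k : ℤ) : ∃ C : ℝ≥0, ∀ q ∈ polySpace n k, ∀ i,
    eLpNorm (evalFun n (MvPolynomial.pderiv i q)) 2 (refMeasure n) ≤
      C * eLpNorm (evalFun n q) 2 (refMeasure n) := by
  choose C hC using fun i : Fin n => exists_eLpNorm_le (F := polyEval n k)
    (G := evalFun n ∘ₗ (MvPolynomial.pderiv i).toLinearMap ∘ₗ (polySpace n k).subtype)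
    memLp_polyEval (fun q => memLp_refMeasure (continuous_evalFun _)) fun q => polyEval_eq_zero'
  refine ⟨∑ i, C i, fun q hq i => (hC i ⟨q, hq⟩).trans ?_⟩
  gcongr
  · exact Finset.single_le_sum (f := C) (fun _ _ => zero_le) (Finset.mem_univ i)
  · exact le_rfl

/-- Polynomials on the reference simplex are bounded by their `L²` norm. -/
theorem exists_sup_le (n : ℕ) (k : ℤ) : ∃ C : ℝ≥0, ∀ q ∈ polySpace n k, ∀ y ∈ refSimplex n,
    ‖evalFun n q y‖ₑ ≤ C * eLpNorm (evalFun n q) 2 (refMeasure n) := by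
  have : CompactSpace (refSimplex n) := isCompact_iff_compactSpace.1 isCompact_refSimplex
  let J : polySpace n k →ₗ[ℝ] C(refSimplex n, ℝ) :=
    { toFun := fun q => ⟨fun y => evalFun n q.1 y, (continuous_evalFun q.1).comp continuous_subtype_val⟩
      map_add' := fun p q => by ext y; simp
      map_smul' := fun c q => by ext y; simp }
  obtain ⟨C, hC⟩ := exists_norm_le (toL2 (refMeasure n) (polyEval n k) memLp_polyEval)
    (toL2_injective _ fun _ => polyEval_eq_zero') J
  refine ⟨C, fun q hq y hy => ?_⟩
  have h1 := ((J ⟨q, hq⟩).norm_coe_le_norm ⟨y, hy⟩).trans (hC ⟨q, hq⟩)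
  rw [norm_toL2] at h1
  have hfin := (memLp_polyEval (⟨q, hq⟩ : polySpace n k)).2.ne
  rw [← ofReal_norm]
  refine ENNReal.ofReal_le_of_le_toReal ?_
  rw [ENNReal.toReal_mul]
  exact h1

theorem integral_mul_le_eLpNorm {α : Type*} [MeasurableSpace α] {μ : Measure α} {f g : α → ℝ}
    (hf : MemLp f 2 μ) (hg : MemLp g 2 μ) :
    ∫ x, f x * g x ∂μ ≤ (eLpNorm f 2 μ).toReal * (eLpNorm g 2 μ).toReal := by
  have h := real_inner_le_norm hg.toLp hf.toLp
  rw [L2.inner_def, Lp.norm_toLp, Lp.norm_toLp, mul_comm] at h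
  refine le_trans (le_of_eq (integral_congr_ae ?_)) h
  filter_upwards [hf.coeFn_toLp, hg.coeFn_toLp] with x h1 h2
  rw [h1, h2]
  simp

theorem integral_mul_self_eq_eLpNorm {α : Type*} [MeasurableSpace α] {μ : Measure α} {f : α → ℝ}
    (hf : MemLp f 2 μ) : ∫ x, f x * f x ∂μ = (eLpNorm f 2 μ).toReal ^ 2 := by
  have h := real_inner_self_eq_norm_sq hf.toLp
  rw [L2.inner_def, Lp.norm_toLp] at h
  rw [← h]
  refine integral_congr_ae ?_
  filter_upwards [hf.coeFn_toLp] with x h1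
  rw [h1]
  simp [pow_two]

theorem integrable_mul_of_memLp {α : Type*} [MeasurableSpace α] {μ : Measure α} {f g : α → ℝ}
    (hf : MemLp f 2 μ) (hg : MemLp g 2 μ) : Integrable (fun x => f x * g x) μ :=
  hf.integrable_mul hg

theorem integrable_refMeasure {f : Eucl n → ℝ} (hf : Continuous f) :
    Integrable f (refMeasure n) := (memLp_refMeasure hf).integrable one_le_two

/-- Uniqueness for the weighted moment problem on the reference simplex. -/
theorem eq_zero_of_moments {b : MvPolynomial (Fin n) ℝ}
    (h : ∫ y, evalFun n b y * evalFun n b y * refBubble n y ∂refMeasure n = 0) : b = 0 := by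
  have hc := continuous_evalFun b
  have h1 : (fun y => evalFun n b y * evalFun n b y * refBubble n y) =ᵐ[refMeasure n] 0 := by
    refine (integral_eq_zero_iff_of_nonneg_ae ?_ ?_).1 h
    · refine (ae_restrict_iff' isClosed_refSimplex.measurableSet).2 (.of_forall fun y hy => ?_)
      exact mul_nonneg (mul_self_nonneg _) (refBubble_nonneg hy)
    · exact integrable_refMeasure ((hc.mul hc).mul continuous_refBubble)
  have h2 := eqOn_of_ae_refMeasure ((hc.mul hc).mul continuous_refBubble) h1
  refine eq_zero_of_eval_isOpen isOpen_refInterior refInterior_nonempty fun y hy => ?_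
  exact mul_self_eq_zero.1 ((mul_eq_zero.1 (h2 y hy)).resolve_right (refBubble_pos hy).ne')

/-- Solvability and stability of the weighted moment problem on the reference simplex. -/
theorem exists_moments (n : ℕ) (k : ℤ) : ∃ C : ℝ≥0, ∀ w : Eucl n → ℝ, MemLp w 2 (refMeasure n) →
    ∃ b ∈ polySpace n k, (∀ q ∈ polySpace n k,
      ∫ y, evalFun n q y * evalFun n b y * refBubble n y ∂refMeasure n =
        ∫ y, evalFun n q y * w y ∂refMeasure n) ∧
      eLpNorm (evalFun n b) 2 (refMeasure n) ≤ C * eLpNorm w 2 (refMeasure n) := by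
  have hsq : Continuous fun y => √(refBubble n y) := continuous_refBubble.sqrt
  -- With the weight $\sqrt\Phi$ the quadratic form $\int b^2\Phi$ becomes a squared $L^2$ norm,
  -- which is equivalent to the unweighted one on polynomials.
  let G : polySpace n k →ₗ[ℝ] Eucl n → ℝ :=
    { toFun := fun q y => √(refBubble n y) * polyEval n k q y
      map_add' := fun p q => by ext y; simp [mul_add]
      map_smul' := fun c q => by ext y; simp; ring }
  have hG : ∀ q, MemLp (G q) 2 (refMeasure n) := fun q =>
    memLp_refMeasure (hsq.mul (continuous_evalFun q.1))
  obtain ⟨C, hC⟩ := exists_eLpNorm_le (F := G) (G := polyEval n k) hG memLp_polyEval fun q hq =>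
    polyEval_eq_zero hsq (fun y hy => (Real.sqrt_pos.2 (refBubble_pos hy)).ne') hq
  let A : polySpace n k →ₗ[ℝ] Module.Dual ℝ (polySpace n k) := LinearMap.mk₂ ℝ
    (fun b q => ∫ y, polyEval n k q y * polyEval n k b y * refBubble n y ∂refMeasure n)
    (fun b b' q => by
      rw [← integral_add]
      · simp [mul_add, add_mul]
      all_goals
        exact integrable_refMeasure (((continuous_evalFun _).mul (continuous_evalFun _)).mul
          continuous_refBubble))
    (fun c b q => by
      rw [smul_eq_mul, ← integral_const_mul]
      congr 1; ext y; simp; ring)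
    (fun b q q' => by
      rw [← integral_add]
      · simp [add_mul]
      all_goals
        exact integrable_refMeasure (((continuous_evalFun _).mul (continuous_evalFun _)).mul
          continuous_refBubble))
    (fun c b q => by
      rw [smul_eq_mul, ← integral_const_mul]
      congr 1; ext y; simp; ring)
  have hA : Function.Injective A := by
    refine (injective_iff_map_eq_zero _).2 fun b hb => Subtype.ext (eq_zero_of_moments ?_)
    have := LinearMap.congr_fun hb b
    simp only [A, LinearMap.mk₂_apply, LinearMap.zero_apply] at this
    exact this
  -- The trial and test spaces coincide, so uniqueness gives existence by equality of dimensions.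
  have hAs : Function.Surjective A :=
    (LinearMap.injective_iff_surjective_of_finrank_eq_finrank Subspace.dual_finrank_eq.symm).1 hA
  -- With $N=\|b\|$, $S=\|\sqrt\Phi\,b\|$ and $W=\|w\|$, testing with $b$ gives $S^2\le NW$, and
  -- norm equivalence gives $N\le CS$. Hence $N^2\le C^2NW$.
  refine ⟨C ^ 2, fun w hw => ?_⟩
  let l : Module.Dual ℝ (polySpace n k) :=
    { toFun := fun q => ∫ y, polyEval n k q y * w y ∂refMeasure n
      map_add' := fun p q => by
        rw [← integral_add (integrable_mul_of_memLp (memLp_polyEval p) hw)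
          (integrable_mul_of_memLp (memLp_polyEval q) hw)]
        simp [add_mul]
      map_smul' := fun c q => by
        rw [RingHom.id_apply, smul_eq_mul, ← integral_const_mul]
        congr 1; ext y; simp; ring }
  obtain ⟨b, hb⟩ := hAs l
  have hmom : ∀ q : polySpace n k,
      ∫ y, polyEval n k q y * polyEval n k b y * refBubble n y ∂refMeasure n =
        ∫ y, polyEval n k q y * w y ∂refMeasure n := fun q => LinearMap.congr_fun hb q
  refine ⟨b.1, b.2, fun q hq => hmom ⟨q, hq⟩, ?_⟩
  have h1 := hC b
  have hb2 := memLp_polyEval b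
  change eLpNorm (polyEval n k b) 2 (refMeasure n) ≤ _
  have h2 : (eLpNorm (G b) 2 (refMeasure n)).toReal ^ 2 ≤
      (eLpNorm (polyEval n k b) 2 (refMeasure n)).toReal * (eLpNorm w 2 (refMeasure n)).toReal := by
    rw [← integral_mul_self_eq_eLpNorm (hG b)]
    refine le_trans (le_of_eq ?_) (integral_mul_le_eLpNorm hb2 hw)
    rw [← hmom b]
    refine setIntegral_congr_fun isClosed_refSimplex.measurableSet fun y hy => ?_
    change √(refBubble n y) * polyEval n k b y * (√(refBubble n y) * polyEval n k b y) = _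
    have := Real.mul_self_sqrt (refBubble_nonneg hy)
    linear_combination polyEval n k b y * polyEval n k b y * this
  have h3 : (eLpNorm (polyEval n k b) 2 (refMeasure n)).toReal ≤
      C * (eLpNorm (G b) 2 (refMeasure n)).toReal := by
    rw [← ENNReal.coe_toReal, ← ENNReal.toReal_mul]
    exact ENNReal.toReal_mono (ENNReal.mul_ne_top (by simp) (hG b).2.ne) h1
  rw [← ENNReal.toReal_le_toReal hb2.2.ne (ENNReal.mul_ne_top (by simp) hw.2.ne),
    ENNReal.toReal_mul]
  set N := (eLpNorm (polyEval n k b) 2 (refMeasure n)).toReal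
  set W := (eLpNorm w 2 (refMeasure n)).toReal
  set S := (eLpNorm (G b) 2 (refMeasure n)).toReal
  have hN : 0 ≤ N := ENNReal.toReal_nonneg
  have hW : 0 ≤ W := ENNReal.toReal_nonneg
  have hS : 0 ≤ S := ENNReal.toReal_nonneg
  have hC0 : (0 : ℝ) ≤ C := C.2
  rw [ENNReal.coe_toReal, NNReal.coe_pow]
  rcases hN.eq_or_lt with h0 | h0
  · rw [← h0]; positivity
  · have h4 : N * N ≤ N * ((C : ℝ) ^ 2 * W) := by
      calc N * N ≤ (C * S) * (C * S) := mul_le_mul h3 h3 hN (by positivity)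
        _ = (C : ℝ) ^ 2 * S ^ 2 := by ring
        _ ≤ (C : ℝ) ^ 2 * (N * W) := by gcongr
        _ = _ := by ring
    exact le_of_mul_le_mul_left h4 h0

end Reference

/-! ### Parametrization of simplices -/

section Param

open scoped NNReal ENNReal

variable {n D : ℕ} {S : Finset (Eucl D)}

/-- An affine parametrization of the simplex with the vertex set `S` over the reference simplex,
with an affine left inverse. -/
structure IsParam (S : Finset (Eucl D)) (A : Eucl n →ᵃ[ℝ] Eucl D) (B : Eucl D →ᵃ[ℝ] Eucl n) :
    Prop where
  left_inv : ∀ y, B (A y) = y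
  image : A '' refSimplex n = hull S
  weights : ∀ y ∈ refSimplex n, ∃ w : Eucl D → ℝ, (∀ a ∈ S, 0 ≤ w a) ∧ ∑ a ∈ S, w a = 1 ∧
    ∑ a ∈ S, w a • a = A y ∧ (S.card : ℝ) ^ S.card * ∏ a ∈ S, w a = refBubble n y

/-- The weights of $A y$ are $1-\sum_iy_i,y_1,\dots,y_n$. Affine independence makes $A$ injective,
so its linear part has a left inverse. The simplex may be a face, with $n<D$, and then $B$ is only a
one-sided inverse. -/
theorem exists_isParam (hc : S.card = n + 1)
    (hS : AffineIndependent ℝ (fun a : S => (a : Eucl D))) :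
    ∃ (A : Eucl n →ᵃ[ℝ] Eucl D) (B : Eucl D →ᵃ[ℝ] Eucl n), IsParam S A B := by
  classical
  let e : Fin (n + 1) ≃ S := (S.equivFinOfCardEq hc).symm
  let A := refMap fun i => (e i : Eucl D)
  let c : Eucl n → Fin (n + 1) → ℝ := fun y => Fin.cons (1 - ∑ i, y i) fun i => y i
  let w : Eucl n → Eucl D → ℝ := fun y a => if h : a ∈ S then c y (e.symm ⟨a, h⟩) else 0
  have hw : ∀ y i, w y (e i) = c y i := by
    intro y i; simp [w]
  have hsum : ∀ {F : Type} [AddCommMonoid F] (g : Eucl D → F), ∑ a ∈ S, g a = ∑ i, g (e i) := by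
    intro F _ g
    rw [← Finset.sum_coe_sort, ← e.sum_comp]
  have hprod : ∀ g : Eucl D → ℝ, ∏ a ∈ S, g a = ∏ i, g (e i) := by
    intro g
    rw [← Finset.prod_coe_sort, ← e.prod_comp]
  have hw1 : ∀ y, ∑ a ∈ S, w y a = 1 := by
    intro y
    rw [hsum]
    simp [hw, c, Fin.sum_univ_succ]
  have hwA : ∀ y, ∑ a ∈ S, w y a • a = A y := by
    intro y
    rw [hsum fun a => w y a • a, refMap_apply]
    simp [hw, c, Fin.sum_univ_succ]
  have hinj : ∀ y z, A y = A z → y = z := by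
    intro y z h
    have h0 := hS.eq_zero_of_sum_eq_zero_subtype (w := fun a => w y a - w z a)
      (by rw [Finset.sum_sub_distrib, hw1, hw1, sub_self])
      (by simp only [sub_smul, Finset.sum_sub_distrib]; rw [hwA, hwA, h, sub_self])
    ext i
    have h1 := h0 (e i.succ) (e i.succ).2
    rw [hw, hw] at h1
    simpa [c, sub_eq_zero] using h1
  have hlin : LinearMap.ker A.linear = ⊥ := by
    rw [LinearMap.ker_eq_bot]
    exact A.linear_injective_iff.2 fun y z h => hinj y z h
  obtain ⟨g, hg⟩ := A.linear.exists_leftInverse_of_injective hlin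
  let B : Eucl D →ᵃ[ℝ] Eucl n := g.toAffineMap.comp (AffineMap.id ℝ _ - AffineMap.const ℝ _ (A 0))
  have hB : ∀ x, B x = g (x - A 0) := fun x => by simp [B]
  refine ⟨A, B, fun y => ?_, ?_, fun y hy => ⟨w y, ?_, hw1 y, hwA y, ?_⟩⟩
  · have h1 := A.linearMap_vsub y 0
    simp only [vsub_eq_sub, sub_zero] at h1
    rw [hB, ← h1]
    exact LinearMap.congr_fun hg y
  · ext x
    constructor
    · rintro ⟨y, hy, rfl⟩
      refine mem_hull.2 ⟨w y, fun a ha => ?_, hw1 y, hwA y⟩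
      obtain ⟨i, rfl⟩ : ∃ i, (e i : Eucl D) = a := ⟨e.symm ⟨a, ha⟩, by simp⟩
      rw [hw]
      refine Fin.cases ?_ (fun j => ?_) i
      · simpa [c] using hy.2
      · simpa [c] using hy.1 j
    · rintro hx
      obtain ⟨v, hv0, hv1, rfl⟩ := mem_hull.1 hx
      rw [hsum, Fin.sum_univ_succ] at hv1
      have h1 : 1 - ∑ i : Fin n, v (e i.succ) = v (e 0) := by linarith
      refine ⟨WithLp.toLp 2 fun i => v (e i.succ), ⟨fun i => hv0 _ (e i.succ).2, ?_⟩, ?_⟩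
      · have := hv0 _ (e 0).2
        change ∑ i : Fin n, v (e i.succ) ≤ 1
        linarith
      · rw [refMap_apply, hsum fun a => v a • a, Fin.sum_univ_succ]
        change (1 - ∑ i : Fin n, v (e i.succ)) • _ + _ = _
        rw [h1]
  · intro a ha
    obtain ⟨i, rfl⟩ : ∃ i, (e i : Eucl D) = a := ⟨e.symm ⟨a, ha⟩, by simp⟩
    rw [hw]
    refine Fin.cases ?_ (fun j => ?_) i
    · simpa [c] using hy.2
    · simpa [c] using hy.1 j
  · rw [hprod]
    simp [hw, c, Fin.prod_univ_succ, refBubble, hc]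

namespace IsParam

variable {A : Eucl n →ᵃ[ℝ] Eucl D} {B : Eucl D →ᵃ[ℝ] Eucl n}

theorem injective (h : IsParam S A B) : Function.Injective A :=
  Function.LeftInverse.injective h.left_inv

theorem mem_hull (h : IsParam S A B) {y : Eucl n} (hy : y ∈ refSimplex n) : A y ∈ hull S :=
  h.image ▸ Set.mem_image_of_mem A hy

theorem exists_eq (h : IsParam S A B) {x : Eucl D} (hx : x ∈ hull S) :
    ∃ y ∈ refSimplex n, A y = x := by rwa [← h.image] at hx

theorem mem_refSimplex (h : IsParam S A B) {x : Eucl D} (hx : x ∈ hull S) :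
    B x ∈ refSimplex n := by
  obtain ⟨y, hy, rfl⟩ := h.exists_eq hx
  rwa [h.left_inv]

theorem linear_injective (h : IsParam S A B) : Function.Injective A.linear :=
  A.linear_injective_iff.2 h.injective

theorem measurableEmbedding (h : IsParam S A B) : MeasurableEmbedding A := by
  have hA : Continuous A := AffineMap.continuous_of_finiteDimensional A
  exact (hA.measurableEmbedding h.injective)

/-- The Euclidean Hausdorff measure on a simplex is a multiple of the image of the Lebesgue
measure on the reference simplex. -/
theorem exists_measure_eq (h : IsParam S A B) : ∃ c : ℝ≥0∞, c ≠ 0 ∧ c ≠ ⊤ ∧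
    (μHE[n] : Measure (Eucl D)).restrict (hull S) = c • (refMeasure n).map A := by
  -- The map $A$ is a linear isomorphism onto its direction space followed by an isometric
  -- embedding. On the direction space the Hausdorff measure and the image of Lebesgue measure are
  -- both Haar measures, hence proportional. The value of the factor is irrelevant, because it
  -- cancels in all later estimates.
  let s : Submodule ℝ (Eucl D) := LinearMap.range A.linear
  let L : Eucl n ≃L[ℝ] s := (LinearEquiv.ofInjective A.linear h.linear_injective).toContinuousLinearEquiv
  have hL : ∀ y, (L y : Eucl D) = A.linear y := fun y => rfl
  have hfin : Module.finrank ℝ s = n := by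
    rw [← L.toLinearEquiv.finrank_eq]; simp
  have hH : (μHE[n] : Measure s).IsAddHaarMeasure := by
    have := isAddHaarMeasure_euclideanHausdorffMeasure (E := s)
    rwa [hfin] at this
  have hM := L.isAddHaarMeasure_map (volume : Measure (Eucl n))
  let c := (μHE[n] : Measure s).addHaarScalarFactor (volume.map L)
  have hc : (μHE[n] : Measure s) = c • volume.map L := Measure.isAddLeftInvariant_eq_smul _ _
  have hcpos : 0 < c := Measure.addHaarScalarFactor_pos_of_isAddHaarMeasure _ _
  let ι : s → Eucl D := fun z => (z : Eucl D) + A 0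
  have hι : Isometry ι := Isometry.of_dist_eq fun x y => by
    simp only [ι, dist_add_right]; rfl
  have hιA : ι ∘ L = A := by
    ext1 y
    have := A.linearMap_vsub y 0
    simp only [vsub_eq_sub, sub_zero] at this
    simp only [Function.comp, ι, hL, this]
    abel
  have hmap := hι.map_euclideanHausdorffMeasure (d := n)
  have hιm : Measurable ι := hι.continuous.measurable
  have hLm : Measurable L := L.continuous.measurable
  have hsub : hull S ⊆ Set.range ι := by
    rw [← h.image]
    rintro _ ⟨y, -, rfl⟩
    exact ⟨L y, congrFun hιA y⟩
  refine ⟨c, by exact_mod_cast hcpos.ne', by simp, ?_⟩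
  have h1 : (μHE[n] : Measure (Eucl D)).restrict (Set.range ι) = (c : ℝ≥0∞) • volume.map A := by
    rw [← hmap, hc, Measure.map_smul, Measure.map_map hιm hLm, hιA]
    rfl
  have h2 : (μHE[n] : Measure (Eucl D)).restrict (hull S) =
      ((μHE[n] : Measure (Eucl D)).restrict (Set.range ι)).restrict (hull S) := by
    rw [Measure.restrict_restrict isClosed_hull.measurableSet,
      Set.inter_eq_self_of_subset_left hsub]
  rw [h2, h1, Measure.restrict_smul, h.measurableEmbedding.restrict_map, ← h.image,
    Set.preimage_image_eq _ h.injective]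

theorem eLpNorm_eq (h : IsParam S A B) {ν : Measure (Eucl D)} {c : ℝ≥0∞}
    (hν : ν = c • (refMeasure n).map A) {G : Type*} [NormedAddCommGroup G] (f : Eucl D → G) :
    eLpNorm f 2 ν = c ^ (1 / 2 : ℝ) * eLpNorm (fun y => f (A y)) 2 (refMeasure n) := by
  rw [hν, eLpNorm_smul_measure_of_ne_top (by simp), h.measurableEmbedding.eLpNorm_map_measure,
    smul_eq_mul]
  simp [Function.comp_def]

theorem integral_eq (h : IsParam S A B) {ν : Measure (Eucl D)} {c : ℝ≥0∞}
    (hν : ν = c • (refMeasure n).map A) (f : Eucl D → ℝ) :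
    ∫ x, f x ∂ν = c.toReal * ∫ y, f (A y) ∂refMeasure n := by
  rw [hν, integral_smul_measure, h.measurableEmbedding.integral_map, smul_eq_mul]

theorem memLp_comp (h : IsParam S A B) {ν : Measure (Eucl D)} {c : ℝ≥0∞} (hc : c ≠ 0)
    (hct : c ≠ ⊤) (hν : ν = c • (refMeasure n).map A) {f : Eucl D → ℝ} (hf : MemLp f 2 ν) :
    MemLp (fun y => f (A y)) 2 (refMeasure n) := by
  refine (h.measurableEmbedding.memLp_map_measure_iff (g := f)).1 ?_
  refine hf.of_measure_le_smul (c := c⁻¹) (by simpa using hc) ?_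
  rw [hν, smul_smul, ENNReal.inv_mul_cancel hc hct, one_smul]

end IsParam

/-- The weighted local moment problem on the simplex with the vertex set `S`. -/
def IsLocalOp (n : ℕ) (k : ℤ) (S : Finset (Eucl D)) (Φ v b : Eucl D → ℝ) : Prop :=
  IsPolyOn k (hull S) b ∧ (∀ x ∉ hull S, b x = 0) ∧
    ∀ q : Eucl D → ℝ, IsPolyOn k (hull S) q →
      ∫ x in hull S, q x * b x * Φ x ∂μHE[n] = ∫ x in hull S, q x * v x ∂μHE[n]

/-- The weight of the local moment problem: the product of the barycentric coordinates. -/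
def IsBubbleOn (S : Finset (Eucl D)) (Φ : Eucl D → ℝ) : Prop :=
  ∀ w : Eucl D → ℝ, (∀ a ∈ S, 0 ≤ w a) → ∑ a ∈ S, w a = 1 →
    Φ (∑ a ∈ S, w a • a) = (S.card : ℝ) ^ S.card * ∏ a ∈ S, w a

theorem IsParam.bubble {A : Eucl n →ᵃ[ℝ] Eucl D} {B : Eucl D →ᵃ[ℝ] Eucl n} (h : IsParam S A B)
    {Φ : Eucl D → ℝ} (hΦ : IsBubbleOn S Φ) {y : Eucl n} (hy : y ∈ refSimplex n) :
    Φ (A y) = refBubble n y := by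
  obtain ⟨w, h0, h1, h2, h3⟩ := h.weights y hy
  rw [← h2, hΦ w h0 h1, h3]

theorem integral_refMeasure_congr {f g : Eucl n → ℝ} (h : ∀ y ∈ refSimplex n, f y = g y) :
    ∫ y, f y ∂refMeasure n = ∫ y, g y ∂refMeasure n :=
  setIntegral_congr_fun isClosed_refSimplex.measurableSet h

theorem eLpNorm_refMeasure_congr {G : Type*} [NormedAddCommGroup G] {f g : Eucl n → G}
    (h : ∀ y ∈ refSimplex n, f y = g y) :
    eLpNorm f 2 (refMeasure n) = eLpNorm g 2 (refMeasure n) :=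
  eLpNorm_congr_ae ((ae_restrict_iff' isClosed_refSimplex.measurableSet).2 (.of_forall h))

theorem IsPolyOn.exists_evalFun {k : ℤ} {A : Eucl n →ᵃ[ℝ] Eucl D} {B : Eucl D →ᵃ[ℝ] Eucl n}
    (h : IsParam S A B) {q : Eucl D → ℝ} (hq : IsPolyOn k (hull S) q) :
    ∃ r ∈ polySpace n k, ∀ y ∈ refSimplex n, q (A y) = evalFun n r y :=
  hq.comp_affine A fun _ hy => h.mem_hull hy

theorem isPolyOn_evalFun_comp {k : ℤ} (B : Eucl D →ᵃ[ℝ] Eucl n)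
    {r : MvPolynomial (Fin n) ℝ} (hr : r ∈ polySpace n k) {Q : Set (Eucl D)} :
    IsPolyOn k Q fun x => evalFun n r (B x) :=
  IsPolyOn.comp_affine (S := Set.univ) ⟨r, hr, fun _ _ => rfl⟩ B fun _ _ => Set.mem_univ _

open Classical in
/-- The local moment problem on a simplex is uniquely solvable, and its solution depends
continuously on the data, with constants depending only on the degree. -/
theorem exists_localOp (n : ℕ) (k : ℤ) : ∃ C : ℝ≥0, ∀ (D : ℕ) (S : Finset (Eucl D)),
    S.card = n + 1 → AffineIndependent ℝ (fun a : S => (a : Eucl D)) →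
    ∀ Φ : Eucl D → ℝ, IsBubbleOn S Φ → ∀ v, MemLp v 2 ((μHE[n]).restrict (hull S)) →
      ∃ b, IsLocalOp n k S Φ v b ∧ (∀ b', IsLocalOp n k S Φ v b' → b' = b) ∧
        eLpNorm b 2 ((μHE[n]).restrict (hull S)) ≤ C * eLpNorm v 2 ((μHE[n]).restrict (hull S)) ∧
        ∀ x ∈ hull S, ‖b x‖ₑ * (μHE[n] (hull S)) ^ (1 / 2 : ℝ) ≤
          C * eLpNorm v 2 ((μHE[n]).restrict (hull S)) := by
  obtain ⟨C₁, hC₁⟩ := exists_moments n k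
  obtain ⟨C₂, hC₂⟩ := exists_sup_le n k
  let m : ℝ≥0 := (volume (refSimplex n)).toNNReal
  have hm : (m : ℝ≥0∞) = volume (refSimplex n) :=
    ENNReal.coe_toNNReal isCompact_refSimplex.measure_lt_top.ne
  -- The first summand serves the $L^2$ bound, the second the pointwise one. The measure of the
  -- simplex is $c\,m$, so weighting the pointwise values with its root produces the same $c^{1/2}$
  -- as the norm of $v$.
  refine ⟨C₁ + C₂ * C₁ * m ^ (1 / 2 : ℝ), fun D S hcard hS Φ hΦ v hv => ?_⟩
  obtain ⟨A, B, h⟩ := exists_isParam hcard hS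
  obtain ⟨c, hc0, hct, hν⟩ := h.exists_measure_eq
  obtain ⟨r, hr, hmom, hbd⟩ := hC₁ _ (h.memLp_comp hc0 hct hν hv)
  have hcr : c.toReal ≠ 0 := ENNReal.toReal_ne_zero.2 ⟨hc0, hct⟩
  let b : Eucl D → ℝ := fun x => if x ∈ hull S then evalFun n r (B x) else 0
  have hbA : ∀ y ∈ refSimplex n, b (A y) = evalFun n r y := fun y hy => by
    simp only [b, h.mem_hull hy, if_true, h.left_inv]
  have hnorm : eLpNorm b 2 ((μHE[n]).restrict (hull S)) =
      c ^ (1 / 2 : ℝ) * eLpNorm (evalFun n r) 2 (refMeasure n) := by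
    rw [h.eLpNorm_eq hν, eLpNorm_refMeasure_congr hbA]
  have hvnorm := h.eLpNorm_eq hν v
  refine ⟨b, ⟨?_, fun x hx => if_neg hx, fun q hq => ?_⟩, fun b' hb' => ?_, ?_, fun x hx => ?_⟩
  · exact (isPolyOn_evalFun_comp B hr).congr fun x hx => if_pos hx
  · obtain ⟨s, hs, hsq⟩ := hq.exists_evalFun h
    rw [h.integral_eq hν, h.integral_eq hν]
    congr 1
    rw [integral_refMeasure_congr (g := fun y => evalFun n s y * evalFun n r y * refBubble n y),
      hmom s hs]
    · exact (integral_refMeasure_congr fun y hy => by rw [hsq y hy]).symm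
    · intro y hy
      rw [hsq y hy, hbA y hy, h.bubble hΦ hy]
  · obtain ⟨r', hr', hrb⟩ := hb'.1.exists_evalFun h
    have key : ∀ q ∈ polySpace n k, ∫ y, evalFun n q y * evalFun n r' y * refBubble n y
        ∂refMeasure n = ∫ y, evalFun n q y * v (A y) ∂refMeasure n := by
      intro q hq
      have h1 := hb'.2.2 _ (isPolyOn_evalFun_comp B hq)
      rw [h.integral_eq hν, h.integral_eq hν] at h1
      have h2 := mul_left_cancel₀ hcr h1
      rw [integral_refMeasure_congr (g := fun y => evalFun n q y * evalFun n r' y * refBubble n y)] at h2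
      · rw [h2]
        exact integral_refMeasure_congr fun y _ => by rw [h.left_inv]
      · intro y hy
        rw [hrb y hy, h.left_inv, h.bubble hΦ hy]
    -- The difference of two solutions is itself admissible as a test polynomial.
    have hrr : r' - r = 0 := by
      refine eq_zero_of_moments ?_
      have hsub : r' - r ∈ polySpace n k := sub_mem hr' hr
      have h1 := (key _ hsub).trans (hmom _ hsub).symm
      rw [← sub_eq_zero, ← integral_sub] at h1
      · rw [← h1]
        congr 1
        ext1 y
        simp only [map_sub, Pi.sub_apply]
        ring
      all_goals
        exact integrable_refMeasure (((continuous_evalFun _).mul (continuous_evalFun _)).mul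
          continuous_refBubble)
    ext x
    by_cases hx : x ∈ hull S
    · obtain ⟨y, hy, rfl⟩ := h.exists_eq hx
      rw [hrb y hy, hbA y hy, sub_eq_zero.1 hrr]
    · rw [hb'.2.1 x hx]
      exact (if_neg hx).symm
  · rw [hnorm, hvnorm]
    calc c ^ (1 / 2 : ℝ) * eLpNorm (evalFun n r) 2 (refMeasure n)
        ≤ c ^ (1 / 2 : ℝ) * (C₁ * eLpNorm (fun y => v (A y)) 2 (refMeasure n)) := by gcongr
      _ = C₁ * (c ^ (1 / 2 : ℝ) * eLpNorm (fun y => v (A y)) 2 (refMeasure n)) := by ring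
      _ ≤ _ := by
        gcongr
        exact le_self_add
  · have hμ : μHE[n] (hull S) = c * m := by
      have := congrArg (fun ν : Measure (Eucl D) => ν (hull S)) hν
      simp only [Measure.restrict_apply_self, Measure.smul_apply, smul_eq_mul] at this
      rw [this, h.measurableEmbedding.map_apply, ← h.image, Set.preimage_image_eq _ h.injective,
        Measure.restrict_apply_self, hm]
    obtain ⟨y, hy, rfl⟩ := h.exists_eq hx
    rw [hbA y hy, hμ, hvnorm, ENNReal.mul_rpow_of_nonneg _ _ (by norm_num)]
    calc ‖evalFun n r y‖ₑ * (c ^ (1 / 2 : ℝ) * (m : ℝ≥0∞) ^ (1 / 2 : ℝ))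
        ≤ (C₂ * (C₁ * eLpNorm (fun y => v (A y)) 2 (refMeasure n))) *
          (c ^ (1 / 2 : ℝ) * (m : ℝ≥0∞) ^ (1 / 2 : ℝ)) := by
          gcongr
          exact (hC₂ r hr y hy).trans (by gcongr)
      _ = (C₂ * C₁ * (m : ℝ≥0∞) ^ (1 / 2 : ℝ)) *
          (c ^ (1 / 2 : ℝ) * eLpNorm (fun y => v (A y)) 2 (refMeasure n)) := by ring
      _ ≤ _ := by
        gcongr
        rw [ENNReal.coe_add, ENNReal.coe_mul, ENNReal.coe_mul,
          ENNReal.coe_rpow_of_nonneg _ (by norm_num)]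
        exact le_add_self

end Param

/-! ### Scaling -/

section Scaling

open scoped NNReal ENNReal

variable {d n : ℕ} {T : Finset (Eucl d)}

theorem hasFDerivAt_evalFun (q : MvPolynomial (Fin n) ℝ) (y : Eucl n) :
    HasFDerivAt (evalFun n q)
      (∑ i, evalFun n (MvPolynomial.pderiv i q) y • (EuclideanSpace.proj i : Eucl n →L[ℝ] ℝ)) y := by
  induction q using MvPolynomial.induction_on with
  | C a =>
    have h : evalFun n (MvPolynomial.C a) = fun _ => a := by ext; simp [evalFun_apply]
    rw [h]
    simpa [evalFun_apply] using hasFDerivAt_const a y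
  | add p q hp hq =>
    have h := hp.add hq
    rw [map_add]
    refine h.congr_fderiv ?_
    simp [evalFun_apply, add_smul, Finset.sum_add_distrib]
  | mul_X p j hp =>
    have h := hp.mul (EuclideanSpace.proj j : Eucl n →L[ℝ] ℝ).hasFDerivAt
    have h1 : evalFun n (p * MvPolynomial.X j) = evalFun n p * (EuclideanSpace.proj j : Eucl n →L[ℝ] ℝ) := by
      ext; simp [evalFun_apply]
    rw [h1]
    refine h.congr_fderiv ?_
    have h2 : ∀ i, evalFun n (MvPolynomial.pderiv i (p * MvPolynomial.X j)) y =
        evalFun n (MvPolynomial.pderiv i p) y * y j + if i = j then evalFun n p y else 0 := by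
      intro i
      rw [Derivation.leibniz, MvPolynomial.pderiv_X, Pi.single_apply]
      by_cases hij : i = j
      · subst hij
        simp [evalFun_apply]; ring
      · simp [evalFun_apply, hij, Ne.symm hij]; ring
    simp only [h2, add_smul, Finset.sum_add_distrib, ite_smul, zero_smul, Finset.sum_ite_eq',
      Finset.mem_univ, if_true]
    rw [add_comm, Finset.smul_sum]
    congr 1
    refine Finset.sum_congr rfl fun i _ => ?_
    rw [smul_smul, mul_comm]
    rfl

theorem IsCell.interior_nonempty (hT : IsCell T) : (interior (hull T)).Nonempty := by
  have hne : T.Nonempty := by rw [← Finset.card_pos, hT.1]; omega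
  exact ⟨_, hT.mem_interior fun a ha => by
    rw [hT.barycenter_pos subset_rfl hne ha]
    exact inv_pos.2 (Nat.cast_pos.2 hne.card_pos)⟩

/-- A ball of radius $r>0$ contains two points at distance $r$. This needs $d\ne0$: in dimension
zero every radius would be admissible. -/
theorem bddAbove_inradius [NeZero d] (T : Finset (Eucl d)) :
    BddAbove {r : ℝ | ∃ x, Metric.closedBall x r ⊆ hull T} := by
  refine ⟨size T, ?_⟩
  rintro r ⟨x, hx⟩
  rcases le_or_gt r 0 with hr | hr
  · exact hr.trans Metric.diam_nonneg
  have h1 : dist (x + EuclideanSpace.single (0 : Fin d) r) x = r := by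
    rw [dist_eq_norm]; simp [abs_of_pos hr]
  rw [← h1]
  exact Metric.dist_le_diam_of_mem isCompact_hull.isBounded (hx (Metric.mem_closedBall.2 h1.le))
    (hx (Metric.mem_closedBall_self hr.le))

theorem IsCell.inradius_pos [NeZero d] (hT : IsCell T) : 0 < inradius T := by
  obtain ⟨x, hx⟩ := hT.interior_nonempty
  obtain ⟨r, hr, hx⟩ := Metric.nhds_basis_closedBall.mem_iff.1 (mem_interior_iff_mem_nhds.1 hx)
  exact hr.trans_le (le_csSup (bddAbove_inradius T) ⟨x, hx⟩)

/-- Halving the inradius avoids proving that the supremum is attained, and costs only factors of $2$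
in the constants. -/
theorem IsCell.exists_closedBall [NeZero d] (hT : IsCell T) :
    ∃ x, Metric.closedBall x (inradius T / 2) ⊆ hull T := by
  have h := hT.inradius_pos
  obtain ⟨x, hx⟩ := hT.interior_nonempty
  have hne : {r : ℝ | ∃ x, Metric.closedBall x r ⊆ hull T}.Nonempty :=
    ⟨0, x, by simpa using interior_subset hx⟩
  obtain ⟨r, ⟨y, hy⟩, hr⟩ := exists_lt_of_lt_csSup hne (half_lt_self h)
  exact ⟨y, (Metric.closedBall_subset_closedBall hr.le).trans hy⟩

theorem size_mono {S : Finset (Eucl d)} (h : hull S ⊆ hull T) : size S ≤ size T :=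
  Metric.diam_mono h isCompact_hull.isBounded

theorem size_pos_of_one_lt_card {S : Finset (Eucl d)} (h : 1 < S.card) : 0 < size S := by
  obtain ⟨a, ha, b, hb, hab⟩ := Finset.one_lt_card.1 h
  exact (dist_pos.2 hab).trans_le (Metric.dist_le_diam_of_mem isCompact_hull.isBounded
    (subset_hull ha) (subset_hull hb))

theorem IsCell.size_pos [NeZero d] (hT : IsCell T) : 0 < size T :=
  size_pos_of_one_lt_card (by rw [hT.1]; have := NeZero.ne d; omega)

/-- An affine function with values in `[0, 1]` on a simplex has a bounded slope. -/
theorem IsCell.abs_linear_le [NeZero d] (hT : IsCell T) (φ : Eucl d →ᵃ[ℝ] ℝ)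
    (h : ∀ x ∈ hull T, 0 ≤ φ x ∧ φ x ≤ 1) (v : Eucl d) :
    |φ.linear v| ≤ 2 * (inradius T)⁻¹ * ‖v‖ := by
  obtain ⟨x, hx⟩ := hT.exists_closedBall
  have hρ := hT.inradius_pos
  rcases eq_or_ne v 0 with rfl | hv
  · simp
  have hv' : 0 < ‖v‖ := norm_pos_iff.2 hv
  -- The scaled vector $s v$ has the length of the radius of the inscribed ball, so the step from
  -- its center along $s v$ stays in the simplex and changes $\varphi$ by at most $1$.
  set s : ℝ := inradius T / 2 / ‖v‖ with hs
  have hs0 : 0 < s := by positivity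
  have h1 := h _ (hx (Metric.mem_closedBall_self (by positivity)))
  have h2 := h (s • v + x) (hx (by
    rw [Metric.mem_closedBall, dist_eq_norm, add_sub_cancel_right, norm_smul, Real.norm_of_nonneg
      hs0.le, hs, div_mul_cancel₀ _ hv'.ne']))
  have h3 : φ (s • v + x) = s * φ.linear v + φ x := by
    have := φ.map_vadd x (s • v)
    simpa using this
  rw [h3] at h2
  have h4 : |s * φ.linear v| ≤ 1 := abs_le.2 ⟨by linarith, by linarith⟩
  rw [abs_mul, abs_of_pos hs0] at h4
  have h5 : 2 * (inradius T)⁻¹ * ‖v‖ = 1 / s := by rw [hs]; field_simp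
  rw [h5, le_div_iff₀ hs0, mul_comm]
  exact h4

theorem IsParam.right_inv_of_isCell {A B : Eucl d →ᵃ[ℝ] Eucl d} (h : IsParam T A B) (x : Eucl d) :
    A (B x) = x := by
  have hs : Function.Surjective A := by
    rw [← A.linear_surjective_iff]
    exact LinearMap.injective_iff_surjective.1 h.linear_injective
  obtain ⟨y, rfl⟩ := hs x
  rw [h.left_inv]

/-- The inverse estimate. -/
theorem exists_gradient_le (d : ℕ) [NeZero d] (k : ℤ) : ∃ C : ℝ≥0, ∀ T : Finset (Eucl d), IsCell T →
    ∀ P, IsPolyOn k Set.univ P → eLpNorm (gradient P) 2 (volume.restrict (hull T)) ≤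
      C * ENNReal.ofReal (inradius T)⁻¹ * eLpNorm P 2 (volume.restrict (hull T)) := by
  obtain ⟨C, hC⟩ := exists_pderiv_le d k
  -- The $2$ comes from the slope bound for the inverse parametrization, the $d$ from summing over
  -- the partial derivatives, and $C$ is the reference constant.
  refine ⟨2 * d * C, fun T hT P hP => ?_⟩
  obtain ⟨A, B, h⟩ := exists_isParam hT.1 hT.2
  obtain ⟨c, -, -, hν⟩ := h.exists_measure_eq
  rw [EuclideanSpace.euclideanHausdorffMeasure_eq_volume] at hν
  obtain ⟨r, hr, hrP⟩ := hP.comp_affine (Q := Set.univ) A (by simp)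
  have hPB : P = fun x => evalFun d r (B x) := by
    ext x
    have := hrP (B x) (Set.mem_univ _)
    simp only [h.right_inv_of_isCell] at this
    exact this
  have hρ := hT.inradius_pos
  let φ : Fin d → Eucl d →ᵃ[ℝ] ℝ := fun i =>
    (EuclideanSpace.proj i : Eucl d →L[ℝ] ℝ).toLinearMap.toAffineMap.comp B
  -- The components of $B$ take values in $[0,1]$ on the simplex, which bounds the derivative of the
  -- inverse parametrization by the inverse inradius.
  have hφ : ∀ i v, |B.linear v i| ≤ 2 * (inradius T)⁻¹ * ‖v‖ := fun i v =>
    hT.abs_linear_le (φ i) (fun x hx => ⟨(h.mem_refSimplex hx).1 i,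
      coord_le_one (h.mem_refSimplex hx) i⟩) v
  have hBd : ∀ x, HasFDerivAt B (LinearMap.toContinuousLinearMap B.linear) x := by
    intro x
    have h1 : (B : Eucl d → Eucl d) = fun x => LinearMap.toContinuousLinearMap B.linear x + B 0 := by
      ext1 x
      have := B.map_vadd 0 x
      simpa using this
    rw [h1]
    exact (ContinuousLinearMap.hasFDerivAt _).add_const _
  have hgrad : ∀ x, ‖gradient P x‖ ≤
      2 * (inradius T)⁻¹ * ∑ i, ‖evalFun d (MvPolynomial.pderiv i r) (B x)‖ := by
    intro x
    rw [norm_gradient]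
    have h1 := (hasFDerivAt_evalFun r (B x)).comp x (hBd x)
    rw [hPB, show (fun x => evalFun d r (B x)) = evalFun d r ∘ B from rfl, h1.fderiv]
    refine ContinuousLinearMap.opNorm_le_bound _ (by positivity) fun v => ?_
    simp only [ContinuousLinearMap.coe_comp, Function.comp, sum_apply,
      smul_apply, LinearMap.coe_toContinuousLinearMap',
      EuclideanSpace.coe_proj, smul_eq_mul]
    refine (norm_sum_le _ _).trans ?_
    rw [mul_right_comm, Finset.mul_sum]
    refine Finset.sum_le_sum fun i _ => ?_
    rw [norm_mul, mul_comm]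
    gcongr
    exact hφ i v
  have hcomp : ∀ q : MvPolynomial (Fin d) ℝ,
      eLpNorm (fun x => evalFun d q (B x)) 2 (volume.restrict (hull T)) =
        c ^ (1 / 2 : ℝ) * eLpNorm (evalFun d q) 2 (refMeasure d) := by
    intro q
    rw [h.eLpNorm_eq hν]
    simp only [h.left_inv]
  have hBc : Continuous B := AffineMap.continuous_of_finiteDimensional B
  calc eLpNorm (gradient P) 2 (volume.restrict (hull T))
      ≤ eLpNorm ((2 * (inradius T)⁻¹) •
          ∑ i, fun x => ‖evalFun d (MvPolynomial.pderiv i r) (B x)‖) 2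
          (volume.restrict (hull T)) := by
        refine eLpNorm_mono_real fun x => (hgrad x).trans_eq ?_
        simp
    _ ≤ ENNReal.ofReal (2 * (inradius T)⁻¹) * ∑ i : Fin d,
          (c ^ (1 / 2 : ℝ) * (C * eLpNorm (evalFun d r) 2 (refMeasure d))) := by
        rw [eLpNorm_const_smul, Real.enorm_of_nonneg (by positivity)]
        gcongr
        refine (eLpNorm_sum_le (fun i _ => ?_) (by norm_num)).trans ?_
        · exact ((continuous_evalFun _).comp hBc).norm.aestronglyMeasurable
        · refine Finset.sum_le_sum fun i _ => ?_
          rw [eLpNorm_norm, hcomp]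
          gcongr
          exact hC r hr i
    _ = _ := by
        rw [hPB, hcomp, ENNReal.ofReal_mul (by norm_num)]
        simp
        ring

/-- The measure of a facet is bounded from below in terms of an inscribed ball. -/
theorem IsCell.volume_closedBall_le (hT : IsCell T) {a : Eucl d} (ha : a ∈ T)
    {F : Finset (Eucl d)} (haF : a ∉ F) (hF : insert a F = T) (hFne : F.Nonempty) {x : Eucl d}
    {r : ℝ} (hr : 0 < r) (hx : Metric.closedBall x r ⊆ hull T) :
    volume (Metric.closedBall (0 : Eucl (d - 1)) r) ≤ μHE[d - 1] (hull F) := by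
  set t := bary T a x with ht
  obtain ⟨b, hb⟩ := hFne
  have hbT : b ∈ T := hF ▸ Finset.mem_insert_of_mem hb
  have hab : a ≠ b := fun h => haF (h ▸ hb)
  have hx0 := hx (Metric.mem_closedBall_self hr.le)
  have ht0 : 0 ≤ t := hT.mem_hull_iff.1 hx0 a
  have hmap : ∀ v y, bary T a (v + y) = (bary T a).linear v + bary T a y := fun v y => by
    simpa using (bary T a).map_vadd y v
  have hlab : (bary T a).linear (a - b) = 1 := by
    have := (bary T a).linearMap_vsub a b
    simpa [hT.bary_self ha, hT.bary_ne hbT hab] using this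
  -- From the center of the ball one can still move by $r$ in direction $a-b$, which raises the
  -- $a$-coordinate strictly, and it never exceeds $1$.
  have ht1 : t < 1 := by
    have hn : 0 < ‖a - b‖ := norm_pos_iff.2 (sub_ne_zero.2 hab)
    have h1 : (r / ‖a - b‖) • (a - b) + x ∈ hull T := hx (by
      rw [Metric.mem_closedBall, dist_eq_norm, add_sub_cancel_right, norm_smul,
        Real.norm_of_nonneg (by positivity), div_mul_cancel₀ _ hn.ne'])
    have h2 := hT.bary_le_one h1 a
    rw [hmap, map_smul, hlab] at h2
    have : 0 < r / ‖a - b‖ := by positivity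
    simp only [smul_eq_mul, mul_one] at h2
    linarith
  let s : Submodule ℝ (Eucl d) := LinearMap.ker (bary T a).linear
  have hs : Module.finrank ℝ s = d - 1 := by
    have h1 := (bary T a).linear.finrank_range_add_finrank_ker
    have h2 : LinearMap.range (bary T a).linear = ⊤ := by
      rw [LinearMap.range_eq_top]
      exact LinearMap.surjective fun h => by simp [h] at hlab
    rw [h2, finrank_top, Module.finrank_self, finrank_euclideanSpace_fin] at h1
    have : Module.finrank ℝ s = Module.finrank ℝ (LinearMap.ker (bary T a).linear) := rfl
    omega
  let L : s ≃ₗᵢ[ℝ] Eucl (d - 1) := ((stdOrthonormalBasis ℝ s).reindex (finCongr hs)).repr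
  -- The slice of the ball at height $t$ parallel to the facet is projected from the apex $a$ onto
  -- the facet. This dilates it by $(1-t)^{-1}\ge1$, so the facet contains an isometric copy of a
  -- $(d-1)$-ball of radius $r$ centered at the projection of $x$.
  let ι : Eucl (d - 1) → Eucl d := fun u => (1 - t)⁻¹ • (x - t • a) + (L.symm u : Eucl d)
  have hι : Isometry ι := Isometry.of_dist_eq fun u w => by
    simp only [ι, dist_add_left]
    exact L.symm.dist_map u w
  have hsub : Metric.closedBall (0 : Eucl (d - 1)) r ⊆ ι ⁻¹' hull F := by
    intro u hu
    have h1t : 0 < 1 - t := by linarith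
    let v : Eucl d := (1 - t) • (L.symm u : Eucl d)
    have hv : ‖v‖ ≤ r := by
      have h1 : ‖(L.symm u : Eucl d)‖ = ‖u‖ := L.symm.norm_map u
      rw [norm_smul, h1, Real.norm_of_nonneg h1t.le]
      have h2 : ‖u‖ ≤ r := by simpa using hu
      have := mul_le_mul (show 1 - t ≤ 1 by linarith) h2 (norm_nonneg _) zero_le_one
      simpa using this
    have hy : v + x ∈ hull T := hx (by simpa [dist_eq_norm] using hv)
    have hbt : bary T a (v + x) = t := by
      have : (bary T a).linear (L.symm u : Eucl d) = 0 := (L.symm u).2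
      rw [hmap, map_smul, this]; simp [ht]
    have hsum := hT.sum_bary (v + x)
    have hsm := hT.sum_bary_smul (v + x)
    rw [← hF, Finset.sum_insert haF, hF, hbt] at hsum hsm
    refine mem_hull.2 ⟨fun c => (1 - t)⁻¹ * bary T c (v + x), fun c _ => ?_, ?_, ?_⟩
    · have := hT.mem_hull_iff.1 hy c
      positivity
    · rw [← Finset.mul_sum, eq_sub_of_add_eq' hsum, inv_mul_cancel₀ h1t.ne']
    · simp only [mul_smul]
      rw [← Finset.smul_sum, eq_sub_of_add_eq' hsm, add_sub_assoc, smul_add, add_comm,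
        smul_smul, inv_mul_cancel₀ h1t.ne', one_smul]
  have hmap' := hι.map_euclideanHausdorffMeasure (d := d - 1)
  rw [EuclideanSpace.euclideanHausdorffMeasure_eq_volume] at hmap'
  calc volume (Metric.closedBall (0 : Eucl (d - 1)) r) ≤ volume (ι ⁻¹' hull F) := measure_mono hsub
    _ = volume.map ι (hull F) := by
        rw [Measure.map_apply hι.continuous.measurable isClosed_hull.measurableSet]
    _ ≤ μHE[d - 1] (hull F) := by
        rw [hmap']
        exact Measure.restrict_apply_le _ _

/-- The measure of a cell is bounded in terms of its diameter and the measure of a facet. -/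
theorem exists_volume_le (d : ℕ) (hd : d = 2 ∨ d = 3) : ∃ C : ℝ≥0, ∀ T : Finset (Eucl d), IsCell T →
    ∀ G : ℝ, 1 ≤ G → size T ≤ G * inradius T → ∀ F ⊆ T, F.card = d →
      volume (hull T) ^ (1 / 2 : ℝ) ≤ C * ENNReal.ofReal (size T ^ (1 / 2 : ℝ)) *
        ENNReal.ofReal G * μHE[d - 1] (hull F) ^ (1 / 2 : ℝ) := by
  have : NeZero d := ⟨by omega⟩
  let α := (volume (Metric.closedBall (0 : Eucl d) 1)).toReal
  let β := (volume (Metric.closedBall (0 : Eucl (d - 1)) 1)).toReal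
  have hβ : 0 < β := ENNReal.toReal_pos (Metric.measure_closedBall_pos _ _ one_pos).ne'
    measure_closedBall_lt_top.ne
  have hα : 0 < α := ENNReal.toReal_pos (Metric.measure_closedBall_pos _ _ one_pos).ne'
    measure_closedBall_lt_top.ne
  -- The cell lies in a ball of radius $h_T$, with volume $\alpha h_T^d$, and the facet has measure
  -- at least $\beta(r_T/2)^{d-1}$. The constant is the square root of the resulting quotient.
  refine ⟨((α / β * 2 ^ (d - 1)) ^ (1 / 2 : ℝ)).toNNReal, fun T hT G hG hTG F hFT hF => ?_⟩
  have hρ := hT.inradius_pos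
  have hh := hT.size_pos
  obtain ⟨x, hx⟩ := hT.exists_closedBall
  obtain ⟨a, haF, hins⟩ : ∃ a ∉ F, insert a F = T := by
    classical
    obtain ⟨a, ha⟩ := Finset.card_eq_one.1 (show (T \ F).card = 1 by
      rw [Finset.card_sdiff_of_subset hFT, hT.1, hF]; omega)
    have h1 : a ∈ T \ F := by simp [ha]
    refine ⟨a, (Finset.mem_sdiff.1 h1).2, ?_⟩
    rw [Finset.insert_eq, ← ha, Finset.sdiff_union_of_subset hFT]
  have haT : a ∈ T := hins ▸ Finset.mem_insert_self a F
  have h1 := hT.volume_closedBall_le haT haF hins (Finset.card_pos.1 (by omega))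
    (by positivity) hx
  have h2 : volume (hull T) ≤ volume (Metric.closedBall x (size T)) := by
    refine measure_mono fun y hy => ?_
    exact Metric.dist_le_diam_of_mem isCompact_hull.isBounded hy
      (hx (Metric.mem_closedBall_self (by positivity)))
  rw [Measure.addHaar_closedBall' _ _ hh.le, finrank_euclideanSpace_fin,
    ← ENNReal.ofReal_toReal (a := volume (Metric.closedBall (0 : Eucl d) 1))
      measure_closedBall_lt_top.ne, ← ENNReal.ofReal_mul (by positivity)] at h2
  rw [Measure.addHaar_closedBall' _ _ (by positivity), finrank_euclideanSpace_fin,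
    ← ENNReal.ofReal_toReal (a := volume (Metric.closedBall (0 : Eucl (d - 1)) 1))
      measure_closedBall_lt_top.ne, ← ENNReal.ofReal_mul (by positivity)] at h1
  change volume (hull T) ≤ ENNReal.ofReal (size T ^ d * α) at h2
  change ENNReal.ofReal ((inradius T / 2) ^ (d - 1) * β) ≤ _ at h1
  have hle : size T ^ d * α ≤ α / β * 2 ^ (d - 1) * size T * G ^ 2 *
      ((inradius T / 2) ^ (d - 1) * β) := by
    -- Since $d-1\le2$ and $G\ge1$, the power $G^{d-1}$ is at most $G^2$; the square root then
    -- leaves a single factor $G$.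
    have h3 : size T ^ (d - 1) ≤ G ^ 2 * inradius T ^ (d - 1) := by
      calc size T ^ (d - 1) ≤ (G * inradius T) ^ (d - 1) := by gcongr
        _ = G ^ (d - 1) * inradius T ^ (d - 1) := mul_pow _ _ _
        _ ≤ G ^ 2 * inradius T ^ (d - 1) := by
          gcongr
          omega
    have h4 : size T ^ d = size T * size T ^ (d - 1) := by
      rw [← pow_succ', Nat.sub_add_cancel (by omega)]
    have h5 : α / β * 2 ^ (d - 1) * size T * G ^ 2 * ((inradius T / 2) ^ (d - 1) * β) =
        α * size T * (G ^ 2 * inradius T ^ (d - 1)) := by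
      rw [div_pow]; field_simp
    rw [h5, h4]
    calc size T * size T ^ (d - 1) * α = α * size T * size T ^ (d - 1) := by ring
      _ ≤ _ := by gcongr
  calc volume (hull T) ^ (1 / 2 : ℝ)
      ≤ (ENNReal.ofReal (α / β * 2 ^ (d - 1) * size T * G ^ 2) *
          μHE[d - 1] (hull F)) ^ (1 / 2 : ℝ) := by
        gcongr
        refine h2.trans ((ENNReal.ofReal_le_ofReal hle).trans ?_)
        rw [ENNReal.ofReal_mul (by positivity)]
        gcongr
    _ = _ := by
        have h6 : (α / β * 2 ^ (d - 1) * size T * G ^ 2) ^ (1 / 2 : ℝ) =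
            (α / β * 2 ^ (d - 1)) ^ (1 / 2 : ℝ) * size T ^ (1 / 2 : ℝ) * G := by
          rw [Real.mul_rpow (by positivity) (by positivity),
            Real.mul_rpow (by positivity) (by positivity), ← Real.sqrt_eq_rpow (G ^ 2),
            Real.sqrt_sq (by linarith)]
        rw [ENNReal.mul_rpow_of_nonneg _ _ (by norm_num), ENNReal.ofReal_rpow_of_nonneg
          (by positivity) (by norm_num), h6, ENNReal.ofReal_mul (by positivity),
          ENNReal.ofReal_mul (by positivity)]
        rfl

end Scaling

/-! ### Piecewise polynomials: Lipschitz continuity, Sobolev membership, well-posedness -/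

section WellPosed

open scoped NNReal ENNReal

variable {d : ℕ} {Ω : Set (Eucl d)}

theorem IsPolyOn.exists_lipschitz {k : ℤ} {T : Finset (Eucl d)} {f : Eucl d → ℝ}
    (hf : IsPolyOn k (hull T) f) :
    ∃ C : ℝ≥0, ∀ x ∈ hull T, ∀ y ∈ hull T, |f y - f x| ≤ C * ‖y - x‖ := by
  obtain ⟨P, hP, -, hfP⟩ := hf.exists_contDiff
  obtain ⟨B, hB⟩ := isCompact_hull.exists_bound_of_continuousOn (s := hull T) (f := fderiv ℝ P)
    (hP.continuous_fderiv (by simp)).continuousOn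
  refine ⟨B.toNNReal, fun x hx y hy => ?_⟩
  rw [hfP x hx, hfP y hy, ← Real.norm_eq_abs]
  refine convex_hull.norm_image_sub_le_of_norm_fderiv_le (𝕜 := ℝ) (s := hull T)
    (fun z _ => (hP.differentiable (by simp)).differentiableAt)
    (fun z hz => (hB z hz).trans (Real.le_coe_toNNReal B)) hx hy

namespace SimplicialMesh

/-- `f` is a polynomial on each cell. -/
def IsPiecewisePoly (M : SimplicialMesh Ω) (f : Eucl d → ℝ) : Prop :=
  ∀ T ∈ M.cells, ∃ k : ℤ, IsPolyOn k (hull T) f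

variable {M : SimplicialMesh Ω} {T F : Finset (Eucl d)} {f : Eucl d → ℝ}

theorem IsPiecewisePoly.exists_lipschitz (hf : M.IsPiecewisePoly f) :
    ∃ C : ℝ≥0, ∀ T ∈ M.cells, ∀ x ∈ hull T, ∀ y ∈ hull T, |f y - f x| ≤ C * ‖y - x‖ := by
  have h : ∀ T : M.cells, ∃ C : ℝ≥0, ∀ x ∈ hull T.1, ∀ y ∈ hull T.1,
      |f y - f x| ≤ C * ‖y - x‖ := fun T => by
    obtain ⟨k, hk⟩ := hf T.1 T.2
    exact hk.exists_lipschitz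
  choose C hC using h
  refine ⟨∑ T, C T, fun T hT x hx y hy => (hC ⟨T, hT⟩ x hx y hy).trans ?_⟩
  gcongr
  exact Finset.single_le_sum (f := C) (fun _ _ => zero_le) (Finset.mem_univ _)

/-- The finitely many closed cells that miss $x$ keep a distance from it. Hence a nearby mesh point
$y$ shares a cell with $x$, and the two values can be compared within that cell. -/
theorem eventually_mem_hull (M : SimplicialMesh Ω) (x : Eucl d) :
    ∀ᶠ y in 𝓝 x, ∀ T ∈ M.cells, y ∈ hull T → x ∈ hull T := by
  rw [Filter.eventually_all_finset]
  intro T _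
  by_cases hx : x ∈ hull T
  · exact .of_forall fun _ _ => hx
  · filter_upwards [isClosed_hull.isOpen_compl.mem_nhds hx] with y hy h
    exact absurd h hy

/-- Being a single function that is polynomial on closed cells, $f$ has matching values on common
faces. Nearby mesh points share a cell, and a point outside the mesh is compared with a point off
$\Omega$, where $f$ is also zero. The local bounds then give a global one, since they hold along all
segments of the whole space. -/
theorem IsPiecewisePoly.lipschitzWith (hΩ : IsOpen Ω) (hf : M.IsPiecewisePoly f)
    (h0 : ∀ x ∉ Ω, f x = 0) : ∃ C, LipschitzWith C f := by
  obtain ⟨C, hC⟩ := hf.exists_lipschitz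
  refine ⟨C, lipschitzWith_of_eventually fun x => ?_⟩
  have key : ∀ y ∈ closure Ω, (∀ T ∈ M.cells, y ∈ hull T → x ∈ hull T) →
      |f y - f x| ≤ C * ‖y - x‖ := by
    intro y hy h
    obtain ⟨T, hT, hyT⟩ := mem_closure_iff.1 hy
    exact hC T hT x (h T hT hyT) y hyT
  by_cases hx : x ∈ Ω
  · filter_upwards [M.eventually_mem_hull x, hΩ.mem_nhds hx] with y h hy
    exact key y (subset_closure hy) h
  · filter_upwards [M.eventually_mem_hull x] with y h
    by_cases hy : y ∈ closure Ω
    · exact key y hy h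
    · rw [h0 x hx, h0 y fun h => hy (subset_closure h)]
      simp only [sub_self, abs_zero]
      positivity

/-- Only neighbourhoods inside $\Omega$ are inspected, so a jump to zero across the boundary is
harmless. This is needed for Lagrange functions of boundary nodes. -/
theorem IsPiecewisePoly.memH1 (hΩ : IsOpen Ω) (hb : Bornology.IsBounded Ω)
    (hf : M.IsPiecewisePoly f) : MemH1 Ω f := by
  obtain ⟨C, hC⟩ := hf.exists_lipschitz
  have h : ∀ T : M.cells, ∃ B : ℝ, ∀ x ∈ hull T.1, ‖f x‖ ≤ B := fun T => by
    obtain ⟨k, hk⟩ := hf T.1 T.2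
    exact isCompact_hull.exists_bound_of_continuousOn hk.continuousOn
  choose B hB using h
  refine ⟨_, hasWeakGradient_of_local hΩ hb (C := C) (B := ∑ T, |B T|) (fun x hx => ?_)
    fun x hx => ?_⟩
  · obtain ⟨T, hT, hxT⟩ := mem_closure_iff.1 (subset_closure hx)
    refine (hB ⟨T, hT⟩ x hxT).trans ((le_abs_self _).trans ?_)
    exact Finset.single_le_sum (f := fun T => |B T|) (fun _ _ => abs_nonneg _) (Finset.mem_univ _)
  · filter_upwards [M.eventually_mem_hull x, hΩ.mem_nhds hx] with y h hy
    obtain ⟨T, hT, hyT⟩ := mem_closure_iff.1 (subset_closure hy)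
    exact hC T hT x (h T hT hyT) y hyT

/-! ### The bubbles -/

/-- Uniqueness is checked at the nodes of degree $d+1$, whose $d+1$ weights have sum $d+1$. Either
some weight is zero and the node lies on the boundary of the cell, where $\Phi$ vanishes by
continuity; or all weights are $1$ and the node is the barycenter. -/
theorem isElementBubble_iff (hΩ : IsOpen Ω) (hb : Bornology.IsBounded Ω)
    (hi : interior (closure Ω) = Ω) (hT : T ∈ M.cells) {Φ : Eucl d → ℝ} :
    M.IsElementBubble T Φ ↔ Φ = M.bubble T := by
  have hcard := M.card_eq T hT
  constructor
  · rintro ⟨hc, -, h0, hp, h1⟩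
    have hbd := (isPolyOn_bubble (M := M) hT T)
    rw [hcard] at hbd
    have hz := (isCell hT).eq_zero_of_nodes (p := d + 1) (by omega)
      (f := fun x => Φ x - M.bubble T x) (IsPolyOn.sub (by exact_mod_cast hp) hbd) ?_
    · ext x
      by_cases hx : x ∈ hull T
      · exact sub_eq_zero.1 (hz x hx)
      · rw [h0 x hx, cellBubble_eq_zero hT hx]
    · intro z hz
      obtain ⟨α, hα, rfl⟩ := mem_simplexNodes.1 hz
      have hw : ∑ a ∈ T, (α a : ℝ) / ((d + 1 : ℕ) : ℝ) = 1 := by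
        rw [← Finset.sum_div, ← Nat.cast_sum, hα.1, div_self (by positivity)]
      by_cases hex : ∃ a ∈ T, α a = 0
      · obtain ⟨a, ha, ha0⟩ := hex
        set z := ∑ a ∈ T, ((α a : ℝ) / ((d + 1 : ℕ) : ℝ)) • a with hzdef
        have hbary : bary T a z = 0 := by
          rw [hzdef, (isCell hT).bary_comb subset_rfl hw ha, ha0]; simp
        have hzT := mem_hull_of_mem_simplexNodes (by omega) hz
        have hΦ : Φ z = 0 := by
          by_contra hne
          have h2 := hc.continuousAt.eventually_ne hne
          obtain ⟨y, hy, hy'⟩ := (((isCell hT).frequently_notMem ha hbary).and_eventually h2).exists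
          exact hy' (h0 y hy)
        rw [hΦ, bubble_eq_zero ha ((hat_eq hT hzT a).trans hbary), sub_zero]
      · push Not at hex
        have hα1 : ∀ a ∈ T, α a = 1 := by
          have h2 : ∑ a ∈ T, 1 = ∑ a ∈ T, α a := by simp [hα.1, hcard]
          intro a ha
          exact ((Finset.sum_eq_sum_iff_of_le fun a ha =>
            Nat.one_le_iff_ne_zero.2 (hex a ha)).1 h2 a ha).symm
        have hzb : ∑ a ∈ T, ((α a : ℝ) / ((d + 1 : ℕ) : ℝ)) • a = barycenter T := by
          rw [barycenter, Finset.smul_sum, hcard]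
          refine Finset.sum_congr rfl fun a ha => ?_
          rw [hα1 a ha, Nat.cast_one, one_div]
        rw [hzb, h1, bubble_barycenter hT subset_rfl (cell_nonempty hT), sub_self]
  · rintro rfl
    have hpw : M.IsPiecewisePoly (M.bubble T) := fun T' hT' => ⟨_, isPolyOn_bubble hT' T⟩
    have hz : ∀ x ∉ Ω, M.bubble T x = 0 := fun x hx => cellBubble_eq_zero_of_notMem hi hT hx
    obtain ⟨C, hC⟩ := hpw.lipschitzWith hΩ hz
    refine ⟨hC.continuous, memH10_of_lipschitz hΩ hb hC hz, fun x hx => cellBubble_eq_zero hT hx,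
      ?_, bubble_barycenter hT subset_rfl (cell_nonempty hT)⟩
    have := isPolyOn_bubble (M := M) hT T
    rw [hcard] at this
    exact_mod_cast this

/-- A continuous function that vanishes off two adjacent cells vanishes at the points of one of
them lying on a facet different from the common one. -/
theorem eq_zero_of_bary_eq_zero (hd : 0 < d) {T₁ T₂ : Finset (Eucl d)} (h₁ : T₁ ∈ M.cells)
    (h₂ : T₂ ∈ M.cells) (hne : T₁ ≠ T₂) (hF₁ : F ⊆ T₁) (hF₂ : F ⊆ T₂) (hc : F.card = d)
    (hf : Continuous f) (h0 : ∀ x ∉ hull T₁ ∪ hull T₂, f x = 0) {a : Eucl d} (ha : a ∈ F)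
    {z : Eucl d} (hz : z ∈ hull T₁) (haz : bary T₁ a z = 0) : f z = 0 := by
  obtain ⟨a₁, ha₁, ha₁F, -⟩ := facet_eq_insert (M.card_eq _ h₁) hF₁ hc
  obtain ⟨a₂, ha₂, ha₂F, -⟩ := facet_eq_insert (M.card_eq _ h₂) hF₂ hc
  obtain ⟨hneg, hopp⟩ := opposite hd h₁ h₂ hne hF₁ hF₂ hc ha₁ ha₁F ha₂ ha₂F
  -- Strictly on the side of $T_1$ there are no points of $T_2$, so points leaving $T_1$ near $y$
  -- lie off both cells.
  have key : ∀ y, 0 < bary T₁ a₁ y → bary T₁ a y = 0 → f y = 0 := by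
    intro y hy hay
    by_contra hfy
    have e1 := hf.continuousAt.eventually_ne hfy
    have e2 : ∀ᶠ x in 𝓝 y, 0 < bary T₁ a₁ x :=
      (continuous_bary T₁ a₁).continuousAt.eventually (lt_mem_nhds hy)
    obtain ⟨x, hx, hfx, hpos⟩ :=
      (((isCell h₁).frequently_notMem (hF₁ ha) hay).and_eventually (e1.and e2)).exists
    refine hfx (h0 x ?_)
    rintro (h | h)
    · exact hx h
    · have h3 := (isCell h₂).mem_hull_iff.1 h a₂
      rw [hopp x] at hpos
      exact absurd hpos (not_lt.2 (mul_nonpos_of_nonpos_of_nonneg hneg.le h3))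
  -- A point whose apex coordinate may be zero is approached along the segment to the apex $a_1$,
  -- where that coordinate is positive and the $a$-coordinate stays zero.
  have hlim : Tendsto (fun t : ℝ => f (AffineMap.lineMap z a₁ t)) (𝓝[>] (0 : ℝ)) (𝓝 (f z)) := by
    have hcont : Continuous fun t : ℝ => f (AffineMap.lineMap z a₁ t) :=
      hf.comp AffineMap.lineMap_continuous
    have := (hcont.tendsto 0).mono_left (nhdsWithin_le_nhds (s := Set.Ioi 0))
    simpa using this
  refine tendsto_nhds_unique hlim (tendsto_const_nhds.congr' ?_)
  filter_upwards [Ioo_mem_nhdsGT (zero_lt_one' ℝ)] with t ht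
  refine (key _ ?_ ?_).symm
  · have := (isCell h₁).mem_hull_iff.1 hz a₁
    rw [AffineMap.apply_lineMap, (isCell h₁).bary_self ha₁, AffineMap.lineMap_apply]
    have h4 : 0 ≤ (1 - t) * bary T₁ a₁ z := mul_nonneg (by linarith [ht.2]) this
    simp only [vsub_eq_sub, smul_eq_mul, vadd_eq_add]
    linarith [ht.1]
  · have haa : a ≠ a₁ := fun h => ha₁F (h ▸ ha)
    rw [AffineMap.apply_lineMap, (isCell h₁).bary_ne ha₁ haa, haz]
    simp

/-- On each of the two cells the nodes of degree $d$ decide. If a vertex of $F$ has weight zero, the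
node lies on another facet and both functions vanish there. Otherwise the $d$ vertices of $F$ use up
the total weight $d$, and the node is the barycenter of $F$. -/
theorem isFaceBubble_iff (hΩ : IsOpen Ω) (hb : Bornology.IsBounded Ω)
    (hi : interior (closure Ω) = Ω) (hd : 0 < d) (hF : F ∈ M.interfaces) {Φ : Eucl d → ℝ} :
    M.IsFaceBubble F Φ ↔ Φ = M.bubble F := by
  classical
  have hFne : F.Nonempty := by
    rw [← Finset.card_pos, (exists_of_mem_interfaces hF).1]; exact hd
  constructor
  · rintro ⟨hc, -, ⟨T₁, h₁, T₂, h₂, hint, h0, hp₁, hp₂⟩, h1⟩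
    obtain ⟨hF₁, hF₂, hne⟩ := interface_subset (Finset.mem_filter.1 hF).1 h₁ h₂ hint
    have hcard := (exists_of_mem_interfaces hF).1
    have key : ∀ T₁ ∈ M.cells, ∀ T₂ ∈ M.cells, T₁ ≠ T₂ → F ⊆ T₁ → F ⊆ T₂ →
        (∀ x ∉ hull T₁ ∪ hull T₂, Φ x = 0) → IsPolyOn (d : ℤ) (hull T₁) Φ →
        ∀ x ∈ hull T₁, Φ x = M.bubble F x := by
      intro T₁ h₁ T₂ h₂ hne hF₁ hF₂ h0 hp
      obtain ⟨a₁, ha₁, ha₁F, hu⟩ := facet_eq_insert (M.card_eq _ h₁) hF₁ hcard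
      have hbd := isPolyOn_bubble (M := M) h₁ F
      rw [hcard] at hbd
      have hz := (isCell h₁).eq_zero_of_nodes (p := d) hd
        (f := fun x => Φ x - M.bubble F x) (hp.sub hbd) ?_
      · exact fun x hx => sub_eq_zero.1 (hz x hx)
      intro z hz
      have hzT := mem_hull_of_mem_simplexNodes hd hz
      obtain ⟨α, hα, rfl⟩ := mem_simplexNodes.1 hz
      have hdr : (d : ℝ) ≠ 0 := by positivity
      have hw : ∑ a ∈ T₁, (α a : ℝ) / (d : ℝ) = 1 := by
        rw [← Finset.sum_div, ← Nat.cast_sum, hα.1, div_self hdr]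
      by_cases hex : ∃ a ∈ F, α a = 0
      · obtain ⟨a, ha, ha0⟩ := hex
        set z := ∑ a ∈ T₁, ((α a : ℝ) / (d : ℝ)) • a with hzdef
        have hbary : bary T₁ a z = 0 := by
          rw [hzdef, (isCell h₁).bary_comb subset_rfl hw (hF₁ ha), ha0]; simp
        rw [eq_zero_of_bary_eq_zero hd h₁ h₂ hne hF₁ hF₂ hcard hc h0 ha hzT hbary,
          bubble_eq_zero ha ((hat_eq h₁ hzT a).trans hbary), sub_zero]
      · push Not at hex
        have hins : T₁ = insert a₁ F := by
          ext b
          rw [Finset.mem_insert]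
          constructor
          · intro hbT
            by_cases hbF : b ∈ F
            · exact .inr hbF
            · exact .inl (hu b hbT hbF)
          · rintro (rfl | hbF)
            · exact ha₁
            · exact hF₁ hbF
        have hsum : α a₁ + ∑ a ∈ F, α a = d := by
          rw [← Finset.sum_insert ha₁F, ← hins, hα.1]
        have hle : ∑ a ∈ F, 1 ≤ ∑ a ∈ F, α a := Finset.sum_le_sum fun a ha =>
            Nat.one_le_iff_ne_zero.2 (hex a ha)
        have hF1 : ∑ a ∈ F, 1 = d := by simp [hcard]
        have hα1 : ∀ a ∈ F, α a = 1 := fun a ha =>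
          ((Finset.sum_eq_sum_iff_of_le fun a ha =>
            Nat.one_le_iff_ne_zero.2 (hex a ha)).1 (by omega : ∑ a ∈ F, 1 = ∑ a ∈ F, α a) a ha).symm
        have hα0 : α a₁ = 0 := by omega
        have hzb : ∑ a ∈ T₁, ((α a : ℝ) / (d : ℝ)) • a = barycenter F := by
          rw [hins, Finset.sum_insert ha₁F, hα0, barycenter, Finset.smul_sum, hcard]
          simp only [Nat.cast_zero, zero_div, zero_smul, zero_add]
          refine Finset.sum_congr rfl fun a ha => ?_
          rw [hα1 a ha, Nat.cast_one, one_div]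
        rw [hzb, h1, bubble_barycenter h₁ hF₁ hFne, sub_self]
    ext x
    by_cases hx₁ : x ∈ hull T₁
    · exact key T₁ h₁ T₂ h₂ hne hF₁ hF₂ h0 hp₁ x hx₁
    by_cases hx₂ : x ∈ hull T₂
    · exact key T₂ h₂ T₁ h₁ hne.symm hF₂ hF₁ (by rwa [Set.union_comm]) hp₂ x hx₂
    have hx : x ∉ hull T₁ ∪ hull T₂ := by simp [hx₁, hx₂]
    rw [h0 x hx, faceBubble_eq_zero hd h₁ h₂ hne hF₁ hF₂ hcard hx]
  · rintro rfl
    obtain ⟨hcard, T₁, h₁, T₂, h₂, hint, hF₁, hF₂, hne⟩ := exists_of_mem_interfaces hF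
    have hpw : M.IsPiecewisePoly (M.bubble F) := fun T' hT' => ⟨_, isPolyOn_bubble hT' F⟩
    have hz : ∀ x ∉ Ω, M.bubble F x = 0 := fun x hx => faceBubble_eq_zero_of_notMem hi hd hF hx
    obtain ⟨C, hC⟩ := hpw.lipschitzWith hΩ hz
    refine ⟨hC.continuous, memH10_of_lipschitz hΩ hb hC hz, ⟨T₁, h₁, T₂, h₂, hint,
      fun x hx => faceBubble_eq_zero hd h₁ h₂ hne hF₁ hF₂ hcard hx, ?_, ?_⟩,
      bubble_barycenter h₁ hF₁ hFne⟩
    · simpa [hcard] using isPolyOn_bubble (M := M) h₁ F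
    · simpa [hcard] using isPolyOn_bubble (M := M) h₂ F

/-- Uniqueness is unisolvence on each cell; existence is the explicit product `nodeFun`. As for the
bubbles, this identifies an object chosen by its properties with a formula. -/
theorem isLagrangeBasis_iff (hΩ : IsOpen Ω) (hb : Bornology.IsBounded Ω) {p : ℕ} (hp : 1 ≤ p)
    (hT : T ∈ M.cells) {α : Eucl d → ℕ} (hα : ∑ a ∈ T, α a = p ∧ ∀ a, α a ≠ 0 → a ∈ T)
    {Φ : Eucl d → ℝ} :
    M.IsLagrangeBasis p (∑ a ∈ T, ((α a : ℝ) / p) • a) Φ ↔ Φ = M.nodeFun p T α := by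
  classical
  have hnode : ∀ z' ∈ M.nodes p, M.nodeFun p T α z' =
      if z' = ∑ a ∈ T, ((α a : ℝ) / p) • a then 1 else 0 := by
    intro z' hz'
    split_ifs with h
    · exact (nodeFun_node hp hT hα hz').1 h
    · exact (nodeFun_node hp hT hα hz').2 h
  constructor
  · rintro ⟨-, h0, hpoly, hδ⟩
    ext x
    by_cases hx : x ∈ closure Ω
    · obtain ⟨T', hT', hxT'⟩ := mem_closure_iff.1 hx
      refine sub_eq_zero.1 ((isCell hT').eq_zero_of_nodes hp (f := fun x => Φ x - M.nodeFun p T α x)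
        ((hpoly T' hT').sub (isPolyOn_nodeFun hα.1 hT')) (fun z hz => ?_) x hxT')
      have hz' : z ∈ M.nodes p := mem_nodes.2 ⟨T', hT', hz⟩
      rw [hnode z hz', hδ z hz']
      exact sub_self _
    · rw [h0 x hx, nodeFun_of_notMem hp hα.1 hx]
  · rintro rfl
    have hpw : M.IsPiecewisePoly (M.nodeFun p T α) := fun T' hT' => ⟨_, isPolyOn_nodeFun hα.1 hT'⟩
    exact ⟨hpw.memH1 hΩ hb, fun x hx => nodeFun_of_notMem hp hα.1 hx,
      fun T' hT' => isPolyOn_nodeFun hα.1 hT', hnode⟩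

theorem elementBubble_eq (hΩ : IsOpen Ω) (hb : Bornology.IsBounded Ω)
    (hi : interior (closure Ω) = Ω) (hT : T ∈ M.cells) : M.elementBubble T = M.bubble T :=
  (isElementBubble_iff hΩ hb hi hT).1
    (Classical.epsilon_spec ⟨_, (isElementBubble_iff hΩ hb hi hT).2 rfl⟩)

theorem faceBubble_eq (hΩ : IsOpen Ω) (hb : Bornology.IsBounded Ω)
    (hi : interior (closure Ω) = Ω) (hd : 0 < d) (hF : F ∈ M.interfaces) :
    M.faceBubble F = M.bubble F :=
  (isFaceBubble_iff hΩ hb hi hd hF).1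
    (Classical.epsilon_spec ⟨_, (isFaceBubble_iff hΩ hb hi hd hF).2 rfl⟩)

theorem existsUnique_lagrangeBasis (hΩ : IsOpen Ω) (hb : Bornology.IsBounded Ω) {p : ℕ}
    (hp : 1 ≤ p) {z : Eucl d} (hz : z ∈ M.nodes p) : ∃! Φ, M.IsLagrangeBasis p z Φ := by
  obtain ⟨T, hT, hzT⟩ := mem_nodes.1 hz
  obtain ⟨α, hα, rfl⟩ := mem_simplexNodes.1 hzT
  exact ⟨_, (isLagrangeBasis_iff hΩ hb hp hT hα).2 rfl,
    fun Φ hΦ => (isLagrangeBasis_iff hΩ hb hp hT hα).1 hΦ⟩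

theorem isLagrangeBasis_lagrangeBasis (hΩ : IsOpen Ω) (hb : Bornology.IsBounded Ω) {p : ℕ}
    (hp : 1 ≤ p) {z : Eucl d} (hz : z ∈ M.nodes p) :
    M.IsLagrangeBasis p z (M.lagrangeBasis p z) :=
  Classical.epsilon_spec (existsUnique_lagrangeBasis hΩ hb hp hz).exists

theorem abs_lagrangeBasis_le (hΩ : IsOpen Ω) (hb : Bornology.IsBounded Ω) {p : ℕ}
    (hp : 1 ≤ p) {z : Eucl d} (hz : z ∈ M.nodes p) (x : Eucl d) :
    |M.lagrangeBasis p z x| ≤ (p : ℝ) ^ p := by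
  have h := isLagrangeBasis_lagrangeBasis hΩ hb hp hz
  obtain ⟨T, hT, hzT⟩ := mem_nodes.1 hz
  obtain ⟨α, hα, hzα⟩ := mem_simplexNodes.1 hzT
  have h2 : M.lagrangeBasis p z = M.nodeFun p T α := by
    refine (isLagrangeBasis_iff hΩ hb hp hT hα).1 ?_
    rwa [hzα]
  rw [h2]
  exact abs_nodeFun_le hα.1 x

/-! ### The local operators -/

theorem isCellOp_iff (hΩ : IsOpen Ω) (hb : Bornology.IsBounded Ω)
    (hi : interior (closure Ω) = Ω) (hT : T ∈ M.cells) {p : ℕ} {v b : Eucl d → ℝ} :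
    M.IsCellOp p T v b ↔ IsLocalOp d ((p : ℤ) - 1) T (M.bubble T) v b := by
  rw [IsCellOp, IsLocalOp, elementBubble_eq hΩ hb hi hT,
    EuclideanSpace.euclideanHausdorffMeasure_eq_volume]

theorem isFaceOp_iff (hΩ : IsOpen Ω) (hb : Bornology.IsBounded Ω)
    (hi : interior (closure Ω) = Ω) (hd : 0 < d) (hF : F ∈ M.interfaces) {p : ℕ}
    {v b : Eucl d → ℝ} :
    M.IsFaceOp p F v b ↔ IsLocalOp (d - 1) (p : ℤ) F (M.bubble F) v b := by
  rw [IsFaceOp, IsLocalOp, faceBubble_eq hΩ hb hi hd hF]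

theorem isBubbleOn_bubble (hT : T ∈ M.cells) {S : Finset (Eucl d)} (hS : S ⊆ T) :
    IsBubbleOn S (M.bubble S) := fun _ hw0 hw => bubble_comb hT hS hw0 hw

/-- Only the interior of a cell must lie in $\Omega$, but the boundary of a convex set is a null
set. -/
theorem restrict_hull_le (hi : interior (closure Ω) = Ω) (hT : T ∈ M.cells) :
    (volume : Measure (Eucl d)).restrict (hull T) ≤ volume.restrict Ω := by
  have h : (hull T : Set (Eucl d)) =ᵐ[volume] interior (hull T) := by
    refine Filter.EventuallyEq.symm ?_
    refine interior_ae_eq_of_null_frontier (convex_hull.addHaar_frontier volume)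
  rw [Measure.restrict_congr_set h]
  exact Measure.restrict_mono (interior_hull_subset hi hT) le_rfl

theorem hull_subset_skeleton (hF : F ∈ M.faces) : hull F ⊆ M.skeleton :=
  Set.subset_iUnion₂ (s := fun F _ => hull F) F hF

theorem MemL2Skeleton.restrict_hull {v : Eucl d → ℝ} (hv : M.MemL2Skeleton v) (hF : F ∈ M.faces) :
    MemLp v 2 ((μHE[d - 1]).restrict (hull F)) :=
  hv.mono_measure (Measure.restrict_mono (hull_subset_skeleton hF) le_rfl)

theorem MemL2Cells.restrict_hull {v : Eucl d → ℝ} (hi : interior (closure Ω) = Ω)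
    (hv : M.MemL2Cells v) (hT : T ∈ M.cells) :
    MemLp v 2 (volume.restrict (hull T)) :=
  hv.mono_measure (restrict_hull_le hi hT)

end SimplicialMesh

/-- The solvability of the local problems in the cells, with a stability estimate. -/
theorem exists_cellOp (d : ℕ) (p : ℕ) : ∃ C : ℝ≥0, ∀ Ω : Set (Eucl d), IsOpen Ω →
    Bornology.IsBounded Ω → interior (closure Ω) = Ω → ∀ M : SimplicialMesh Ω, ∀ T ∈ M.cells,
    ∀ v, MemLp v 2 (volume.restrict (hull T)) → (∃! b, M.IsCellOp p T v b) ∧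
      M.IsCellOp p T v (M.cellOp p T v) ∧
      eLpNorm (M.cellOp p T v) 2 (volume.restrict (hull T)) ≤
        C * eLpNorm v 2 (volume.restrict (hull T)) := by
  obtain ⟨C, hC⟩ := exists_localOp d ((p : ℤ) - 1)
  refine ⟨C, fun Ω hΩ hb hi M T hT v hv => ?_⟩
  obtain ⟨b, h1, h2, h3, -⟩ := hC d T (M.card_eq T hT) (M.indep T hT) _
    (SimplicialMesh.isBubbleOn_bubble hT subset_rfl) v
    (by rwa [EuclideanSpace.euclideanHausdorffMeasure_eq_volume])
  simp only [← SimplicialMesh.isCellOp_iff hΩ hb hi hT,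
    EuclideanSpace.euclideanHausdorffMeasure_eq_volume] at h1 h2 h3
  have h4 : M.IsCellOp p T v (M.cellOp p T v) := Classical.epsilon_spec ⟨b, h1⟩
  refine ⟨⟨b, h1, h2⟩, h4, ?_⟩
  rwa [h2 _ h4]

/-- The solvability of the local problems on the interfaces, with a stability estimate. -/
theorem exists_faceOp (d : ℕ) (hd : 0 < d) (p : ℕ) : ∃ C : ℝ≥0, ∀ Ω : Set (Eucl d), IsOpen Ω →
    Bornology.IsBounded Ω → interior (closure Ω) = Ω → ∀ M : SimplicialMesh Ω, ∀ F ∈ M.interfaces,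
    ∀ v, MemLp v 2 ((μHE[d - 1]).restrict (hull F)) → (∃! b, M.IsFaceOp p F v b) ∧
      M.IsFaceOp p F v (M.faceOp p F v) ∧
      ∀ x ∈ hull F, ‖M.faceOp p F v x‖ₑ * (μHE[d - 1] (hull F)) ^ (1 / 2 : ℝ) ≤
        C * eLpNorm v 2 ((μHE[d - 1]).restrict (hull F)) := by
  obtain ⟨C, hC⟩ := exists_localOp (d - 1) (p : ℤ)
  refine ⟨C, fun Ω hΩ hb hi M F hF v hv => ?_⟩
  obtain ⟨hcard, T₁, h₁, -, -, -, hF₁, -, -⟩ := SimplicialMesh.exists_of_mem_interfaces hF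
  obtain ⟨b, h1, h2, -, h3⟩ := hC d F (by omega)
    ((M.indep T₁ h₁).mono (Finset.coe_subset.2 hF₁)) _
    (SimplicialMesh.isBubbleOn_bubble h₁ hF₁) v hv
  simp only [← SimplicialMesh.isFaceOp_iff hΩ hb hi hd hF] at h1 h2
  have h4 : M.IsFaceOp p F v (M.faceOp p F v) := Classical.epsilon_spec ⟨b, h1⟩
  refine ⟨⟨b, h1, h2⟩, h4, ?_⟩
  rwa [h2 _ h4]

end WellPosed

section Smoother

open scoped NNReal ENNReal

variable {d n : ℕ} {Ω : Set (Eucl d)}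

/-! ### Linearity of the local operators -/

theorem euclideanHausdorffMeasure_hull_lt_top {S : Finset (Eucl d)} (hc : S.card = n + 1)
    (hS : AffineIndependent ℝ (fun a : S => (a : Eucl d))) : μHE[n] (hull S) < ⊤ := by
  obtain ⟨A, B, h⟩ := exists_isParam hc hS
  obtain ⟨c, -, hct, hν⟩ := h.exists_measure_eq
  have := congrArg (fun ν : Measure (Eucl d) => ν (hull S)) hν
  simp only [Measure.restrict_apply_self, Measure.smul_apply, smul_eq_mul] at this
  rw [this, h.measurableEmbedding.map_apply]
  refine ENNReal.mul_lt_top hct.lt_top (lt_of_le_of_lt (Measure.restrict_apply_le _ _) ?_)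
  rw [← h.image, Set.preimage_image_eq _ h.injective]
  exact isCompact_refSimplex.measure_lt_top

theorem IsPolyOn.memLp {k : ℤ} {S : Finset (Eucl d)} {f : Eucl d → ℝ} (hf : IsPolyOn k (hull S) f)
    {μ : Measure (Eucl d)} (hμ : μ (hull S) < ⊤) {r : ℝ≥0∞} : MemLp f r (μ.restrict (hull S)) := by
  have : IsFiniteMeasure (μ.restrict (hull S)) := ⟨by simpa using hμ⟩
  obtain ⟨B, hB⟩ := isCompact_hull.exists_bound_of_continuousOn hf.continuousOn
  exact MemLp.of_bound (hf.continuousOn.aestronglyMeasurable_of_isCompact isCompact_hull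
    isClosed_hull.measurableSet) B
    ((ae_restrict_iff' isClosed_hull.measurableSet).2 (.of_forall hB))

theorem IsPolyOn.integrable_mul {k : ℤ} {S : Finset (Eucl d)} {f v : Eucl d → ℝ}
    (hf : IsPolyOn k (hull S) f) {μ : Measure (Eucl d)} (hμ : μ (hull S) < ⊤)
    (hv : MemLp v 2 (μ.restrict (hull S))) :
    Integrable (fun x => f x * v x) (μ.restrict (hull S)) :=
  (hf.memLp hμ (r := 2)).integrable_mul hv

/-- The combination of solutions solves the problem for the combined data; with uniqueness this
gives linearity of the local operators. -/
theorem IsLocalOp.comb {k l : ℤ} {S : Finset (Eucl d)} {Φ v w b c : Eucl d → ℝ}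
    (hμ : μHE[n] (hull S) < ⊤) (hΦ : IsPolyOn l (hull S) Φ)
    (hv : MemLp v 2 ((μHE[n]).restrict (hull S))) (hw : MemLp w 2 ((μHE[n]).restrict (hull S)))
    (hb : IsLocalOp n k S Φ v b) (hc : IsLocalOp n k S Φ w c) (s t : ℝ) :
    IsLocalOp n k S Φ (s • v + t • w) (s • b + t • c) := by
  refine ⟨(hb.1.const_mul s).add (hc.1.const_mul t), fun x hx => ?_, fun q hq => ?_⟩
  · simp [hb.2.1 x hx, hc.2.1 x hx]
  have i1 : ∀ {b}, IsPolyOn k (hull S) b →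
      Integrable (fun x => q x * b x * Φ x) ((μHE[n]).restrict (hull S)) := fun hb =>
    memLp_one_iff_integrable.1 (((hq.mul hb).mul hΦ).memLp hμ)
  have e1 : ∀ x, q x * (s • b + t • c) x * Φ x =
      s * (q x * b x * Φ x) + t * (q x * c x * Φ x) := fun x => by
    simp only [Pi.add_apply, Pi.smul_apply, smul_eq_mul]; ring
  have e2 : ∀ x, q x * (s • v + t • w) x = s * (q x * v x) + t * (q x * w x) := fun x => by
    simp only [Pi.add_apply, Pi.smul_apply, smul_eq_mul]; ring
  simp only [e1, e2]
  rw [integral_add ((i1 hb.1).const_mul s) ((i1 hc.1).const_mul t),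
    integral_add ((hq.integrable_mul hμ hv).const_mul s) ((hq.integrable_mul hμ hw).const_mul t)]
  simp only [integral_const_mul]
  rw [hb.2.2 q hq, hc.2.2 q hq]

theorem IsLocalOp.congr_ae {k : ℤ} {S : Finset (Eucl d)} {Φ v w b : Eucl d → ℝ}
    (h : v =ᵐ[(μHE[n]).restrict (hull S)] w) (hb : IsLocalOp n k S Φ v b) :
    IsLocalOp n k S Φ w b := by
  refine ⟨hb.1, hb.2.1, fun q hq => (hb.2.2 q hq).trans (integral_congr_ae ?_)⟩
  filter_upwards [h] with x hx
  rw [hx]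

theorem IsPolyOn.eq_of_degree_zero {S : Set (Eucl d)} {f : Eucl d → ℝ} (hf : IsPolyOn 0 S f)
    {x y : Eucl d} (hx : x ∈ S) (hy : y ∈ S) : f x = f y := by
  obtain ⟨q, hq, hf⟩ := hf
  have hq' : q ∈ polySpace d ((0 : ℕ) : ℤ) := hq
  rw [mem_polySpace_natCast, Nat.le_zero, MvPolynomial.totalDegree_eq_zero_iff_eq_C] at hq'
  rw [hf x hx, hf y hy, hq', MvPolynomial.eval_C, MvPolynomial.eval_C]

theorem card_simplexNodes_le (p : ℕ) (T : Finset (Eucl d)) :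
    (simplexNodes p T).card ≤ (p + 1) ^ T.card := by
  classical
  refine Finset.card_image_le.trans ?_
  calc (T.piAntidiag p).card ≤ (T.pi fun _ => Finset.range (p + 1)).card := by
        refine Finset.card_le_card_of_injOn (fun α a _ => α a) (fun α hα => ?_) fun α hα β hβ h => ?_
        · have hα' := Finset.mem_piAntidiag.1 (Finset.mem_coe.1 hα)
          refine Finset.mem_coe.2 (Finset.mem_pi.2 fun a ha => Finset.mem_range.2 ?_)
          have h1 := Finset.single_le_sum (f := α) (fun _ _ => Nat.zero_le _) ha
          have h2 : ∑ a ∈ T, α a = p := hα'.1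
          change α a < p + 1
          omega
        · have hα' := Finset.mem_piAntidiag.1 (Finset.mem_coe.1 hα)
          have hβ' := Finset.mem_piAntidiag.1 (Finset.mem_coe.1 hβ)
          ext a
          by_cases ha : a ∈ T
          · exact congrFun (congrFun h a) ha
          · rw [not_not.1 (mt (hα'.2 a) ha), not_not.1 (mt (hβ'.2 a) ha)]
    _ = _ := by rw [Finset.card_pi]; simp

namespace SimplicialMesh

variable {M : SimplicialMesh Ω} {T F : Finset (Eucl d)} {p : ℕ} {v w : Eucl d → ℝ}

theorem mem_faces_of_mem_interfaces (hF : F ∈ M.interfaces) : F ∈ M.faces := by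
  classical
  exact (Finset.mem_filter.1 hF).1

theorem measure_hull_lt_top_of_mem_interfaces (hd : 0 < d) (hF : F ∈ M.interfaces) :
    μHE[d - 1] (hull F) < ⊤ := by
  obtain ⟨hcard, T₁, h₁, -, -, -, hF₁, -, -⟩ := exists_of_mem_interfaces hF
  exact euclideanHausdorffMeasure_hull_lt_top (by omega)
    ((M.indep T₁ h₁).mono (Finset.coe_subset.2 hF₁))

/-- Data that agree almost everywhere define the same solution predicate, so the choice from it is
the same function. -/
theorem cellOp_congr (hΩ : IsOpen Ω) (hb : Bornology.IsBounded Ω) (hi : interior (closure Ω) = Ω)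
    (hT : T ∈ M.cells) (h : v =ᵐ[volume.restrict Ω] w) : M.cellOp p T v = M.cellOp p T w := by
  have h1 : v =ᵐ[(μHE[d]).restrict (hull T)] w := by
    rw [EuclideanSpace.euclideanHausdorffMeasure_eq_volume]
    exact (Measure.absolutelyContinuous_of_le (restrict_hull_le hi hT)).ae_eq h
  have h2 : M.IsCellOp p T v = M.IsCellOp p T w := by
    ext b
    rw [isCellOp_iff hΩ hb hi hT, isCellOp_iff hΩ hb hi hT]
    exact ⟨fun hb => hb.congr_ae h1, fun hb => hb.congr_ae h1.symm⟩
  rw [cellOp, cellOp, h2]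

theorem faceOp_congr (hΩ : IsOpen Ω) (hb : Bornology.IsBounded Ω) (hi : interior (closure Ω) = Ω)
    (hd : 0 < d) (hF : F ∈ M.interfaces) (h : v =ᵐ[(μHE[d - 1]).restrict M.skeleton] w) :
    M.faceOp p F v = M.faceOp p F w := by
  have h1 : v =ᵐ[(μHE[d - 1]).restrict (hull F)] w :=
    (Measure.absolutelyContinuous_of_le (Measure.restrict_mono
      (hull_subset_skeleton (mem_faces_of_mem_interfaces hF)) le_rfl)).ae_eq h
  have h2 : M.IsFaceOp p F v = M.IsFaceOp p F w := by
    ext b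
    rw [isFaceOp_iff hΩ hb hi hd hF, isFaceOp_iff hΩ hb hi hd hF]
    exact ⟨fun hb => hb.congr_ae h1, fun hb => hb.congr_ae h1.symm⟩
  rw [faceOp, faceOp, h2]

theorem cellOp_comb (hΩ : IsOpen Ω) (hb : Bornology.IsBounded Ω) (hi : interior (closure Ω) = Ω)
    (hT : T ∈ M.cells) (hv : MemLp v 2 (volume.restrict (hull T)))
    (hw : MemLp w 2 (volume.restrict (hull T))) (s t : ℝ) :
    M.cellOp p T (s • v + t • w) = s • M.cellOp p T v + t • M.cellOp p T w := by
  obtain ⟨C, hC⟩ := exists_cellOp d p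
  have hC := hC Ω hΩ hb hi M T hT
  obtain ⟨h1, h2, -⟩ := hC _ ((hv.const_smul s).add (hw.const_smul t))
  refine h1.unique h2 ((isCellOp_iff hΩ hb hi hT).2 (IsLocalOp.comb
    (euclideanHausdorffMeasure_hull_lt_top (M.card_eq T hT) (M.indep T hT))
    (isPolyOn_bubble hT T) ?_ ?_ ((isCellOp_iff hΩ hb hi hT).1 (hC v hv).2.1)
    ((isCellOp_iff hΩ hb hi hT).1 (hC w hw).2.1) s t))
  all_goals rwa [EuclideanSpace.euclideanHausdorffMeasure_eq_volume]

theorem faceOp_comb (hΩ : IsOpen Ω) (hb : Bornology.IsBounded Ω) (hi : interior (closure Ω) = Ω)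
    (hd : 0 < d) (hF : F ∈ M.interfaces) (hv : M.MemL2Skeleton v) (hw : M.MemL2Skeleton w)
    (s t : ℝ) : M.faceOp p F (s • v + t • w) = s • M.faceOp p F v + t • M.faceOp p F w := by
  obtain ⟨C, hC⟩ := exists_faceOp d hd p
  have hC := hC Ω hΩ hb hi M F hF
  have hv := hv.restrict_hull (mem_faces_of_mem_interfaces hF)
  have hw := hw.restrict_hull (mem_faces_of_mem_interfaces hF)
  obtain ⟨h1, h2, -⟩ := hC _ ((hv.const_smul s).add (hw.const_smul t))
  obtain ⟨-, T₁, h₁, -, -, -, hF₁, -, -⟩ := exists_of_mem_interfaces hF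
  exact h1.unique h2 ((isFaceOp_iff hΩ hb hi hd hF).2 (IsLocalOp.comb
    (measure_hull_lt_top_of_mem_interfaces hd hF)
    ((isPolyOn_bubble h₁ F).mono_set (hull_mono hF₁)) hv hw
    ((isFaceOp_iff hΩ hb hi hd hF).1 (hC v hv).2.1)
    ((isFaceOp_iff hΩ hb hi hd hF).1 (hC w hw).2.1) s t))

/-! ### The operator on the skeleton -/

open Classical in
/-- The extension of the local polynomial `B_F v` to the mesh. -/
noncomputable def faceExt (M : SimplicialMesh Ω) (p : ℕ) (F : Finset (Eucl d)) (v : Eucl d → ℝ)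
    (x : Eucl d) : ℝ :=
  if p = 0 then M.faceOp p F v (barycenter F)
  else ∑ z ∈ (M.nodes p).filter (fun z => z ∈ hull F), M.faceOp p F v z * M.lagrangeBasis p z x

theorem skeletonOp_eq (hΩ : IsOpen Ω) (hb : Bornology.IsBounded Ω)
    (hi : interior (closure Ω) = Ω) (hd : 0 < d) (v : Eucl d → ℝ) (x : Eucl d) :
    M.skeletonOp p v x = ∑ F ∈ M.interfaces, M.faceExt p F v x * M.bubble F x := by
  classical
  have h : ∀ F ∈ M.interfaces, M.faceBubble F = M.bubble F := fun F hF =>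
    faceBubble_eq hΩ hb hi hd hF
  rw [skeletonOp]
  split_ifs with hp
  · exact Finset.sum_congr rfl fun F hF => by rw [faceExt, if_pos hp, h F hF]
  · exact Finset.sum_congr rfl fun F hF => by rw [faceExt, if_neg hp, h F hF, Finset.sum_mul]

theorem isPolyOn_faceExt (hΩ : IsOpen Ω) (hb : Bornology.IsBounded Ω) (hT : T ∈ M.cells)
    (F : Finset (Eucl d)) (v : Eucl d → ℝ) : IsPolyOn (p : ℤ) (hull T) (M.faceExt p F v) := by
  classical
  by_cases hp : p = 0
  · refine IsPolyOn.congr (f := fun _ => M.faceOp p F v (barycenter F)) ?_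
      fun x _ => by rw [faceExt, if_pos hp]
    exact (isPolyOn_const _).mono_deg (by positivity)
  · refine IsPolyOn.congr (f := fun x => ∑ z ∈ (M.nodes p).filter (fun z => z ∈ hull F),
      M.faceOp p F v z * M.lagrangeBasis p z x) ?_ fun x _ => by rw [faceExt, if_neg hp]
    refine IsPolyOn.sum fun z hz => IsPolyOn.const_mul ?_ _
    exact (isLagrangeBasis_lagrangeBasis hΩ hb (by omega) (Finset.mem_filter.1 hz).1).2.2.1 T hT

/-- A node off $F$ has positive weight at some vertex outside $F$. The hat of that vertex is a
factor of the basis function, up to a constant, and vanishes on $F$. -/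
theorem lagrangeBasis_eq_zero (hΩ : IsOpen Ω) (hb : Bornology.IsBounded Ω) (hp : 1 ≤ p)
    {z : Eucl d} (hz : z ∈ M.nodes p) (hT : T ∈ M.cells) (hFT : F ⊆ T) (hzF : z ∉ hull F)
    {x : Eucl d} (hx : x ∈ hull F) : M.lagrangeBasis p z x = 0 := by
  classical
  have h := isLagrangeBasis_lagrangeBasis hΩ hb hp hz
  obtain ⟨T', hT', hzT⟩ := mem_nodes.1 hz
  obtain ⟨α, hα, hzα⟩ := mem_simplexNodes.1 hzT
  have h2 : M.lagrangeBasis p z = M.nodeFun p T' α := by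
    refine (isLagrangeBasis_iff hΩ hb hp hT' hα).1 ?_
    rwa [hzα]
  have hp0 : (p : ℝ) ≠ 0 := by positivity
  obtain ⟨a, haT, haF, ha0⟩ : ∃ a ∈ T', a ∉ F ∧ α a ≠ 0 := by
    by_contra! hcon
    refine hzF (hull_mono (S := T' ∩ F) Finset.inter_subset_right (mem_hull.2
      ⟨fun a => (α a : ℝ) / p, fun a _ => by positivity, ?_, ?_⟩))
    · rw [Finset.sum_subset (Finset.inter_subset_left (s₂ := F)) fun a ha haF => ?_]
      · rw [← Finset.sum_div, ← Nat.cast_sum, hα.1, div_self hp0]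
      · rw [hcon a ha fun h => haF (Finset.mem_inter.2 ⟨ha, h⟩)]; simp
    · rw [Finset.sum_subset (Finset.inter_subset_left (s₂ := F)) fun a ha haF => ?_]
      · exact hzα
      · have h0 := hcon a ha fun h => haF (Finset.mem_inter.2 ⟨ha, h⟩)
        simp [h0]
  rw [h2, nodeFun]
  refine Finset.prod_eq_zero haT (Finset.prod_eq_zero (i := 0)
    (Finset.mem_range.2 (Nat.pos_of_ne_zero ha0)) ?_)
  rw [hat_eq hT (hull_mono hFT hx), (((isCell hT).mem_hull_face_iff hFT).1 hx).2 a haF]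
  simp

/-- The extension reproduces the local polynomial on the interface. -/
theorem faceExt_eq (hΩ : IsOpen Ω) (hb : Bornology.IsBounded Ω) (hd : 0 < d)
    (hF : F ∈ M.interfaces) (hop : IsPolyOn (p : ℤ) (hull F) (M.faceOp p F v))
    {x : Eucl d} (hx : x ∈ hull F) : M.faceExt p F v x = M.faceOp p F v x := by
  classical
  obtain ⟨hcard, T, hT, -, -, -, hFT, -, -⟩ := exists_of_mem_interfaces hF
  by_cases hp : p = 0
  · subst hp
    rw [faceExt, if_pos rfl]
    exact hop.eq_of_degree_zero (barycenter_mem_hull (by rw [← Finset.card_pos]; omega)) hx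
  have hp1 : 1 ≤ p := by omega
  -- The local polynomial on $F$ is the restriction of a polynomial $P$ on the whole space, which
  -- Lagrange interpolation reproduces on an adjacent cell. On $F$ the nodes off $F$ do not
  -- contribute.
  obtain ⟨P, -, hPp, hP⟩ := hop.exists_contDiff
  have hcell := (isCell hT).eq_zero_of_nodes hp1
    (f := fun x => (∑ z ∈ M.nodes p, P z * M.lagrangeBasis p z x) - P x)
    (IsPolyOn.sub (IsPolyOn.sum fun z hz => IsPolyOn.const_mul
      ((isLagrangeBasis_lagrangeBasis hΩ hb hp1 hz).2.2.1 T hT) _)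
      (hPp.mono_set (Set.subset_univ _))) (fun z hz => ?_) x (hull_mono hFT hx)
  · have h1 : ∑ z ∈ M.nodes p, P z * M.lagrangeBasis p z x =
        ∑ z ∈ (M.nodes p).filter (fun z => z ∈ hull F),
          M.faceOp p F v z * M.lagrangeBasis p z x := by
      rw [Finset.sum_filter]
      refine Finset.sum_congr rfl fun z hz => ?_
      split_ifs with hzF
      · rw [hP z hzF]
      · rw [lagrangeBasis_eq_zero hΩ hb hp1 hz hT hFT hzF hx, mul_zero]
    rw [faceExt, if_neg hp, ← h1, hP x hx]
    exact sub_eq_zero.1 hcell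
  · have hz' : z ∈ M.nodes p := mem_nodes.2 ⟨T, hT, hz⟩
    rw [sub_eq_zero, Finset.sum_eq_single z]
    · rw [(isLagrangeBasis_lagrangeBasis hΩ hb hp1 hz').2.2.2 z hz']; simp
    · intro y hy hyz
      rw [(isLagrangeBasis_lagrangeBasis hΩ hb hp1 hy).2.2.2 z hz', if_neg hyz.symm, mul_zero]
    · exact fun h => absurd hz' h

/-- The nodes on $F$ are nodes of one cell, hence at most $(p+1)^{d+1}$ in number, and each basis
function is bounded by $p^p$. For $p=0$ the constant is $1$, as $0^0=1$. The weight $m$ stands for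
the root of the cell volume. -/
theorem enorm_faceExt_le (hΩ : IsOpen Ω) (hb : Bornology.IsBounded Ω) (hd : 0 < d)
    (hF : F ∈ M.interfaces) {m D : ℝ≥0∞} (hD : ∀ z ∈ hull F, ‖M.faceOp p F v z‖ₑ * m ≤ D)
    (x : Eucl d) :
    ‖M.faceExt p F v x‖ₑ * m ≤ (((p + 1) ^ (d + 1) * p ^ p : ℕ) : ℝ≥0∞) * D := by
  classical
  obtain ⟨hcard, T, hT, -, -, -, hFT, -, -⟩ := exists_of_mem_interfaces hF
  by_cases hp : p = 0
  · subst hp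
    rw [faceExt, if_pos rfl]
    simpa using hD _ (barycenter_mem_hull (by rw [← Finset.card_pos]; omega))
  have hp1 : 1 ≤ p := by omega
  set N := (M.nodes p).filter (fun z => z ∈ hull F) with hN
  have hNcard : N.card ≤ (p + 1) ^ (d + 1) := by
    rw [← M.card_eq T hT]
    refine (Finset.card_le_card fun z hz => ?_).trans (card_simplexNodes_le p T)
    have hz := Finset.mem_filter.1 hz
    exact mem_simplexNodes_of_mem hp1 hz.1 hT (hull_mono hFT hz.2)
  rw [faceExt, if_neg hp]
  calc ‖∑ z ∈ N, M.faceOp p F v z * M.lagrangeBasis p z x‖ₑ * m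
      ≤ (∑ z ∈ N, ‖M.faceOp p F v z * M.lagrangeBasis p z x‖ₑ) * m := by
        gcongr
        exact enorm_sum_le _ _
    _ = ∑ z ∈ N, (‖M.faceOp p F v z‖ₑ * m) * ‖M.lagrangeBasis p z x‖ₑ := by
        rw [Finset.sum_mul]
        refine Finset.sum_congr rfl fun z _ => ?_
        rw [enorm_mul]; ring
    _ ≤ ∑ z ∈ N, D * ((p ^ p : ℕ) : ℝ≥0∞) := by
        refine Finset.sum_le_sum fun z hz => ?_
        have hz := Finset.mem_filter.1 hz
        refine mul_le_mul' (hD z hz.2) ?_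
        rw [Real.enorm_eq_ofReal_abs, ← ENNReal.ofReal_natCast]
        refine ENNReal.ofReal_le_ofReal ?_
        push_cast
        exact abs_lagrangeBasis_le hΩ hb hp1 hz.1 x
    _ = (N.card : ℝ≥0∞) * (D * ((p ^ p : ℕ) : ℝ≥0∞)) := by rw [Finset.sum_const, nsmul_eq_mul]
    _ ≤ (((p + 1) ^ (d + 1) : ℕ) : ℝ≥0∞) * (D * ((p ^ p : ℕ) : ℝ≥0∞)) := by
        gcongr
    _ = _ := by push_cast; ring

/-- Only point values of $B_Fv$ enter the extension, so the degree bound holds for arbitrary data.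
-/
theorem isPolyOn_skeletonOp (hΩ : IsOpen Ω) (hb : Bornology.IsBounded Ω)
    (hi : interior (closure Ω) = Ω) (hd : 0 < d) (hT : T ∈ M.cells) (v : Eucl d → ℝ) :
    IsPolyOn ((p : ℤ) + d) (hull T) (M.skeletonOp p v) := by
  refine IsPolyOn.congr (IsPolyOn.sum fun F hF => (isPolyOn_faceExt hΩ hb hT F v).mul ?_)
    fun x _ => skeletonOp_eq hΩ hb hi hd v x
  have := isPolyOn_bubble (M := M) hT F
  rwa [(exists_of_mem_interfaces hF).1] at this

theorem skeletonOp_of_notMem (hΩ : IsOpen Ω) (hb : Bornology.IsBounded Ω)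
    (hi : interior (closure Ω) = Ω) (hd : 0 < d) (v : Eucl d → ℝ) {x : Eucl d} (hx : x ∉ Ω) :
    M.skeletonOp p v x = 0 := by
  rw [skeletonOp_eq hΩ hb hi hd]
  exact Finset.sum_eq_zero fun F hF => by
    rw [faceBubble_eq_zero_of_notMem hi hd hF hx, mul_zero]

/-- The bubble of another interface vanishes on $F$, since its vertex set has the same cardinality
and cannot be contained in $F$. -/
theorem skeletonOp_eq_on_interface (hΩ : IsOpen Ω) (hb : Bornology.IsBounded Ω)
    (hi : interior (closure Ω) = Ω) (hd : 0 < d) (hF : F ∈ M.interfaces)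
    (hop : IsPolyOn (p : ℤ) (hull F) (M.faceOp p F v)) {x : Eucl d} (hx : x ∈ hull F) :
    M.skeletonOp p v x = M.faceOp p F v x * M.bubble F x := by
  obtain ⟨hcard, T, hT, -, -, -, hFT, -, -⟩ := exists_of_mem_interfaces hF
  rw [skeletonOp_eq hΩ hb hi hd, Finset.sum_eq_single F, faceExt_eq hΩ hb hd hF hop hx]
  · intro F' hF' hne
    rw [bubble_eq_zero_of_not_subset hT hFT hx, mul_zero]
    intro hsub
    exact hne (Finset.eq_of_subset_of_card_le hsub
      (by rw [hcard, (exists_of_mem_interfaces hF').1]))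
  · exact fun h => absurd hF h

theorem skeletonOp_congr (hΩ : IsOpen Ω) (hb : Bornology.IsBounded Ω)
    (hi : interior (closure Ω) = Ω) (hd : 0 < d)
    (h : v =ᵐ[(μHE[d - 1]).restrict M.skeleton] w) : M.skeletonOp p v = M.skeletonOp p w := by
  ext x
  rw [skeletonOp_eq hΩ hb hi hd, skeletonOp_eq hΩ hb hi hd]
  exact Finset.sum_congr rfl fun F hF => by
    rw [faceExt, faceExt, faceOp_congr hΩ hb hi hd hF h]

theorem skeletonOp_comb (hΩ : IsOpen Ω) (hb : Bornology.IsBounded Ω)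
    (hi : interior (closure Ω) = Ω) (hd : 0 < d) (hv : M.MemL2Skeleton v) (hw : M.MemL2Skeleton w)
    (s t : ℝ) : M.skeletonOp p (s • v + t • w) = s • M.skeletonOp p v + t • M.skeletonOp p w := by
  classical
  ext x
  simp only [Pi.add_apply, Pi.smul_apply, smul_eq_mul]
  simp only [skeletonOp_eq hΩ hb hi hd, Finset.mul_sum]
  rw [← Finset.sum_add_distrib]
  refine Finset.sum_congr rfl fun F hF => ?_
  have h : M.faceExt p F (s • v + t • w) x = s * M.faceExt p F v x + t * M.faceExt p F w x := by
    rw [faceExt, faceExt, faceExt, faceOp_comb hΩ hb hi hd hF hv hw]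
    split_ifs
    · simp
    · rw [Finset.mul_sum, Finset.mul_sum, ← Finset.sum_add_distrib]
      refine Finset.sum_congr rfl fun z _ => ?_
      simp only [Pi.add_apply, Pi.smul_apply, smul_eq_mul]
      ring
  rw [h]
  ring

/-- The local bound for the operator on the skeleton. -/
theorem eLpNorm_skeletonOp_le (hΩ : IsOpen Ω) (hb : Bornology.IsBounded Ω)
    (hi : interior (closure Ω) = Ω) (hd : 0 < d) (hT : T ∈ M.cells) (D : Finset (Eucl d) → ℝ≥0∞)
    (hD : ∀ F ∈ M.interfaces, F ⊆ T → ∀ z ∈ hull F,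
      ‖M.faceOp p F v z‖ₑ * volume (hull T) ^ (1 / 2 : ℝ) ≤ D F) :
    eLpNorm (M.skeletonOp p v) 2 (volume.restrict (hull T)) ≤
      ∑ F ∈ M.facesOf T, (((p + 1) ^ (d + 1) * p ^ p * d ^ d : ℕ) : ℝ≥0∞) * D F := by
  classical
  have hbub : ∀ F ∈ M.interfaces, ∀ x, ‖M.bubble F x‖ₑ ≤ ((d ^ d : ℕ) : ℝ≥0∞) := by
    intro F hF x
    rw [Real.enorm_of_nonneg (bubble_nonneg F x), ← ENNReal.ofReal_natCast]
    refine ENNReal.ofReal_le_ofReal ?_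
    have := bubble_le (M := M) F x
    rw [(exists_of_mem_interfaces hF).1] at this
    exact_mod_cast this
  -- Bubbles of interfaces that are not facets of $T$ vanish on $T$.
  set I := M.interfaces.filter fun F => F ⊆ T with hI
  have hsub : I ⊆ M.facesOf T := fun F hF => by
    have := Finset.mem_filter.1 hF
    exact Finset.mem_filter.2 ⟨mem_faces_of_mem_interfaces this.1, hull_mono this.2⟩
  have hloc : ∀ x ∈ hull T, M.skeletonOp p v x = ∑ F ∈ I, M.faceExt p F v x * M.bubble F x := by
    intro x hx
    rw [skeletonOp_eq hΩ hb hi hd, hI, Finset.sum_filter]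
    refine Finset.sum_congr rfl fun F hF => ?_
    split_ifs with h
    · rfl
    · rw [bubble_eq_zero_of_not_subset hT subset_rfl hx h, mul_zero]
  calc eLpNorm (M.skeletonOp p v) 2 (volume.restrict (hull T))
      = eLpNorm (∑ F ∈ I, fun x => M.faceExt p F v x * M.bubble F x) 2
          (volume.restrict (hull T)) := by
        refine eLpNorm_congr_ae ((ae_restrict_iff' isClosed_hull.measurableSet).2
          (.of_forall fun x hx => ?_))
        rw [hloc x hx, Finset.sum_apply]
    _ ≤ ∑ F ∈ I, eLpNorm (fun x => M.faceExt p F v x * M.bubble F x) 2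
          (volume.restrict (hull T)) := by
        refine eLpNorm_sum_le (fun F _ => ?_) (by norm_num)
        exact ((isPolyOn_faceExt hΩ hb hT F v).mul (isPolyOn_bubble hT F)).continuousOn
          |>.aestronglyMeasurable_of_isCompact isCompact_hull isClosed_hull.measurableSet
    _ ≤ ∑ F ∈ I, (((p + 1) ^ (d + 1) * p ^ p * d ^ d : ℕ) : ℝ≥0∞) * D F := by
        refine Finset.sum_le_sum fun F hF => ?_
        have hF' := Finset.mem_filter.1 hF
        have hvol : volume (hull T) ≠ ⊤ := isCompact_hull.measure_lt_top.ne
        -- A positive finite volume is needed to divide by its root in the pointwise bound;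
        -- integration over the cell multiplies the root back.
        rcases eq_or_ne (volume (hull T)) 0 with h0 | h0
        · rw [Measure.restrict_eq_zero.2 h0]; simp
        have hm0 : volume (hull T) ^ (1 / 2 : ℝ) ≠ 0 := by simp [h0, hvol]
        have hmt : volume (hull T) ^ (1 / 2 : ℝ) ≠ ⊤ :=
          ENNReal.rpow_ne_top_of_nonneg (by norm_num) hvol
        have hbd : ∀ x, ‖M.faceExt p F v x * M.bubble F x‖ₑ ≤
            (((p + 1) ^ (d + 1) * p ^ p * d ^ d : ℕ) : ℝ≥0∞) * D F /
              volume (hull T) ^ (1 / 2 : ℝ) := by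
          intro x
          rw [ENNReal.le_div_iff_mul_le (.inl hm0) (.inl hmt), enorm_mul]
          have h1 := enorm_faceExt_le hΩ hb hd hF'.1 (hD F hF'.1 hF'.2) x
          calc _ = (‖M.faceExt p F v x‖ₑ * volume (hull T) ^ (1 / 2 : ℝ)) * ‖M.bubble F x‖ₑ := by
                ring
            _ ≤ ((((p + 1) ^ (d + 1) * p ^ p : ℕ) : ℝ≥0∞) * D F) * ((d ^ d : ℕ) : ℝ≥0∞) :=
                mul_le_mul' h1 (hbub F hF'.1 x)
            _ = _ := by push_cast; ring
        refine (eLpNorm_le_of_ae_enorm_bound (.of_forall hbd)).trans ?_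
        rw [Measure.restrict_apply_univ, smul_eq_mul]
        have : (ENNReal.toReal 2)⁻¹ = (1 / 2 : ℝ) := by norm_num
        rw [this, ENNReal.div_mul_cancel hm0 hmt]
    _ ≤ _ := Finset.sum_le_sum_of_subset hsub

end SimplicialMesh

end Smoother

section Main

open scoped NNReal ENNReal

variable {d : ℕ} {Ω : Set (Eucl d)}

namespace SimplicialMesh

variable {M : SimplicialMesh Ω} {T F : Finset (Eucl d)} {p : ℕ} {vM vS wM wS : Eucl d → ℝ}

/-! ### The bubble smoother -/

theorem smoother_eq (hΩ : IsOpen Ω) (hb : Bornology.IsBounded Ω) (hi : interior (closure Ω) = Ω)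
    (vM vS : Eucl d → ℝ) (x : Eucl d) : M.smoother p vM vS x = M.skeletonOp p vS x +
      ∑ T ∈ M.cells, M.cellOp p T (fun y => vM y - M.skeletonOp p vS y) x * M.bubble T x := by
  rw [smoother, meshOp]
  congr 1
  exact Finset.sum_congr rfl fun T hT => by rw [elementBubble_eq hΩ hb hi hT]

theorem smoother_eq_on_cell (hΩ : IsOpen Ω) (hb : Bornology.IsBounded Ω)
    (hi : interior (closure Ω) = Ω) (vM vS : Eucl d → ℝ) (hT : T ∈ M.cells) {x : Eucl d}
    (hx : x ∈ hull T) : M.smoother p vM vS x = M.skeletonOp p vS x +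
      M.cellOp p T (fun y => vM y - M.skeletonOp p vS y) x * M.bubble T x := by
  rw [smoother_eq hΩ hb hi, Finset.sum_eq_single T]
  · intro T' hT' hne
    rw [bubble_eq_zero_of_not_subset hT subset_rfl hx fun h => hne (cell_eq_of_subset hT' hT h),
      mul_zero]
  · exact fun h => absurd hT h

theorem memLp_skeletonOp (hΩ : IsOpen Ω) (hb : Bornology.IsBounded Ω)
    (hi : interior (closure Ω) = Ω) (hd : 0 < d) (hT : T ∈ M.cells) (vS : Eucl d → ℝ) :
    MemLp (M.skeletonOp p vS) 2 (volume.restrict (hull T)) :=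
  (isPolyOn_skeletonOp hΩ hb hi hd hT vS).memLp isCompact_hull.measure_lt_top

theorem memLp_residual (hΩ : IsOpen Ω) (hb : Bornology.IsBounded Ω)
    (hi : interior (closure Ω) = Ω) (hd : 0 < d) (hT : T ∈ M.cells) (hv : M.MemL2Cells vM)
    (vS : Eucl d → ℝ) :
    MemLp (fun y => vM y - M.skeletonOp p vS y) 2 (volume.restrict (hull T)) :=
  (hv.restrict_hull hi hT).sub (memLp_skeletonOp hΩ hb hi hd hT vS)

theorem isCellOp_residual (hΩ : IsOpen Ω) (hb : Bornology.IsBounded Ω)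
    (hi : interior (closure Ω) = Ω) (hd : 0 < d) (hT : T ∈ M.cells) (hv : M.MemL2Cells vM)
    (vS : Eucl d → ℝ) : M.IsCellOp p T (fun y => vM y - M.skeletonOp p vS y)
      (M.cellOp p T fun y => vM y - M.skeletonOp p vS y) := by
  obtain ⟨C, hC⟩ := exists_cellOp d p
  exact (hC Ω hΩ hb hi M T hT _ (memLp_residual hΩ hb hi hd hT hv vS)).2.1

/-- The degrees match: $(p-1)+(d+1)$ for the cell part and $p+d$ for the skeleton part. This is the
degree for which the inverse estimate is applied. -/
theorem isPolyOn_smoother (hΩ : IsOpen Ω) (hb : Bornology.IsBounded Ω)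
    (hi : interior (closure Ω) = Ω) (hd : 0 < d) (hT : T ∈ M.cells) (hv : M.MemL2Cells vM)
    (vS : Eucl d → ℝ) : IsPolyOn ((p : ℤ) + d) (hull T) (M.smoother p vM vS) := by
  refine IsPolyOn.congr ((isPolyOn_skeletonOp hΩ hb hi hd hT vS).add
    (((isCellOp_residual hΩ hb hi hd hT hv vS).1.mul (isPolyOn_bubble hT T)).mono_deg ?_))
    fun x hx => smoother_eq_on_cell hΩ hb hi vM vS hT hx
  rw [M.card_eq T hT]
  push_cast
  omega

theorem smoother_of_notMem (hΩ : IsOpen Ω) (hb : Bornology.IsBounded Ω)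
    (hi : interior (closure Ω) = Ω) (hd : 0 < d) (vM vS : Eucl d → ℝ) {x : Eucl d} (hx : x ∉ Ω) :
    M.smoother p vM vS x = 0 := by
  rw [smoother_eq hΩ hb hi, skeletonOp_of_notMem hΩ hb hi hd vS hx, zero_add]
  exact Finset.sum_eq_zero fun T hT => by
    rw [cellBubble_eq_zero_of_notMem hi hT hx, mul_zero]

theorem exists_lipschitzWith_smoother (hΩ : IsOpen Ω) (hb : Bornology.IsBounded Ω)
    (hi : interior (closure Ω) = Ω) (hd : 0 < d) (hv : M.MemL2Cells vM) (vS : Eucl d → ℝ) :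
    ∃ C, LipschitzWith C (M.smoother p vM vS) :=
  IsPiecewisePoly.lipschitzWith (M := M) hΩ
    (fun _ hT => ⟨_, isPolyOn_smoother hΩ hb hi hd hT hv vS⟩)
    fun _ hx => smoother_of_notMem hΩ hb hi hd vM vS hx

theorem smoother_congr (hΩ : IsOpen Ω) (hb : Bornology.IsBounded Ω)
    (hi : interior (closure Ω) = Ω) (hd : 0 < d) (hM : vM =ᵐ[volume.restrict Ω] wM)
    (hS : vS =ᵐ[(μHE[d - 1]).restrict M.skeleton] wS) :
    M.smoother p vM vS = M.smoother p wM wS := by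
  ext x
  rw [smoother_eq hΩ hb hi, smoother_eq hΩ hb hi, skeletonOp_congr hΩ hb hi hd hS]
  congr 1
  refine Finset.sum_congr rfl fun T hT => ?_
  rw [cellOp_congr hΩ hb hi hT (v := fun y => vM y - M.skeletonOp p wS y)
    (w := fun y => wM y - M.skeletonOp p wS y)]
  filter_upwards [hM] with y hy
  rw [hy]

theorem smoother_comb (hΩ : IsOpen Ω) (hb : Bornology.IsBounded Ω)
    (hi : interior (closure Ω) = Ω) (hd : 0 < d) (hvM : M.MemL2Cells vM) (hvS : M.MemL2Skeleton vS)
    (hwM : M.MemL2Cells wM) (hwS : M.MemL2Skeleton wS) (s t : ℝ) :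
    M.smoother p (s • vM + t • wM) (s • vS + t • wS) =
      s • M.smoother p vM vS + t • M.smoother p wM wS := by
  ext x
  simp only [Pi.add_apply, Pi.smul_apply, smul_eq_mul]
  rw [smoother_eq hΩ hb hi, smoother_eq hΩ hb hi, smoother_eq hΩ hb hi,
    skeletonOp_comb hΩ hb hi hd hvS hwS]
  have h : (fun y => s * vM y + t * wM y - (s • M.skeletonOp p vS + t • M.skeletonOp p wS) y) =
      s • (fun y => vM y - M.skeletonOp p vS y) + t • (fun y => wM y - M.skeletonOp p wS y) := by
    ext y
    simp only [Pi.add_apply, Pi.smul_apply, smul_eq_mul]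
    ring
  simp only [Pi.add_apply, Pi.smul_apply, smul_eq_mul, mul_add, Finset.mul_sum] at h ⊢
  have h2 : ∀ T ∈ M.cells, M.cellOp p T (fun y => s * vM y + t * wM y -
        (s * M.skeletonOp p vS y + t * M.skeletonOp p wS y)) x * M.bubble T x =
      s * (M.cellOp p T (fun y => vM y - M.skeletonOp p vS y) x * M.bubble T x) +
      t * (M.cellOp p T (fun y => wM y - M.skeletonOp p wS y) x * M.bubble T x) := by
    intro T hT
    rw [h, cellOp_comb hΩ hb hi hT (memLp_residual hΩ hb hi hd hT hvM vS)
      (memLp_residual hΩ hb hi hd hT hwM wS)]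
    simp only [Pi.add_apply, Pi.smul_apply, smul_eq_mul]
    ring
  rw [Finset.sum_congr rfl h2, Finset.sum_add_distrib]
  ring

/-- The cell part has the moments of the residual, so the contribution of the skeleton part cancels.
-/
theorem integral_smoother_cell (hΩ : IsOpen Ω) (hb : Bornology.IsBounded Ω)
    (hi : interior (closure Ω) = Ω) (hd : 0 < d) (hv : M.MemL2Cells vM) (vS : Eucl d → ℝ)
    (hT : T ∈ M.cells) {q : Eucl d → ℝ} (hq : IsPolyOn ((p : ℤ) - 1) (hull T) q) :
    ∫ x in hull T, q x * M.smoother p vM vS x = ∫ x in hull T, q x * vM x := by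
  have hop := isCellOp_residual (p := p) hΩ hb hi hd hT hv vS
  have hmom := hop.2.2 q hq
  rw [elementBubble_eq hΩ hb hi hT] at hmom
  have hfin : volume (hull T) < ⊤ := isCompact_hull.measure_lt_top
  have i1 := hq.integrable_mul hfin (memLp_skeletonOp (p := p) hΩ hb hi hd hT vS)
  have i2 := memLp_one_iff_integrable.1
    (((hq.mul hop.1).mul (isPolyOn_bubble hT T)).memLp hfin)
  have i3 := hq.integrable_mul hfin (hv.restrict_hull hi hT)
  calc ∫ x in hull T, q x * M.smoother p vM vS x
      = ∫ x in hull T, (q x * M.skeletonOp p vS x +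
          q x * M.cellOp p T (fun y => vM y - M.skeletonOp p vS y) x * M.bubble T x) := by
        refine setIntegral_congr_fun isClosed_hull.measurableSet fun x hx => ?_
        simp only [smoother_eq_on_cell hΩ hb hi vM vS hT hx]
        ring
    _ = (∫ x in hull T, q x * M.skeletonOp p vS x) +
          ∫ x in hull T, q x * (vM x - M.skeletonOp p vS x) := by
        rw [integral_add i1 i2, hmom]
    _ = _ := by
        simp only [mul_sub]
        rw [integral_sub i3 i1]
        ring

/-- Cell bubbles vanish on $F$, which has too few vertices to contain a cell. The trace is therefore
$(B_Fv)\Phi_F$, whose moments define $B_F$. -/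
theorem integral_smoother_interface (hΩ : IsOpen Ω) (hb : Bornology.IsBounded Ω)
    (hi : interior (closure Ω) = Ω) (hd : 0 < d) (vM : Eucl d → ℝ) (hv : M.MemL2Skeleton vS)
    (hF : F ∈ M.interfaces) {r : Eucl d → ℝ} (hr : IsPolyOn (p : ℤ) (hull F) r) :
    ∫ x in hull F, r x * M.smoother p vM vS x ∂μHE[d - 1] =
      ∫ x in hull F, r x * vS x ∂μHE[d - 1] := by
  obtain ⟨C, hC⟩ := exists_faceOp d hd p
  obtain ⟨-, hop, -⟩ := hC Ω hΩ hb hi M F hF vS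
    (hv.restrict_hull (mem_faces_of_mem_interfaces hF))
  rw [← hop.2.2 r hr, faceBubble_eq hΩ hb hi hd hF]
  refine setIntegral_congr_fun isClosed_hull.measurableSet fun x hx => ?_
  obtain ⟨hcard, T, hT, -, -, -, hFT, -, -⟩ := exists_of_mem_interfaces hF
  have h0 : M.bubble T x = 0 := by
    refine bubble_eq_zero_of_not_subset hT hFT hx fun h => ?_
    have := Finset.card_le_card h
    rw [M.card_eq T hT, hcard] at this
    omega
  simp only [smoother_eq_on_cell hΩ hb hi vM vS hT (hull_mono hFT hx), h0,
    skeletonOp_eq_on_interface hΩ hb hi hd hF hop.1 hx]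
  ring

theorem le_shapeParameter (hT : T ∈ M.cells) : size T / inradius T ≤ M.shapeParameter :=
  le_csSup ((M.cells.finite_toSet.image _).bddAbove) (Set.mem_image_of_mem _ hT)

end SimplicialMesh

/-- The local stability of the bubble smoother. -/
theorem exists_smoother_le (d : ℕ) (hd : d = 2 ∨ d = 3) (p : ℕ) : ∃ c : ℝ≥0, ∀ Ω : Set (Eucl d),
    IsOpen Ω → Bornology.IsBounded Ω → interior (closure Ω) = Ω → ∀ M : SimplicialMesh Ω,
    ∀ vM vS, M.MemL2Cells vM → M.MemL2Skeleton vS →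
    ∀ g, HasWeakGradient Ω (M.smoother p vM vS) g → ∀ T ∈ M.cells,
      eLpNorm g 2 (volume.restrict (hull T)) ≤
        ENNReal.ofReal (c * max M.shapeParameter 1 ^ 2) *
          (ENNReal.ofReal (size T)⁻¹ * eLpNorm vM 2 (volume.restrict (hull T)) +
            ∑ F ∈ M.facesOf T, ENNReal.ofReal ((size F) ^ (-(1 / 2) : ℝ)) *
              eLpNorm vS 2 ((μHE[d - 1]).restrict (hull F))) := by
  have : NeZero d := ⟨by omega⟩
  have hd0 : 0 < d := by omega
  obtain ⟨C₁, hC₁⟩ := exists_gradient_le d ((p : ℤ) + d)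
  obtain ⟨C₂, hC₂⟩ := exists_volume_le d hd
  obtain ⟨C₃, hC₃⟩ := exists_cellOp d p
  obtain ⟨C₄, hC₄⟩ := exists_faceOp d hd0 p
  let N : ℝ≥0 := ((p + 1) ^ (d + 1) * p ^ p * d ^ d : ℕ)
  let K : ℝ≥0 := ((d + 1) ^ (d + 1) : ℕ) * C₃
  -- Here $C_1$ is the inverse estimate, $K$ bounds the cell operator times its bubble, and
  -- $NC_2C_4$ bounds the skeleton part. The latter enters directly and through the residual, whence
  -- $1+K$.
  refine ⟨C₁ * (K + (1 + K) * (N * C₂ * C₄)), fun Ω hΩ hb hi M vM vS hvM hvS g hg T hT => ?_⟩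
  set μ := (volume : Measure (Eucl d)).restrict (hull T) with hμ
  -- The maximum supplies $G\ge1$, used in comparing volumes and in merging powers of $G$.
  set G : ℝ := max M.shapeParameter 1 with hGdef
  have hcell := SimplicialMesh.isCell hT
  have hG1 : 1 ≤ G := le_max_right _ _
  have hρ := hcell.inradius_pos
  have hh := hcell.size_pos
  have hhG : size T ≤ G * inradius T :=
    (div_le_iff₀ hρ).1 ((SimplicialMesh.le_shapeParameter hT).trans (le_max_left _ _))
  -- the operator on the skeleton
  set s := M.skeletonOp p vS with hs
  have hS : eLpNorm s 2 μ ≤ ∑ F ∈ M.facesOf T, (N * C₂ * C₄ : ℝ≥0∞) *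
      (ENNReal.ofReal (size T ^ (1 / 2 : ℝ)) * ENNReal.ofReal G *
        eLpNorm vS 2 ((μHE[d - 1]).restrict (hull F))) := by
    refine (SimplicialMesh.eLpNorm_skeletonOp_le hΩ hb hi hd0 hT
      (fun F => C₂ * C₄ * (ENNReal.ofReal (size T ^ (1 / 2 : ℝ)) * ENNReal.ofReal G *
        eLpNorm vS 2 ((μHE[d - 1]).restrict (hull F)))) fun F hF hFT z hz => ?_).trans_eq ?_
    · obtain ⟨-, -, h1⟩ := hC₄ Ω hΩ hb hi M F hF vS
        (hvS.restrict_hull (SimplicialMesh.mem_faces_of_mem_interfaces hF))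
      have h2 := hC₂ T hcell G hG1 hhG F hFT (SimplicialMesh.exists_of_mem_interfaces hF).1
      calc ‖M.faceOp p F vS z‖ₑ * volume (hull T) ^ (1 / 2 : ℝ)
          ≤ ‖M.faceOp p F vS z‖ₑ * (C₂ * ENNReal.ofReal (size T ^ (1 / 2 : ℝ)) *
              ENNReal.ofReal G * μHE[d - 1] (hull F) ^ (1 / 2 : ℝ)) := by gcongr
        _ = C₂ * ENNReal.ofReal (size T ^ (1 / 2 : ℝ)) * ENNReal.ofReal G *
              (‖M.faceOp p F vS z‖ₑ * μHE[d - 1] (hull F) ^ (1 / 2 : ℝ)) := by ring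
        _ ≤ C₂ * ENNReal.ofReal (size T ^ (1 / 2 : ℝ)) * ENNReal.ofReal G *
              (C₄ * eLpNorm vS 2 ((μHE[d - 1]).restrict (hull F))) := by
            exact mul_le_mul' le_rfl (h1 z hz)
        _ = _ := by ring
    · refine Finset.sum_congr rfl fun F _ => ?_
      have hN : (N : ℝ≥0∞) = (((p + 1) ^ (d + 1) * p ^ p * d ^ d : ℕ) : ℝ≥0∞) := rfl
      rw [hN]
      ring
  -- the smoother
  set b := M.cellOp p T fun y => vM y - s y with hbdef
  have hres := SimplicialMesh.memLp_residual (p := p) hΩ hb hi hd0 hT hvM vS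
  obtain ⟨-, hbop, hble⟩ := hC₃ Ω hΩ hb hi M T hT _ hres
  have hsL := SimplicialMesh.memLp_skeletonOp (p := p) hΩ hb hi hd0 hT vS
  have hvL := hvM.restrict_hull hi hT
  have hfin : volume (hull T) < ⊤ := isCompact_hull.measure_lt_top
  have hU : eLpNorm (M.smoother p vM vS) 2 μ ≤
      eLpNorm s 2 μ + K * (eLpNorm vM 2 μ + eLpNorm s 2 μ) := by
    calc eLpNorm (M.smoother p vM vS) 2 μ
        = eLpNorm (s + fun x => b x * M.bubble T x) 2 μ := by
          refine eLpNorm_congr_ae ((ae_restrict_iff' isClosed_hull.measurableSet).2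
            (.of_forall fun x hx => ?_))
          exact SimplicialMesh.smoother_eq_on_cell hΩ hb hi vM vS hT hx
      _ ≤ eLpNorm s 2 μ + eLpNorm (fun x => b x * M.bubble T x) 2 μ := by
          refine eLpNorm_add_le hsL.1 ?_ (by norm_num)
          exact ((hbop.1.mul (SimplicialMesh.isPolyOn_bubble hT T)).memLp (r := 2) hfin).1
      _ ≤ eLpNorm s 2 μ + ((d + 1) ^ (d + 1) : ℕ) * eLpNorm b 2 μ := by
          gcongr
          have h1 : ((((d + 1) ^ (d + 1) : ℕ) : ℝ≥0) : ℝ≥0∞) = (((d + 1) ^ (d + 1) : ℕ) : ℝ≥0∞) :=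
            rfl
          rw [← h1]
          change _ ≤ (((d + 1) ^ (d + 1) : ℕ) : ℝ≥0) • eLpNorm b 2 μ
          refine eLpNorm_le_nnreal_smul_eLpNorm_of_ae_le_mul (.of_forall fun x => ?_) 2
          rw [nnnorm_mul, mul_comm]
          gcongr
          rw [← NNReal.coe_le_coe, coe_nnnorm,
            Real.norm_of_nonneg (SimplicialMesh.bubble_nonneg T x)]
          have := SimplicialMesh.bubble_le (M := M) T x
          rw [M.card_eq T hT] at this
          exact_mod_cast this
      _ ≤ eLpNorm s 2 μ + ((d + 1) ^ (d + 1) : ℕ) * (C₃ * (eLpNorm vM 2 μ + eLpNorm s 2 μ)) := by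
          gcongr
          refine hble.trans ?_
          gcongr
          exact eLpNorm_sub_le hvL.1 hsL.1 (by norm_num)
      _ = _ := by
          have h1 : (K : ℝ≥0∞) = (((d + 1) ^ (d + 1) : ℕ) : ℝ≥0∞) * C₃ := by
            simp only [K, ENNReal.coe_mul]; rfl
          rw [h1, mul_assoc]
  -- the gradient
  obtain ⟨P, hP, hPp, hUP⟩ :=
    (SimplicialMesh.isPolyOn_smoother (p := p) hΩ hb hi hd0 hT hvM vS).exists_contDiff
  have hint : hull T =ᵐ[volume] interior (hull T) :=
    (interior_ae_eq_of_null_frontier (convex_hull.addHaar_frontier volume)).symm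
  have hgP : g =ᵐ[μ] gradient P := by
    rw [hμ, Measure.restrict_congr_set hint]
    exact hg.ae_eq_gradient isOpen_interior (SimplicialMesh.interior_hull_subset hi hT) hP
      fun x hx => hUP x (interior_subset hx)
  have hgrad : eLpNorm g 2 μ ≤
      C₁ * ENNReal.ofReal (inradius T)⁻¹ * eLpNorm (M.smoother p vM vS) 2 μ := by
    rw [eLpNorm_congr_ae hgP]
    refine (hC₁ T hcell P hPp).trans_eq ?_
    congr 1
    exact eLpNorm_congr_ae ((ae_restrict_iff' isClosed_hull.measurableSet).2
      (.of_forall fun x hx => (hUP x hx).symm))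
  -- Passing from $r_T^{-1}$ to $h_T^{-1}$ costs one factor $G$. The second one comes from the
  -- volume comparison in the skeleton part.
  have hinv : ENNReal.ofReal (inradius T)⁻¹ ≤ ENNReal.ofReal G * ENNReal.ofReal (size T)⁻¹ := by
    rw [← ENNReal.ofReal_mul (by positivity)]
    refine ENNReal.ofReal_le_ofReal ?_
    rw [← div_eq_mul_inv, le_div_iff₀ hh, inv_mul_le_iff₀ hρ, mul_comm]
    exact hhG
  have hG1' : (1 : ℝ≥0∞) ≤ ENNReal.ofReal G := by
    rw [← ENNReal.ofReal_one]; exact ENNReal.ofReal_le_ofReal hG1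
  set V := eLpNorm vM 2 μ
  set W : Finset (Eucl d) → ℝ≥0∞ := fun F => eLpNorm vS 2 ((μHE[d - 1]).restrict (hull F))
  set H := ENNReal.ofReal (size T)⁻¹
  set g' := ENNReal.ofReal G
  -- The powers combine to $h_T^{-1}h_T^{1/2}=h_T^{-1/2}\le h_F^{-1/2}$, because a face has at most
  -- the diameter of the cell.
  have hface : ∀ F ∈ M.facesOf T, H * ENNReal.ofReal (size T ^ (1 / 2 : ℝ)) ≤
      ENNReal.ofReal (size F ^ (-(1 / 2) : ℝ)) := by
    classical
    intro F hF
    obtain ⟨hF, hFT⟩ := Finset.mem_filter.1 hF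
    obtain ⟨-, -, -, hcard⟩ := SimplicialMesh.mem_faces.1 hF
    have hFpos : 0 < size F := size_pos_of_one_lt_card (by omega)
    rw [← ENNReal.ofReal_mul (by positivity)]
    refine ENNReal.ofReal_le_ofReal ?_
    rw [← Real.rpow_neg_one, ← Real.rpow_add hh]
    calc size T ^ ((-1 : ℝ) + 1 / 2) = size T ^ (-(1 / 2) : ℝ) := by norm_num
      _ ≤ _ := Real.rpow_le_rpow_of_nonpos hFpos (size_mono hFT) (by norm_num)
  have hHS : H * eLpNorm s 2 μ ≤ (N * C₂ * C₄ : ℝ≥0∞) * g' *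
      ∑ F ∈ M.facesOf T, ENNReal.ofReal (size F ^ (-(1 / 2) : ℝ)) * W F := by
    refine (mul_le_mul' le_rfl hS).trans ?_
    rw [Finset.mul_sum, Finset.mul_sum]
    refine Finset.sum_le_sum fun F hF => ?_
    calc H * ((N * C₂ * C₄ : ℝ≥0∞) * (ENNReal.ofReal (size T ^ (1 / 2 : ℝ)) * g' * W F))
        = (N * C₂ * C₄ : ℝ≥0∞) * g' * (H * ENNReal.ofReal (size T ^ (1 / 2 : ℝ)) * W F) := by ring
      _ ≤ _ := by
        gcongr
        exact hface F hF
  set R := ∑ F ∈ M.facesOf T, ENNReal.ofReal (size F ^ (-(1 / 2) : ℝ)) * W F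
  calc eLpNorm g 2 μ
      ≤ C₁ * (g' * H) * (eLpNorm s 2 μ + K * (V + eLpNorm s 2 μ)) := by
        refine hgrad.trans ?_
        gcongr
    _ = C₁ * g' * (K * (H * V) + (1 + K) * (H * eLpNorm s 2 μ)) := by ring
    _ ≤ C₁ * g' * (K * (H * V) + (1 + K) * ((N * C₂ * C₄ : ℝ≥0∞) * g' * R)) := by gcongr
    _ ≤ C₁ * g' * (g' * (K + (1 + K) * (N * C₂ * C₄ : ℝ≥0∞)) * (H * V + R)) := by
        gcongr
        -- The volume term carries no factor $G$ yet; inserting one by $G\ge1$ allows a common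
        -- constant for both terms.
        calc K * (H * V) + (1 + K) * ((N * C₂ * C₄ : ℝ≥0∞) * g' * R)
            ≤ g' * (K * (H * V)) + g' * ((1 + K) * (N * C₂ * C₄ : ℝ≥0∞) * R) := by
              refine add_le_add (le_mul_of_one_le_left zero_le hG1') (le_of_eq (by ring))
          _ ≤ g' * ((K + (1 + K) * (N * C₂ * C₄ : ℝ≥0∞)) * (H * V)) +
                g' * ((K + (1 + K) * (N * C₂ * C₄ : ℝ≥0∞)) * R) := by
              gcongr
              · exact le_self_add
              · exact le_add_self
          _ = _ := by ring
    _ = _ := by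
        rw [ENNReal.ofReal_mul (by positivity), ENNReal.ofReal_coe_nnreal,
          ENNReal.ofReal_pow (by linarith)]
        push_cast
        ring

end Main

end BubbleSmoother

/-! ### The main theorem -/

open BubbleSmoother in
theorem mainTheorem6 :
    ∃ C : ℝ → ℕ → ℝ, (∀ p : ℕ, Monotone fun γ => C γ p) ∧ (∀ γ : ℝ, Monotone (C γ)) ∧
      ∀ d : ℕ, d = 2 ∨ d = 3 → ∀ Ω : Set (BubbleSmoother.Eucl d),
      IsOpen Ω → Bornology.IsBounded Ω → interior (closure Ω) = Ω →
      ∀ (M : BubbleSmoother.SimplicialMesh Ω) (p : ℕ),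
        -- the bubbles, the Lagrange basis and the local operators are well defined
        (∀ T ∈ M.cells, ∃! Φ : BubbleSmoother.Eucl d → ℝ, M.IsElementBubble T Φ) ∧
        (∀ F ∈ M.interfaces, ∃! Φ : BubbleSmoother.Eucl d → ℝ, M.IsFaceBubble F Φ) ∧
        (1 ≤ p → ∀ z ∈ M.nodes p,
          ∃! Φ : BubbleSmoother.Eucl d → ℝ, M.IsLagrangeBasis p z Φ) ∧
        (∀ T ∈ M.cells, ∀ v : BubbleSmoother.Eucl d → ℝ, M.MemL2Cells v →
          ∃! b : BubbleSmoother.Eucl d → ℝ, M.IsCellOp p T v b) ∧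
        (∀ F ∈ M.interfaces, ∀ v : BubbleSmoother.Eucl d → ℝ, M.MemL2Skeleton v →
          ∃! b : BubbleSmoother.Eucl d → ℝ, M.IsFaceOp p F v b) ∧
        -- the smoother depends only on the classes in `L²(Ω) × L²(Σ)`, and it is linear
        (∀ vM vS wM wS : BubbleSmoother.Eucl d → ℝ,
          M.MemL2Cells vM → M.MemL2Skeleton vS → M.MemL2Cells wM → M.MemL2Skeleton wS →
          (vM =ᵐ[volume.restrict Ω] wM → vS =ᵐ[(μHE[d - 1]).restrict M.skeleton] wS →
            M.smoother p vM vS = M.smoother p wM wS) ∧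
          ∀ a b : ℝ, M.smoother p (a • vM + b • wM) (a • vS + b • wS) =
            a • M.smoother p vM vS + b • M.smoother p wM wS) ∧
        ∀ vM vS : BubbleSmoother.Eucl d → ℝ, M.MemL2Cells vM → M.MemL2Skeleton vS →
          -- values in `H¹₀(Ω)`; continuity makes the restriction to a face the trace
          BubbleSmoother.MemH10 Ω (M.smoother p vM vS) ∧
          Continuous (M.smoother p vM vS) ∧
          -- preservation of the moments in the cells and on the interfaces
          (∀ T ∈ M.cells, ∀ q : BubbleSmoother.Eucl d → ℝ,
            BubbleSmoother.IsPolyOn ((p : ℤ) - 1) (BubbleSmoother.hull T) q →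
            ∫ x in BubbleSmoother.hull T, q x * M.smoother p vM vS x =
              ∫ x in BubbleSmoother.hull T, q x * vM x) ∧
          (∀ F ∈ M.interfaces, ∀ r : BubbleSmoother.Eucl d → ℝ,
            BubbleSmoother.IsPolyOn (p : ℤ) (BubbleSmoother.hull F) r →
            ∫ x in BubbleSmoother.hull F, r x * M.smoother p vM vS x ∂μHE[d - 1] =
              ∫ x in BubbleSmoother.hull F, r x * vS x ∂μHE[d - 1]) ∧
          -- the local stability estimate
          (∀ g : BubbleSmoother.Eucl d → BubbleSmoother.Eucl d,
            BubbleSmoother.HasWeakGradient Ω (M.smoother p vM vS) g →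
            ∀ T ∈ M.cells,
              eLpNorm g 2 (volume.restrict (BubbleSmoother.hull T)) ≤
                ENNReal.ofReal (C M.shapeParameter p) *
                  (ENNReal.ofReal (BubbleSmoother.size T)⁻¹ *
                      eLpNorm vM 2 (volume.restrict (BubbleSmoother.hull T)) +
                    ∑ F ∈ M.facesOf T,
                      ENNReal.ofReal ((BubbleSmoother.size F) ^ (-(1 / 2) : ℝ)) *
                        eLpNorm vS 2 ((μHE[d - 1]).restrict (BubbleSmoother.hull F)))) := by
  choose c₂ hc₂ using BubbleSmoother.exists_smoother_le 2 (.inl rfl)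
  choose c₃ hc₃ using BubbleSmoother.exists_smoother_le 3 (.inr rfl)
  have hsum : Monotone fun p : ℕ => ∑ j ∈ Finset.range (p + 1), ((c₂ j : ℝ) + c₃ j) :=
    fun p q hpq => Finset.sum_le_sum_of_subset_of_nonneg
      (Finset.range_mono (Nat.succ_le_succ hpq)) fun _ _ _ => by positivity
  -- Summing the constants over all degrees up to $p$ makes the result monotone in $p$, and adding
  -- those for $d=2$ and $d=3$ makes it independent of the dimension.
  refine ⟨fun γ p => (∑ j ∈ Finset.range (p + 1), ((c₂ j : ℝ) + c₃ j)) * max γ 1 ^ 2,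
    fun p γ γ' h => ?_, fun γ p q h => ?_, fun d hd Ω hΩ hb hi M p => ?_⟩
  · have : max γ 1 ≤ max γ' 1 := max_le_max h le_rfl
    dsimp only
    gcongr
  · exact mul_le_mul_of_nonneg_right (hsum h) (by positivity)
  have hd0 : 0 < d := by omega
  refine ⟨fun T hT => ⟨_, (SimplicialMesh.isElementBubble_iff hΩ hb hi hT).2 rfl,
      fun Φ hΦ => (SimplicialMesh.isElementBubble_iff hΩ hb hi hT).1 hΦ⟩,
    fun F hF => ⟨_, (SimplicialMesh.isFaceBubble_iff hΩ hb hi hd0 hF).2 rfl,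
      fun Φ hΦ => (SimplicialMesh.isFaceBubble_iff hΩ hb hi hd0 hF).1 hΦ⟩,
    fun hp z hz => SimplicialMesh.existsUnique_lagrangeBasis hΩ hb hp hz,
    fun T hT v hv => ?_, fun F hF v hv => ?_,
    fun vM vS wM wS hvM hvS hwM hwS => ⟨fun h h' => SimplicialMesh.smoother_congr hΩ hb hi hd0 h h',
      fun a b => SimplicialMesh.smoother_comb hΩ hb hi hd0 hvM hvS hwM hwS a b⟩,
    fun vM vS hvM hvS => ?_⟩
  · obtain ⟨C, hC⟩ := exists_cellOp d p
    exact (hC Ω hΩ hb hi M T hT v (hv.restrict_hull hi hT)).1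
  · obtain ⟨C, hC⟩ := exists_faceOp d hd0 p
    exact (hC Ω hΩ hb hi M F hF v
      (hv.restrict_hull (SimplicialMesh.mem_faces_of_mem_interfaces hF))).1
  obtain ⟨C, hC⟩ := SimplicialMesh.exists_lipschitzWith_smoother (p := p) hΩ hb hi hd0 hvM vS
  refine ⟨memH10_of_lipschitz hΩ hb hC fun x hx =>
      SimplicialMesh.smoother_of_notMem hΩ hb hi hd0 vM vS hx, hC.continuous,
    fun T hT q hq => SimplicialMesh.integral_smoother_cell hΩ hb hi hd0 hvM vS hT hq,
    fun F hF r hr => SimplicialMesh.integral_smoother_interface hΩ hb hi hd0 vM hvS hF hr,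
    fun g hg T hT => ?_⟩
  have key : ∃ c : ℝ, c ≤ ∑ j ∈ Finset.range (p + 1), ((c₂ j : ℝ) + c₃ j) ∧
      eLpNorm g 2 (volume.restrict (hull T)) ≤
        ENNReal.ofReal (c * max M.shapeParameter 1 ^ 2) *
          (ENNReal.ofReal (size T)⁻¹ * eLpNorm vM 2 (volume.restrict (hull T)) +
            ∑ F ∈ M.facesOf T, ENNReal.ofReal ((size F) ^ (-(1 / 2) : ℝ)) *
              eLpNorm vS 2 ((μHE[d - 1]).restrict (hull F))) := by
    have hle := Finset.single_le_sum (f := fun j => (c₂ j : ℝ) + c₃ j)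
      (fun _ _ => by positivity) (Finset.self_mem_range_succ p)
    rcases hd with rfl | rfl
    · exact ⟨c₂ p, (le_add_of_nonneg_right (c₃ p).2).trans hle,
        hc₂ p Ω hΩ hb hi M vM vS hvM hvS g hg T hT⟩
    · exact ⟨c₃ p, (le_add_of_nonneg_left (c₂ p).2).trans hle,
        hc₃ p Ω hΩ hb hi M vM vS hvM hvS g hg T hT⟩
  obtain ⟨c, hc, hle⟩ := key
  refine hle.trans ?_
  gcongr
  exact mul_le_mul_of_nonneg_right hc (by positivity)
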